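/- Let $S$ be a scheme, with structure sheaf $\mathscr{O}_S$. All bundles are locally free $\mathscr{O}_S$-modules of constant finite rank, and $E^\vee=\mathcal{H}om(E,\mathscr{O}_S)$. *Conventions.* A quadratic form $(E,q,L)$ on $S$ is a vector bundle $E$, a line bundle $L$ and a morphism of sheaves $q:E\to L$ that is quadratic, i.e. $q(av)=a^2q(v)$ for sections $a$ of $\mathscr{O}_S$ and $v$ of $E$, and $b_q(v,w)=q(v+w)-q(v)-q(w)$ is $\mathscr{O}_S$-bilinear; it is *primitive* if $q$ generates $L$, i.e. the induced morphism $S_2E\to L$ from the symmetric tensors in $E\otimes E$ is an epimorphism. An isomorphism of forms with the same value bundle $L$ is an isomorphism of the bundles compatible with the forms, and $\perp$ is the orthogonal sum. For a line bundle $N$, $H_L(N)$ is the quadratic form $(v,f)\mapsto f(v)$ on $N\oplus\mathcal{H}om(N,L)$ with values in $L$. The *even Clifford algebra* $\mathcal{C}_0(q)$ is the quotient of the tensor algebra $T(E\otimes E\otimes L^\vee)$ by the two-sided ideal generated by the local sections $$v\otimes v\otimes f-f(q(v)),\qquad (u\otimes v\otimes f)\otimes(v\otimes w\otimes g)-f(q(v))\,u\otimes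 w\otimes g .$$ The *odd Clifford bimodule* $\mathcal{C}_1(q)$, with its right $\mathcal{C}_0(q)$-module structure, is the quotient of $E\otimes\mathcal{C}_0(q)$ by the right submodule generated by the local sections $v\otimes[v\otimes w\otimes f]-f(q(v))\,w\otimes 1$. $\mathscr{O}_S$-algebras $\mathcal{A}$ and $\mathcal{A}'$ are *Morita $S$-equivalent* if the fibered categories (over the open subsets of $S$) of finitely presented right modules over $\mathcal{A}$ and over $\mathcal{A}'$ are equivalent over $S$, by an equivalence which induces $\mathscr{O}_S$-module isomorphisms on $\mathcal{H}om$ sheaves. The *center* $\mathcal{Z}(q)$ of $\mathcal{C}_0(q)$ is the subsheaf of sections that commute with all local sections. **Proposition.** Let $(E,q,L)$ and $(E',q',L)$ be quadratic forms on $S$ with values in the same line bundle $L$, with $q'$ primitive, and let $N$ be a line bundle with $(E,q,L)\cong H_L(N)\perp(E',q',L)$. Put $\mathcal{P}=\mathcal{C}_0(q')\oplus N^\vee\otimes\mathcal{C}_1(q')$. Then: 1. $\mathcal{P}$ is a locally free right $\mathcal{C}_0(q')$-module of rank $2$, and there is an isomorphism of $\mathscr{O}_S$-algebras $\mathcal{C}_0(q)\cong\mathcal{E}nd_{\mathcal{C}_0(q')}(\mathcal{P})$.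 2. $\mathcal{C}_0(q)$ and $\mathcal{C}_0(q')$ are Morita $S$-equivalent. 3. The isomorphism in (1) can be chosen such that, if moreover $S$ is integral and locally factorial (all its local rings are unique factorization domains) and $E$ has even rank, then there is an isomorphism of $\mathscr{O}_S$-algebras $\zeta:\mathcal{Z}(q)\cong\mathcal{Z}(q')$ with $z\cdot p=p\cdot\zeta(z)$ for all local sections $z$ of $\mathcal{Z}(q)$ and $p$ of $\mathcal{P}$, where $z$ acts on $\mathcal{P}$ from the left through the isomorphism in (1). -/

import Mathlib

universe u

open scoped TensorProduct

noncomputable section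

namespace EvenClifford

section Algebra

variable {R E L D P : Type*} [CommRing R] [AddCommGroup E] [Module R E]
  [AddCommGroup L] [Module R L] [AddCommGroup D] [Module R D] [AddCommGroup P] [Module R P]

/-- The relations of the even Clifford algebra of `(E, q, L)`, in the tensor algebra of
`E ⊗ E ⊗ D`, where `D` is the dual of `L`, with evaluation pairing `ev`. -/
inductive Rel (q : QuadraticMap R E L) (ev : D →ₗ[R] L →ₗ[R] R) :
    TensorAlgebra R (E ⊗[R] E ⊗[R] D) → TensorAlgebra R (E ⊗[R] E ⊗[R] D) → Prop
  | sq (v : E) (f : D) :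
      Rel q ev (TensorAlgebra.ι R (v ⊗ₜ[R] v ⊗ₜ[R] f)) (algebraMap R _ (ev f (q v)))
  | contract (u v w : E) (f g : D) :
      Rel q ev (TensorAlgebra.ι R (u ⊗ₜ[R] v ⊗ₜ[R] f) * TensorAlgebra.ι R (v ⊗ₜ[R] w ⊗ₜ[R] g))
        (ev f (q v) • TensorAlgebra.ι R (u ⊗ₜ[R] w ⊗ₜ[R] g))

/-- The even Clifford algebra. -/
def C0 (q : QuadraticMap R E L) (ev : D →ₗ[R] L →ₗ[R] R) : Type _ := RingQuot (Rel q ev)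

variable (q : QuadraticMap R E L) (ev : D →ₗ[R] L →ₗ[R] R)

instance : Ring (C0 q ev) := inferInstanceAs (Ring (RingQuot (Rel q ev)))
instance : Algebra R (C0 q ev) := inferInstanceAs (Algebra R (RingQuot (Rel q ev)))

/-- The class of a generator `v ⊗ w ⊗ f`. -/
def C0.ι : E ⊗[R] E ⊗[R] D →ₗ[R] C0 q ev :=
  (RingQuot.mkAlgHom R (Rel q ev)).toLinearMap ∘ₗ TensorAlgebra.ι R

theorem C0.ι_sq (v : E) (f : D) :
    C0.ι q ev (v ⊗ₜ v ⊗ₜ f) = algebraMap R _ (ev f (q v)) :=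
  (RingQuot.mkAlgHom_rel R (Rel.sq (q := q) (ev := ev) v f)).trans (AlgHom.commutes _ _)

theorem C0.ι_contract (u v w : E) (f g : D) :
    C0.ι q ev (u ⊗ₜ v ⊗ₜ f) * C0.ι q ev (v ⊗ₜ w ⊗ₜ g) =
      ev f (q v) • C0.ι q ev (u ⊗ₜ w ⊗ₜ g) := by
  have h := RingQuot.mkAlgHom_rel R (Rel.contract (q := q) (ev := ev) u v w f g)
  rw [map_mul, map_smul] at h
  exact h

variable {q ev} in
theorem C0.induction {p : C0 q ev → Prop} (h₀ : ∀ r, p (algebraMap R _ r))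
    (h₁ : ∀ t, p (C0.ι q ev t)) (hm : ∀ a b, p a → p b → p (a * b))
    (ha : ∀ a b, p a → p b → p (a + b)) (x : C0 q ev) : p x := by
  obtain ⟨y, rfl⟩ := RingQuot.mkAlgHom_surjective R (Rel q ev) x
  induction y using TensorAlgebra.induction with
  | algebraMap r => rw [AlgHom.commutes]; exact h₀ r
  | ι x => exact h₁ x
  | mul a b h k => rw [map_mul]; exact hm _ _ h k
  | add a b h k => rw [map_add]; exact ha _ _ h k

variable {q ev} in
theorem C0.ringHom_ext {A : Type*} [Semiring A] {F G : C0 q ev →+* A}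
    (h₀ : ∀ r : R, F (algebraMap R _ r) = G (algebraMap R _ r))
    (h₁ : ∀ t, F (C0.ι q ev t) = G (C0.ι q ev t)) : F = G := by
  ext x
  induction x using C0.induction with
  | h₀ r => exact h₀ r
  | h₁ t => exact h₁ t
  | hm a b h k => rw [map_mul, map_mul, h, k]
  | ha a b h k => rw [map_add, map_add, h, k]

/-- The universal property of the even Clifford algebra. -/
def C0.lift {A : Type*} [Ring A] [Algebra R A] (g : E ⊗[R] E ⊗[R] D →ₗ[R] A)
    (h₁ : ∀ v f, g (v ⊗ₜ v ⊗ₜ f) = algebraMap R A (ev f (q v)))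
    (h₂ : ∀ u v w f f', g (u ⊗ₜ v ⊗ₜ f) * g (v ⊗ₜ w ⊗ₜ f') =
      ev f (q v) • g (u ⊗ₜ w ⊗ₜ f')) : C0 q ev →ₐ[R] A :=
  RingQuot.liftAlgHom R ⟨TensorAlgebra.lift R g, by
    rintro _ _ (⟨v, f⟩ | ⟨u, v, w, f, f'⟩)
    · rw [TensorAlgebra.lift_ι_apply, h₁, AlgHom.commutes]
    · rw [map_mul, map_smul, TensorAlgebra.lift_ι_apply, TensorAlgebra.lift_ι_apply,
        TensorAlgebra.lift_ι_apply, h₂]⟩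

theorem C0.lift_ι {A : Type*} [Ring A] [Algebra R A] (g : E ⊗[R] E ⊗[R] D →ₗ[R] A)
    (h₁ : ∀ v f, g (v ⊗ₜ v ⊗ₜ f) = algebraMap R A (ev f (q v)))
    (h₂ : ∀ u v w f f', g (u ⊗ₜ v ⊗ₜ f) * g (v ⊗ₜ w ⊗ₜ f') =
      ev f (q v) • g (u ⊗ₜ w ⊗ₜ f')) (t : E ⊗[R] E ⊗[R] D) :
    C0.lift q ev g h₁ h₂ (C0.ι q ev t) = g t := by
  change RingQuot.liftAlgHom R _ (RingQuot.mkAlgHom R _ (TensorAlgebra.ι R t)) = _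
  rw [RingQuot.liftAlgHom_mkAlgHom_apply, TensorAlgebra.lift_ι_apply]

/-- The relations `v · (v ⊗ w ⊗ f) = f(q(v)) w` of the odd Clifford bimodule. -/
def C1.rel : Submodule (C0 q ev)ᵐᵒᵖ (C0 q ev ⊗[R] E) :=
  Submodule.span _ {x | ∃ (v w : E) (f : D),
    x = C0.ι q ev (v ⊗ₜ[R] w ⊗ₜ[R] f) ⊗ₜ[R] v - ev f (q v) • (1 ⊗ₜ[R] w)}

/-- The odd Clifford bimodule `C₁`, as a right `C₀`-module: the quotient of `E ⊗ C₀` by the right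
submodule `C1.rel`.  The element `e ⊗ c` is written `c ⊗ₜ e`, and right modules are modules over
the opposite ring. -/
abbrev C1 : Type _ := (C0 q ev ⊗[R] E) ⧸ C1.rel q ev

variable (P) in
/-- The right `C₀`-module `C₀ ⊕ C₁ ⊗ P`. -/
abbrev Bimod : Type _ := C0 q ev × (C1 q ev ⊗[R] P)

section Map

variable {R' E' L' D' P' : Type*} [CommRing R'] [AddCommGroup E'] [Module R' E']
  [AddCommGroup L'] [Module R' L'] [AddCommGroup D'] [Module R' D'] [AddCommGroup P'] [Module R' P']
  {σ : R →+* R'} {q : QuadraticMap R E L} {ev : D →ₗ[R] L →ₗ[R] R}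
  {q' : QuadraticMap R' E' L'} {ev' : D' →ₗ[R'] L' →ₗ[R'] R'}
  (a : E →ₛₗ[σ] E') (d : D →ₛₗ[σ] D')
  (h : ∀ f x, ev' (d f) (q' (a x)) = σ (ev f (q x)))
  (n : P →ₛₗ[σ] P')

def C0.map : C0 q ev →+* C0 q' ev' :=
  letI : Algebra R (C0 q' ev') := Algebra.compHom _ σ
  (C0.lift q ev (A := C0 q' ev')
    { toFun := fun t => C0.ι q' ev' (TensorProduct.map (TensorProduct.map a a) d t)
      map_add' := fun x y => by simp only [map_add]
      map_smul' := fun r x => by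
        simp only [LinearMap.map_smulₛₗ, map_smul]; rfl }
    (fun v f => by
      change C0.ι q' ev' (a v ⊗ₜ a v ⊗ₜ d f) = _
      rw [C0.ι_sq, h]; rfl)
    (fun u v w f f' => by
      change C0.ι q' ev' (a u ⊗ₜ a v ⊗ₜ d f) * C0.ι q' ev' (a v ⊗ₜ a w ⊗ₜ d f') = _
      rw [C0.ι_contract, h]; rfl)).toRingHom

theorem C0.map_algebraMap (r : R) :
    C0.map a d h (algebraMap R _ r) = algebraMap R' _ (σ r) := by
  let _ : Algebra R (C0 q' ev') := Algebra.compHom _ σ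
  exact AlgHom.commutes (C0.lift q ev (A := C0 q' ev') _ _ _) r

theorem C0.map_ι (t : E ⊗[R] E ⊗[R] D) :
    C0.map a d h (C0.ι q ev t) =
      C0.ι q' ev' (TensorProduct.map (TensorProduct.map a a) d t) := by
  let _ : Algebra R (C0 q' ev') := Algebra.compHom _ σ
  exact C0.lift_ι q ev (A := C0 q' ev') _ _ _ t

/-- `C0.map` as a semilinear map over the base rings. -/
def C0.mapₛₗ : C0 q ev →ₛₗ[σ] C0 q' ev' where
  toFun := C0.map a d h
  map_add' := map_add _
  map_smul' r x := by
    rw [Algebra.smul_def, map_mul, C0.map_algebraMap, ← Algebra.smul_def]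

/-- The map `e ⊗ c ↦ a e ⊗ map c`. -/
def C1.preMap : C0 q ev ⊗[R] E →ₛₗ[(C0.map a d h).op] C0 q' ev' ⊗[R'] E' where
  toFun := TensorProduct.map (C0.mapₛₗ a d h) a
  map_add' := map_add _
  map_smul' c x := by
    induction x with
    | zero => simp
    | tmul x e =>
      change (C0.map a d h (x * c.unop)) ⊗ₜ a e = (C0.map a d h x * C0.map a d h c.unop) ⊗ₜ a e
      rw [map_mul]
    | add x y hx hy => rw [smul_add, map_add, map_add, smul_add, hx, hy]

theorem C1.rel_le : C1.rel q ev ≤ (C1.rel q' ev').comap (C1.preMap a d h) := by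
  refine Submodule.span_le.2 ?_
  rintro _ ⟨v, w, f, rfl⟩
  refine Submodule.subset_span ⟨a v, a w, d f, ?_⟩
  rw [map_sub]
  change C0.map a d h _ ⊗ₜ a v - TensorProduct.map (C0.mapₛₗ a d h) a _ = _
  rw [C0.map_ι, LinearMap.map_smulₛₗ, h]
  congr 2
  change C0.map a d h 1 ⊗ₜ a w = _
  rw [map_one]

def C1.map : C1 q ev →ₛₗ[(C0.map a d h).op] C1 q' ev' :=
  (C1.rel q ev).mapQ (C1.rel q' ev') (C1.preMap a d h) (C1.rel_le a d h)

def C1.mapₛₗ : C1 q ev →ₛₗ[σ] C1 q' ev' where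
  toFun := C1.map a d h
  map_add' := map_add _
  map_smul' r x := by
    obtain ⟨x, rfl⟩ := Submodule.Quotient.mk_surjective _ x
    exact congrArg (Submodule.Quotient.mk (p := C1.rel q' ev'))
      ((TensorProduct.map (C0.mapₛₗ a d h) a).map_smulₛₗ r x)

def Bimod.map : Bimod P q ev →ₛₗ[(C0.map a d h).op] Bimod P' q' ev' where
  toFun x := (C0.map a d h x.1, TensorProduct.map (C1.mapₛₗ a d h) n x.2)
  map_add' x y := by simp only [Prod.fst_add, Prod.snd_add, map_add, Prod.mk_add_mk]
  map_smul' c x := by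
    obtain ⟨x, y⟩ := x
    refine Prod.ext (map_mul _ _ _) ?_
    change TensorProduct.map (C1.mapₛₗ a d h) n (c • y) =
      (C0.map a d h).op c • TensorProduct.map (C1.mapₛₗ a d h) n y
    induction y with
    | zero => simp
    | tmul x e => exact congrArg (· ⊗ₜ[R'] n e) ((C1.map a d h).map_smulₛₗ c x)
    | add x y hx hy => rw [smul_add, map_add, map_add, smul_add, hx, hy]

end Map

section Functoriality

variable {R' E' L' D' P' : Type*} [CommRing R'] [AddCommGroup E'] [Module R' E']
  [AddCommGroup L'] [Module R' L'] [AddCommGroup D'] [Module R' D'] [AddCommGroup P'] [Module R' P']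
  {R'' E'' L'' D'' P'' : Type*} [CommRing R''] [AddCommGroup E''] [Module R'' E'']
  [AddCommGroup L''] [Module R'' L''] [AddCommGroup D''] [Module R'' D'']
  [AddCommGroup P''] [Module R'' P'']
  {q : QuadraticMap R E L} {ev : D →ₗ[R] L →ₗ[R] R}
  {q' : QuadraticMap R' E' L'} {ev' : D' →ₗ[R'] L' →ₗ[R'] R'}
  {q'' : QuadraticMap R'' E'' L''} {ev'' : D'' →ₗ[R''] L'' →ₗ[R''] R''}

theorem C0.map_id' {σ : R →+* R} (a : E →ₛₗ[σ] E) (d : D →ₛₗ[σ] D)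
    (h : ∀ f x, ev (d f) (q (a x)) = σ (ev f (q x)))
    (hσ : ∀ r, σ r = r) (ha : ∀ x, a x = x) (hd : ∀ x, d x = x) (x : C0 q ev) :
    C0.map a d h x = x := by
  refine RingHom.congr_fun (g := RingHom.id _) (C0.ringHom_ext (fun r => ?_) fun t => ?_) x
  · rw [C0.map_algebraMap, hσ]; rfl
  · rw [C0.map_ι, RingHom.id_apply]
    congr 1
    induction t with
    | zero => simp
    | tmul y f =>
      rw [TensorProduct.map_tmul, hd]
      congr 1
      induction y with
      | zero => simp
      | tmul u v => rw [TensorProduct.map_tmul, ha, ha]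
      | add x y hx hy => rw [map_add, hx, hy]
    | add x y hx hy => rw [map_add, hx, hy]

theorem Bimod.map_id' {σ : R →+* R} (a : E →ₛₗ[σ] E) (d : D →ₛₗ[σ] D)
    (h : ∀ f x, ev (d f) (q (a x)) = σ (ev f (q x))) (n : P →ₛₗ[σ] P)
    (hσ : ∀ r, σ r = r) (ha : ∀ x, a x = x) (hd : ∀ x, d x = x) (hn : ∀ x, n x = x)
    (x : Bimod P q ev) : Bimod.map a d h n x = x := by
  have h0 := C0.map_id' a d h hσ ha hd
  have h1 : ∀ x, C1.mapₛₗ a d h x = x := fun x => by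
    obtain ⟨x, rfl⟩ := Submodule.Quotient.mk_surjective _ x
    refine congrArg (Submodule.Quotient.mk (p := C1.rel q ev)) ?_
    change TensorProduct.map (C0.mapₛₗ a d h) a x = x
    induction x with
    | zero => simp
    | tmul c e => exact congrArg₂ (· ⊗ₜ[R] ·) (h0 c) (ha e)
    | add x y hx hy => rw [map_add, hx, hy]
  obtain ⟨x, y⟩ := x
  refine Prod.ext (h0 x) ?_
  change TensorProduct.map (C1.mapₛₗ a d h) n y = y
  induction y with
  | zero => simp
  | tmul c e => rw [TensorProduct.map_tmul, h1, hn]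
  | add x y hx hy => rw [map_add, hx, hy]

variable {σ : R →+* R'} {τ : R' →+* R''} {ρ : R →+* R''}
  (a : E →ₛₗ[σ] E') (d : D →ₛₗ[σ] D') (h : ∀ f x, ev' (d f) (q' (a x)) = σ (ev f (q x)))
  (n : P →ₛₗ[σ] P')
  (a' : E' →ₛₗ[τ] E'') (d' : D' →ₛₗ[τ] D'')
  (h' : ∀ f x, ev'' (d' f) (q'' (a' x)) = τ (ev' f (q' x))) (n' : P' →ₛₗ[τ] P'')
  (a'' : E →ₛₗ[ρ] E'') (d'' : D →ₛₗ[ρ] D'')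
  (h'' : ∀ f x, ev'' (d'' f) (q'' (a'' x)) = ρ (ev f (q x))) (n'' : P →ₛₗ[ρ] P'')

theorem C0.map_comp'
    (hσ : ∀ r, ρ r = τ (σ r)) (ha : ∀ x, a'' x = a' (a x)) (hd : ∀ x, d'' x = d' (d x))
    (x : C0 q ev) :
    C0.map a'' d'' h'' x = C0.map a' d' h' (C0.map a d h x) := by
  refine RingHom.congr_fun (g := (C0.map a' d' h').comp (C0.map a d h))
    (C0.ringHom_ext (fun r => ?_) fun t => ?_) x
  · rw [RingHom.comp_apply, C0.map_algebraMap, C0.map_algebraMap, C0.map_algebraMap, hσ]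
  · rw [RingHom.comp_apply, C0.map_ι, C0.map_ι, C0.map_ι]
    congr 1
    induction t with
    | zero => simp
    | tmul y f =>
      rw [TensorProduct.map_tmul, TensorProduct.map_tmul, TensorProduct.map_tmul, hd]
      congr 1
      induction y with
      | zero => simp
      | tmul u v => simp only [TensorProduct.map_tmul, ha]
      | add x y hx hy => rw [map_add, map_add, map_add, hx, hy]
    | add x y hx hy => rw [map_add, map_add, map_add, hx, hy]

theorem Bimod.map_comp'
    (hσ : ∀ r, ρ r = τ (σ r)) (ha : ∀ x, a'' x = a' (a x)) (hd : ∀ x, d'' x = d' (d x))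
    (hn : ∀ x, n'' x = n' (n x)) (x : Bimod P q ev) :
    Bimod.map a'' d'' h'' n'' x = Bimod.map a' d' h' n' (Bimod.map a d h n x) := by
  have h0 := C0.map_comp' a d h a' d' h' a'' d'' h'' hσ ha hd
  have h1 : ∀ x, C1.mapₛₗ a'' d'' h'' x = C1.mapₛₗ a' d' h' (C1.mapₛₗ a d h x) := fun x => by
    obtain ⟨x, rfl⟩ := Submodule.Quotient.mk_surjective _ x
    refine congrArg (Submodule.Quotient.mk (p := C1.rel q'' ev'')) ?_
    change TensorProduct.map (C0.mapₛₗ a'' d'' h'') a'' x =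
      TensorProduct.map (C0.mapₛₗ a' d' h') a' (TensorProduct.map (C0.mapₛₗ a d h) a x)
    induction x with
    | zero => simp
    | tmul c e => exact congrArg₂ (· ⊗ₜ[R''] ·) (h0 c) (ha e)
    | add x y hx hy => rw [map_add, map_add, map_add, hx, hy]
  obtain ⟨x, y⟩ := x
  refine Prod.ext (h0 x) ?_
  change TensorProduct.map (C1.mapₛₗ a'' d'' h'') n'' y =
      TensorProduct.map (C1.mapₛₗ a' d' h') n' (TensorProduct.map (C1.mapₛₗ a d h) n y)
  induction y with
  | zero => simp
  | tmul c e => simp only [TensorProduct.map_tmul, h1, hn]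
  | add x y hx hy => rw [map_add, map_add, map_add, hx, hy]

end Functoriality

end Algebra


section Sheaves

open CategoryTheory Opposite AlgebraicGeometry TopologicalSpace

variable {S : Scheme.{u}}

/-- The Zariski topology on the open subsets of `S`. -/
abbrev zar (S : Scheme.{u}) : GrothendieckTopology (Opens S) := Opens.grothendieckTopology S

instance (M : S.PresheafOfModules) (U : (Opens S)ᵒᵖ) :
    Module (S.presheaf.obj U) (M.obj U) := (M.obj U).isModule

/-- Restriction of sections of a presheaf of `𝒪_S`-modules. -/
def res (M : S.PresheafOfModules) {U V : (Opens S)ᵒᵖ} (i : U ⟶ V) :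
    M.obj U →ₛₗ[(S.presheaf.map i).hom] M.obj V where
  toFun x := M.map i x
  map_add' := map_add _
  map_smul' r x := M.map_smul i r x

theorem res_id (M : S.PresheafOfModules) (U : (Opens S)ᵒᵖ) (i : U ⟶ U) (x : M.obj U) :
    res M i x = x := by
  obtain rfl : i = 𝟙 U := Subsingleton.elim _ _
  exact ConcreteCategory.congr_hom (M.presheaf.map_id U) x

theorem res_res (M : S.PresheafOfModules) {U V W : (Opens S)ᵒᵖ} (i : U ⟶ V) (j : V ⟶ W)
    (k : U ⟶ W) (x : M.obj U) : res M j (res M i x) = res M k x := by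
  obtain rfl : k = i ≫ j := Subsingleton.elim _ _
  exact (ConcreteCategory.congr_hom (M.presheaf.map_comp i j) x).symm

/-- A presheaf of modules from its modules of sections and their restriction maps. -/
def mkModules (R : (Opens S)ᵒᵖ ⥤ RingCat.{u}) (A : (Opens S)ᵒᵖ → Type u)
    [∀ U, AddCommGroup (A U)] [∀ U, Module (R.obj U) (A U)]
    (r : ∀ {U V : (Opens S)ᵒᵖ} (i : U ⟶ V), A U →ₛₗ[(R.map i).hom] A V)
    (hid : ∀ (U : (Opens S)ᵒᵖ) (x : A U), r (𝟙 U) x = x)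
    (hcomp : ∀ {U V W : (Opens S)ᵒᵖ} (i : U ⟶ V) (j : V ⟶ W) (x : A U),
      r (i ≫ j) x = r j (r i x)) : PresheafOfModules.{u} R :=
  letI F : (Opens S)ᵒᵖ ⥤ Ab.{u} :=
    { obj U := AddCommGrpCat.of (A U)
      map i := AddCommGrpCat.ofHom (r i).toAddMonoidHom
      map_id U := by ext x; exact hid U x
      map_comp i j := by ext x; exact hcomp i j x }
  letI (U : (Opens S)ᵒᵖ) : Module (R.obj U) (F.obj U) := inferInstanceAs (Module (R.obj U) (A U))
  PresheafOfModules.ofPresheaf F fun _ _ i a x => (r i).map_smulₛₗ a x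

/-- The structure sheaf as a module over itself. -/
abbrev struc (S : Scheme.{u}) : S.PresheafOfModules := PresheafOfModules.unit _

/-- The sections over `U` of the sheaf `Hom(M, N)`: the `𝒪_U`-linear maps `M|_U ⟶ N|_U`. -/
def homOn (M N : S.PresheafOfModules) (U : (Opens S)ᵒᵖ) :
    AddSubgroup (∀ (V : (Opens S)ᵒᵖ) (_ : U ⟶ V), M.obj V →ₗ[S.presheaf.obj V] N.obj V) where
  carrier := {f | ∀ (V W : (Opens S)ᵒᵖ) (i : U ⟶ V) (j : V ⟶ W) (x : M.obj V),
    res N j (f V i x) = f W (i ≫ j) (res M j x)}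
  add_mem' {f g} hf hg V W i j x := by
    simp only [Pi.add_apply, LinearMap.add_apply, map_add, hf V W i j x, hg V W i j x]
  zero_mem' V W i j x := by simp
  neg_mem' {f} hf V W i j x := by
    simp only [Pi.neg_apply, LinearMap.neg_apply, map_neg, hf V W i j x]

theorem map_comp_hom {U V W : (Opens S)ᵒᵖ} (i : U ⟶ V) (j : V ⟶ W) (r : S.presheaf.obj U) :
    (S.presheaf.map (i ≫ j)).hom r = (S.presheaf.map j).hom ((S.presheaf.map i).hom r) :=
  ConcreteCategory.congr_hom (S.presheaf.map_comp i j) r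

instance (M N : S.PresheafOfModules) (U : (Opens S)ᵒᵖ) : SMul (S.presheaf.obj U) (homOn M N U) where
  smul r f := ⟨fun V i => (S.presheaf.map i).hom r • f.1 V i, fun V W i j x => by
    rw [LinearMap.smul_apply, LinearMap.smul_apply, LinearMap.map_smulₛₗ, f.2 V W i j x,
      map_comp_hom]⟩

theorem homOn.smul_val {M N : S.PresheafOfModules} {U : (Opens S)ᵒᵖ} (r : S.presheaf.obj U)
    (f : homOn M N U) (V : (Opens S)ᵒᵖ) (i : U ⟶ V) :
    (r • f).1 V i = (S.presheaf.map i).hom r • f.1 V i := rfl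

theorem homOn.ext' {M N : S.PresheafOfModules} {U : (Opens S)ᵒᵖ} {f g : homOn M N U}
    (h : ∀ V i, f.1 V i = g.1 V i) : f = g := Subtype.ext (funext₂ h)

theorem homOn.add_val {M N : S.PresheafOfModules} {U : (Opens S)ᵒᵖ}
    (f g : homOn M N U) (V : (Opens S)ᵒᵖ) (i : U ⟶ V) :
    (f + g).1 V i = f.1 V i + g.1 V i := rfl

theorem homOn.zero_val {M N : S.PresheafOfModules} {U : (Opens S)ᵒᵖ}
    (V : (Opens S)ᵒᵖ) (i : U ⟶ V) : (0 : homOn M N U).1 V i = 0 := rfl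

instance (M N : S.PresheafOfModules) (U : (Opens S)ᵒᵖ) :
    Module (S.presheaf.obj U) (homOn M N U) where
  one_smul f := homOn.ext' fun V i => by rw [homOn.smul_val, map_one, one_smul]
  mul_smul r s f := homOn.ext' fun V i => by
    rw [homOn.smul_val, homOn.smul_val, homOn.smul_val, map_mul, mul_smul]
  smul_zero r := homOn.ext' fun V i => by rw [homOn.smul_val, homOn.zero_val, smul_zero]
  smul_add r f g := homOn.ext' fun V i => by
    rw [homOn.smul_val, homOn.add_val, homOn.add_val, smul_add, homOn.smul_val, homOn.smul_val]
  add_smul r s f := homOn.ext' fun V i => by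
    rw [homOn.add_val, homOn.smul_val, homOn.smul_val, homOn.smul_val, map_add, add_smul]
  zero_smul f := homOn.ext' fun V i => by
    rw [homOn.smul_val, map_zero, zero_smul, homOn.zero_val]

/-- Restriction of homomorphisms to a smaller open subset. -/
def homOn.res (M N : S.PresheafOfModules) {U V : (Opens S)ᵒᵖ} (i : U ⟶ V) :
    homOn M N U →ₛₗ[(S.presheaf.map i).hom] homOn M N V where
  toFun f := ⟨fun W j => f.1 W (i ≫ j), fun W X j k x => f.2 W X (i ≫ j) k x⟩
  map_add' f g := rfl
  map_smul' r f := homOn.ext' fun W j => by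
    rw [homOn.smul_val, map_comp_hom]; rfl

/-- The sheaf of homomorphisms `Hom(M, N)`. -/
def hom (M N : S.PresheafOfModules) : S.PresheafOfModules :=
  letI (U : (Opens S)ᵒᵖ) : Module (S.ringCatSheaf.obj.obj U) (homOn M N U) :=
    inferInstanceAs (Module (S.presheaf.obj U) (homOn M N U))
  mkModules S.ringCatSheaf.obj (fun U => homOn M N U) (fun i => homOn.res M N i)
    (fun _ _ => rfl) (fun _ _ _ => rfl)

/-- The direct sum `M ⊕ N`. -/
def prod (M N : S.PresheafOfModules) : S.PresheafOfModules :=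
  letI (U : (Opens S)ᵒᵖ) : Module (S.ringCatSheaf.obj.obj U) (M.obj U × N.obj U) :=
    inferInstanceAs (Module (S.presheaf.obj U) (M.obj U × N.obj U))
  mkModules S.ringCatSheaf.obj (fun U => M.obj U × N.obj U)
    (fun i =>
      { toFun x := (EvenClifford.res M i x.1, EvenClifford.res N i x.2)
        map_add' x y := by simp only [Prod.fst_add, Prod.snd_add, map_add, Prod.mk_add_mk]
        map_smul' r x := Prod.ext ((EvenClifford.res M i).map_smulₛₗ r x.1)
          ((EvenClifford.res N i).map_smulₛₗ r x.2) })
    (fun U x => Prod.ext (res_id M U _ x.1) (res_id N U _ x.2))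
    (fun i j x => Prod.ext (res_res M i j _ x.1).symm (res_res N i j _ x.2).symm)

theorem homOn.smul_id {M N : S.PresheafOfModules} {U : (Opens S)ᵒᵖ} (r : S.presheaf.obj U)
    (f : homOn M N U) (x : M.obj U) : (r • f).1 U (𝟙 U) x = r • f.1 U (𝟙 U) x := by
  rw [homOn.smul_val, S.presheaf.map_id]; rfl

/-- A quadratic form `q : M ⟶ L` of sheaves of modules. -/
structure QuadForm (M L : S.PresheafOfModules) where
  app (U : (Opens S)ᵒᵖ) : QuadraticMap (S.presheaf.obj U) (M.obj U) (L.obj U)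
  naturality {U V : (Opens S)ᵒᵖ} (i : U ⟶ V) (x : M.obj U) :
    app V (res M i x) = res L i (app U x)

namespace QuadForm

/-- `q` is primitive: the image of `q`, as a subsheaf of `L`, generates `L`.  As the symmetric
tensors in `M ⊗ M` are generated locally by the `v ⊗ v`, this says that the associated map
`S₂ M ⟶ L` is an epimorphism. -/
def IsPrimitive {M L : S.PresheafOfModules} (q : QuadForm M L) : Prop :=
  ∀ (U : Opens S) (l : L.obj (op U)) (x : S), x ∈ U →
    ∃ (V : Opens S) (i : V ⟶ U), x ∈ V ∧
      res L i.op l ∈ Submodule.span (S.presheaf.obj (op V)) (Set.range (q.app (op V)))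

/-- An isometry of quadratic forms with the same value module. -/
def Isometric {M M' L : S.PresheafOfModules} (q : QuadForm M L) (q' : QuadForm M' L) : Prop :=
  ∃ φ : M ≅ M', ∀ (U : (Opens S)ᵒᵖ) (x : M.obj U), q'.app U (φ.hom.app U x) = q.app U x

/-- The hyperbolic form `H_L(N)` on `N ⊕ Hom(N, L)`, given by `(v, f) ↦ f v`. -/
def hyperbolic (N L : S.PresheafOfModules) : QuadForm (prod N (hom N L)) L where
  app U := LinearMap.BilinMap.toQuadraticMap (LinearMap.mk₂ (S.presheaf.obj U)
    (fun (x y : N.obj U × homOn N L U) => y.2.1 U (𝟙 U) x.1)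
    (fun _ _ _ => map_add _ _ _) (fun _ _ _ => map_smul _ _ _) (fun _ _ _ => rfl)
    (fun r x y => homOn.smul_id r y.2 x.1))
  naturality {U V} i x := (x.2.2 U V (𝟙 U) i x.1).symm

/-- The orthogonal sum. -/
def perp {M₁ M₂ L : S.PresheafOfModules} (q₁ : QuadForm M₁ L) (q₂ : QuadForm M₂ L) :
    QuadForm (prod M₁ M₂) L where
  app U := (q₁.app U).prod (q₂.app U)
  naturality {U V} i x := by
    change q₁.app V (res M₁ i x.1) + q₂.app V (res M₂ i x.2) =
      res L i (q₁.app U x.1 + q₂.app U x.2)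
    rw [q₁.naturality, q₂.naturality, map_add]

variable {M L : S.PresheafOfModules} (q : QuadForm M L)

/-- The evaluation pairing `L^∨ × L ⟶ 𝒪` on sections over `U`. -/
def ev (L : S.PresheafOfModules) (U : (Opens S)ᵒᵖ) :
    homOn L (struc S) U →ₗ[S.presheaf.obj U] L.obj U →ₗ[S.presheaf.obj U] S.presheaf.obj U where
  toFun f := f.1 U (𝟙 U)
  map_add' f g := rfl
  map_smul' r f := by rw [homOn.smul_val, S.presheaf.map_id]; rfl

theorem ev_res {U V : (Opens S)ᵒᵖ} (i : U ⟶ V) (f : homOn L (struc S) U) (x : M.obj U) :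
    ev L V (homOn.res L (struc S) i f) (q.app V (res M i x)) =
      (S.presheaf.map i).hom (ev L U f (q.app U x)) := by
  rw [q.naturality]
  exact (f.2 U V (𝟙 U) i (q.app U x)).symm

/-- The even Clifford algebra of `(M(U), q_U, L(U))`. -/
abbrev C0 (U : (Opens S)ᵒᵖ) : Type u := EvenClifford.C0 (q.app U) (ev L U)

def C0res {U V : (Opens S)ᵒᵖ} (i : U ⟶ V) : q.C0 U →+* q.C0 V :=
  C0.map (res M i) (homOn.res L (struc S) i) (q.ev_res i)

theorem C0res_id (U : (Opens S)ᵒᵖ) (x : q.C0 U) : q.C0res (𝟙 U) x = x :=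
  C0.map_id' _ _ (q.ev_res (𝟙 U)) (fun r => ConcreteCategory.congr_hom (S.presheaf.map_id U) r)
      (res_id M U _) (fun _ => rfl) x

theorem C0res_comp {U V W : (Opens S)ᵒᵖ} (i : U ⟶ V) (j : V ⟶ W) (x : q.C0 U) :
    q.C0res (i ≫ j) x = q.C0res j (q.C0res i x) :=
  C0.map_comp' _ _ (q.ev_res i) _ _ (q.ev_res j) _ _ (q.ev_res (i ≫ j)) (map_comp_hom i j)
    (fun x => (res_res M i j _ x).symm) (fun _ => rfl) x

/-- The presheaf of even Clifford algebras `U ↦ C₀(M(U), q_U, L(U))`. -/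
def preC0 : (Opens S)ᵒᵖ ⥤ RingCat.{u} where
  obj U := RingCat.of (q.C0 U)
  map i := RingCat.ofHom (q.C0res i)
  map_id U := RingCat.hom_ext (RingHom.ext (q.C0res_id U))
  map_comp i j := RingCat.hom_ext (RingHom.ext (q.C0res_comp i j))

def preC0Unit : S.ringCatSheaf.obj ⟶ q.preC0 where
  app U := RingCat.ofHom (R := S.presheaf.obj U) (algebraMap (S.presheaf.obj U) (q.C0 U))
  naturality _ _ i := RingCat.hom_ext (RingHom.ext fun r =>
    (C0.map_algebraMap (res M i) (homOn.res L (struc S) i) (q.ev_res i) r).symm)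

variable (N : S.PresheafOfModules)

abbrev Bimod (U : (Opens S)ᵒᵖ) : Type u :=
  EvenClifford.Bimod (homOn N (struc S) U) (q.app U) (ev L U)

def Bimodres {U V : (Opens S)ᵒᵖ} (i : U ⟶ V) :
    q.Bimod N U →ₛₗ[(q.C0res i).op] q.Bimod N V :=
  Bimod.map _ _ (q.ev_res i) (homOn.res N (struc S) i)

theorem Bimodres_id (U : (Opens S)ᵒᵖ) (x : q.Bimod N U) : q.Bimodres N (𝟙 U) x = x :=
  Bimod.map_id' _ _ (q.ev_res (𝟙 U)) _
    (fun r => ConcreteCategory.congr_hom (S.presheaf.map_id U) r)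
    (res_id M U _) (fun _ => rfl) (fun _ => rfl) x

theorem Bimodres_comp {U V W : (Opens S)ᵒᵖ} (i : U ⟶ V) (j : V ⟶ W) (x : q.Bimod N U) :
    q.Bimodres N (i ≫ j) x = q.Bimodres N j (q.Bimodres N i x) :=
  Bimod.map_comp' _ _ (q.ev_res i) _ _ _ (q.ev_res j) _ _ _ (q.ev_res (i ≫ j)) _
    (map_comp_hom i j) (fun x => (res_res M i j _ x).symm) (fun _ => rfl) (fun _ => rfl) x

instance (U : (Opens S)ᵒᵖ) : AddCommGroup (q.Bimod N U) := inferInstance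

end QuadForm

/-- The opposite ring. -/
def opRing : RingCat.{u} ⥤ RingCat.{u} where
  obj R := RingCat.of Rᵐᵒᵖ
  map f := RingCat.ofHom f.hom.op

/-- `C₀(q) ⊕ (C₁(q) ⊗ N^∨)` -/
def QuadForm.preP {M L : S.PresheafOfModules} (q : QuadForm M L) (N : S.PresheafOfModules) :
    PresheafOfModules.{u} (q.preC0 ⋙ opRing) :=
  letI (U : (Opens S)ᵒᵖ) : Module ((q.preC0 ⋙ opRing).obj U) (q.Bimod N U) :=
    inferInstanceAs (Module (q.C0 U)ᵐᵒᵖ (q.Bimod N U))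
  mkModules (q.preC0 ⋙ opRing) (q.Bimod N) (q.Bimodres N) (q.Bimodres_id N) (q.Bimodres_comp N)

theorem opRing_isSheaf (A : Sheaf (zar S) RingCat.{u}) :
    Presheaf.IsSheaf (zar S) (A.obj ⋙ opRing) := by
  rw [Presheaf.isSheaf_iff_isSheaf_forget (zar S) _ (forget RingCat.{u})]
  refine (Presheaf.isSheaf_of_iso_iff (J := zar S) (P := A.obj ⋙ forget RingCat.{u})
    (NatIso.ofComponents (fun U => Equiv.toIso (MulOpposite.opEquiv (α := A.obj.obj U)))
      fun _ => rfl)).1 ?_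
  exact (Presheaf.isSheaf_iff_isSheaf_forget (zar S) _ (forget RingCat.{u})).1 A.property

/-- The opposite of a sheaf of rings, so that right modules become modules in the sense of
`SheafOfModules`. -/
def opSheaf (A : Sheaf (zar S) RingCat.{u}) : Sheaf (zar S) RingCat.{u} :=
  ⟨A.obj ⋙ opRing, opRing_isSheaf A⟩

/-- A presheaf of (noncommutative) `𝒪_S`-algebras. -/
structure AlgPresheaf (S : Scheme.{u}) where
  ring : (Opens S)ᵒᵖ ⥤ RingCat.{u}
  unit : S.ringCatSheaf.obj ⟶ ring
  unit_comm (U : (Opens S)ᵒᵖ) (r : S.ringCatSheaf.obj.obj U) (x : ring.obj U) :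
    unit.app U r * x = x * unit.app U r

/-- A sheaf of (noncommutative) `𝒪_S`-algebras. -/
structure AlgSheaf (S : Scheme.{u}) extends AlgPresheaf S where
  isSheaf : Presheaf.IsSheaf (zar S) ring

def AlgSheaf.sheaf (A : AlgSheaf S) : Sheaf (zar S) RingCat.{u} := ⟨A.ring, A.isSheaf⟩

/-- The sheaf of rings whose modules are the sheaves of right `A`-modules. -/
def AlgSheaf.right (A : AlgSheaf S) : Sheaf (zar S) RingCat.{u} := opSheaf A.sheaf

/-- An isomorphism of `𝒪_S`-algebras. -/
structure AlgPresheaf.Iso (A B : AlgPresheaf S) where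
  iso : A.ring ≅ B.ring
  unit_comp : A.unit ≫ iso.hom = B.unit

/-- The associated sheaf of a presheaf of `𝒪_S`-algebras. -/
def AlgPresheaf.sheafify (A : AlgPresheaf S) : AlgSheaf S where
  ring := CategoryTheory.sheafify (zar S) A.ring
  unit := A.unit ≫ toSheafify (zar S) A.ring
  unit_comm U r x := by
    refine (((isSheaf_iff_isSheaf_of_type (zar S) _).1
      ((Presheaf.isSheaf_iff_isSheaf_forget (zar S) _ (forget RingCat.{u})).1
        (((presheafToSheaf (zar S) RingCat.{u}).obj A.ring).property))).isSeparated _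
        (Presheaf.imageSieve_mem (zar S) (toSheafify (zar S) A.ring) x)).ext ?_
    rintro V i ⟨y, hy⟩
    have h := congrArg ((toSheafify (zar S) A.ring).app (op V)).hom
      (A.unit_comm (op V) (S.ringCatSheaf.obj.map i.op r) y)
    rw [map_mul, map_mul] at h
    change ((CategoryTheory.sheafify (zar S) A.ring).map i.op).hom _ =
      ((CategoryTheory.sheafify (zar S) A.ring).map i.op).hom _
    rw [map_mul, map_mul]
    have h1 : ((CategoryTheory.sheafify (zar S) A.ring).map i.op).hom
        ((A.unit ≫ toSheafify (zar S) A.ring).app U r) =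
        ((toSheafify (zar S) A.ring).app (op V)).hom
          (A.unit.app (op V) (S.ringCatSheaf.obj.map i.op r)) :=
      (NatTrans.naturality_apply (A.unit ≫ toSheafify (zar S) A.ring) i.op r).symm
    rw [h1]
    have hy' : ((CategoryTheory.sheafify (zar S) A.ring).map i.op).hom x =
      ((toSheafify (zar S) A.ring).app (op V)).hom y := hy.symm
    rw [hy']
    exact h
  isSheaf := ((presheafToSheaf (zar S) RingCat.{u}).obj A.ring).property

/-- The canonical map from a presheaf of algebras to its associated sheaf, on opposite rings. -/
def AlgPresheaf.toRight (A : AlgPresheaf S) : A.ring ⋙ opRing ⟶ A.sheafify.right.obj :=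
  Functor.whiskerRight (toSheafify (zar S) A.ring) opRing

instance (A : AlgPresheaf S) : Presheaf.IsLocallyInjective (zar S) A.toRight where
  equalizerSieve_mem {U} x y h := by
    refine (zar S).superset_covering ?_ (Presheaf.equalizerSieve_mem (zar S)
      (toSheafify (zar S) A.ring) (MulOpposite.unop x) (MulOpposite.unop y)
      (congrArg MulOpposite.unop h))
    intro V i hi
    exact congrArg MulOpposite.op hi

instance (A : AlgPresheaf S) : Presheaf.IsLocallySurjective (zar S) A.toRight where
  imageSieve_mem {U} x := by
    refine (zar S).superset_covering ?_ (Presheaf.imageSieve_mem (zar S) (U := op U)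
      (toSheafify (zar S) A.ring) (MulOpposite.unop x))
    rintro V i ⟨y, hy⟩
    exact ⟨MulOpposite.op y, congrArg MulOpposite.op hy⟩

/-- The presheaf of even Clifford algebras. -/
def QuadForm.preC0Alg {M L : S.PresheafOfModules} (q : QuadForm M L) : AlgPresheaf S where
  ring := q.preC0
  unit := q.preC0Unit
  unit_comm U r x := Algebra.commutes (R := S.presheaf.obj U) (A := q.C0 U) r x

/-- The even Clifford algebra `C₀(M, q, L)`, the sheaf of algebras associated to
`U ↦ C₀(M(U), q_U, L(U))`. -/
def QuadForm.evenClifford {M L : S.PresheafOfModules} (q : QuadForm M L) : AlgSheaf S :=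
  q.preC0Alg.sheafify

/-- The sheaf of right `C₀(q)`-modules `C₀(q) ⊕ N^∨ ⊗ C₁(q)`. -/
def QuadForm.bimodule {M L : S.PresheafOfModules} (q : QuadForm M L) (N : S.PresheafOfModules) :
    SheafOfModules.{u} q.evenClifford.right :=
  (PresheafOfModules.sheafification q.preC0Alg.toRight).obj (q.preP N)

/-- The center of a sheaf of algebras: the sections which commute with all sections over smaller
open subsets. -/
def AlgPresheaf.centerOn (A : AlgPresheaf S) (U : (Opens S)ᵒᵖ) : Subring (A.ring.obj U) where
  carrier := {z | ∀ (V : (Opens S)ᵒᵖ) (i : U ⟶ V) (x : A.ring.obj V),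
    A.ring.map i z * x = x * A.ring.map i z}
  mul_mem' {a b} ha hb V i x := by
    rw [map_mul, mul_assoc, hb, ← mul_assoc, ha, mul_assoc]
  one_mem' V i x := by rw [map_one, one_mul, mul_one]
  add_mem' {a b} ha hb V i x := by rw [map_add, add_mul, mul_add, ha, hb]
  zero_mem' V i x := by rw [map_zero, zero_mul, mul_zero]
  neg_mem' {a} ha V i x := by rw [map_neg, neg_mul, mul_neg, ha]

def AlgPresheaf.centerRes (A : AlgPresheaf S) {U V : (Opens S)ᵒᵖ} (i : U ⟶ V) :
    A.centerOn U →+* A.centerOn V :=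
  ((A.ring.map i).hom.comp (A.centerOn U).subtype).codRestrict (A.centerOn V)
    fun z W j x => by
      have h := z.2 W (i ≫ j) x
      rw [A.ring.map_comp] at h
      exact h

def AlgPresheaf.center (A : AlgPresheaf S) : AlgPresheaf S where
  ring :=
    { obj U := RingCat.of (A.centerOn U)
      map i := RingCat.ofHom (A.centerRes i)
      map_id U := RingCat.hom_ext <| RingHom.ext fun z => Subtype.ext <|
        ConcreteCategory.congr_hom (A.ring.map_id U) z.1
      map_comp i j := RingCat.hom_ext <| RingHom.ext fun z => Subtype.ext <|
        ConcreteCategory.congr_hom (A.ring.map_comp i j) z.1 }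
  unit :=
    { app U := RingCat.ofHom ((A.unit.app U).hom.codRestrict (A.centerOn U) fun r V i x => by
        have h := A.unit_comm V (S.ringCatSheaf.obj.map i r) x
        rw [NatTrans.naturality_apply] at h
        exact h)
      naturality U V i := RingCat.hom_ext <| RingHom.ext fun r => Subtype.ext <|
        NatTrans.naturality_apply A.unit i r }
  unit_comm U r z := Subtype.ext (A.unit_comm U r z.1)

section End

variable (A : AlgSheaf S) (P : SheafOfModules.{u} A.right)

/-- The sections over `U` of the sheaf `End_A(P)`: the `A|_U`-linear endomorphisms of `P|_U`. -/
def endOn (U : (Opens S)ᵒᵖ) : Subring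
    (∀ (V : (Opens S)ᵒᵖ) (_ : U ⟶ V), Module.End (A.right.obj.obj V) (P.val.obj V)) where
  carrier := {f | ∀ (V W : (Opens S)ᵒᵖ) (i : U ⟶ V) (j : V ⟶ W) (x : P.val.obj V),
    P.val.restrictₛₗ j (f V i x) = f W (i ≫ j) (P.val.restrictₛₗ j x)}
  mul_mem' {f g} hf hg V W i j x :=
    (hf V W i j (g V i x)).trans (congrArg (f W (i ≫ j)) (hg V W i j x))
  one_mem' _ _ _ _ _ := rfl
  add_mem' hf hg V W i j x :=
    (map_add (P.val.restrictₛₗ j) _ _).trans (congrArg₂ (· + ·) (hf V W i j x) (hg V W i j x))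
  zero_mem' _ _ _ j _ := map_zero (P.val.restrictₛₗ j)
  neg_mem' hf V W i j x :=
    (map_neg (P.val.restrictₛₗ j) _).trans (congrArg Neg.neg (hf V W i j x))

def endRes {U V : (Opens S)ᵒᵖ} (i : U ⟶ V) : endOn A P U →+* endOn A P V where
  toFun f := ⟨fun W j => f.1 W (i ≫ j), fun W X j k x => f.2 W X (i ≫ j) k x⟩
  map_one' := rfl
  map_mul' _ _ := rfl
  map_zero' := rfl
  map_add' _ _ := rfl

variable {A} in
/-- A section of `A`, acting on right `A`-modules from the right. -/
def AlgSheaf.toR {U : (Opens S)ᵒᵖ} (a : A.ring.obj U) : A.right.obj.obj U := MulOpposite.op a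

/-- A section `r` of `𝒪_S`, acting on right `A`-modules. -/
def AlgSheaf.scalar (U : (Opens S)ᵒᵖ) : S.ringCatSheaf.obj.obj U →+* A.right.obj.obj U where
  toFun r := AlgSheaf.toR (A.unit.app U r)
  map_one' := congrArg MulOpposite.op (map_one (A.unit.app U).hom)
  map_mul' r s := congrArg MulOpposite.op
    ((map_mul (A.unit.app U).hom r s).trans (A.unit_comm U r _))
  map_zero' := congrArg MulOpposite.op (map_zero (A.unit.app U).hom)
  map_add' r s := congrArg MulOpposite.op (map_add (A.unit.app U).hom r s)

variable {A} in
theorem AlgSheaf.scalar_comm {U : (Opens S)ᵒᵖ} (r : S.ringCatSheaf.obj.obj U)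
    (a : A.right.obj.obj U) : A.scalar U r * a = a * A.scalar U r :=
  MulOpposite.unop_injective (A.unit_comm U r (MulOpposite.unop a)).symm

variable {A} in
theorem AlgSheaf.scalar_map {U V : (Opens S)ᵒᵖ} (i : U ⟶ V) (r : S.ringCatSheaf.obj.obj U) :
    A.right.obj.map i (A.scalar U r) = A.scalar V (S.ringCatSheaf.obj.map i r) :=
  congrArg MulOpposite.op (NatTrans.naturality_apply A.unit i r).symm

/-- Multiplication by sections of `𝒪_S` on the sections of a right `A`-module. -/
def scalarEnd (U : (Opens S)ᵒᵖ) :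
    S.ringCatSheaf.obj.obj U →+* Module.End (A.right.obj.obj U) (P.val.obj U) where
  toFun r :=
    { toFun x := A.scalar U r • x
      map_add' := smul_add _
      map_smul' a x := by
        rw [RingHom.id_apply, smul_smul, smul_smul, AlgSheaf.scalar_comm] }
  map_one' := LinearMap.ext fun x => by
    change A.scalar U 1 • x = x
    rw [map_one, one_smul]
  map_mul' r s := LinearMap.ext fun x => by
    change A.scalar U (r * s) • x = A.scalar U r • A.scalar U s • x
    rw [map_mul, mul_smul]
  map_zero' := LinearMap.ext fun x => by
    change A.scalar U 0 • x = (0 : P.val.obj U)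
    rw [map_zero, zero_smul]
  map_add' r s := LinearMap.ext fun x => by
    change A.scalar U (r + s) • x = A.scalar U r • x + A.scalar U s • x
    rw [map_add, add_smul]

/-- The sheaf of `𝒪_S`-algebras `End_A(P)`. -/
def endAlg : AlgPresheaf S where
  ring :=
    { obj U := RingCat.of (endOn A P U)
      map i := RingCat.ofHom (endRes A P i)
      map_id _ := rfl
      map_comp _ _ := rfl }
  unit :=
    { app U := RingCat.ofHom
        { toFun r := ⟨fun V i => scalarEnd A P V (S.ringCatSheaf.obj.map i r), fun V W i j x => by
            refine ((P.val.restrictₛₗ j).map_smulₛₗ _ x).trans ?_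
            change A.right.obj.map j _ • P.val.restrictₛₗ j x = A.scalar W _ • P.val.restrictₛₗ j x
            rw [AlgSheaf.scalar_map, S.ringCatSheaf.obj.map_comp]
            rfl⟩
          map_one' := Subtype.ext <| funext₂ fun V i =>
            map_one ((scalarEnd A P V).comp (S.ringCatSheaf.obj.map i).hom)
          map_mul' r s := Subtype.ext <| funext₂ fun V i =>
            map_mul ((scalarEnd A P V).comp (S.ringCatSheaf.obj.map i).hom) r s
          map_zero' := Subtype.ext <| funext₂ fun V i =>
            map_zero ((scalarEnd A P V).comp (S.ringCatSheaf.obj.map i).hom)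
          map_add' r s := Subtype.ext <| funext₂ fun V i =>
            map_add ((scalarEnd A P V).comp (S.ringCatSheaf.obj.map i).hom) r s }
      naturality U V i := RingCat.hom_ext <| RingHom.ext fun r => Subtype.ext <|
        funext₂ fun W j => congrArg (scalarEnd A P W)
          (ConcreteCategory.congr_hom (S.ringCatSheaf.obj.map_comp i j) r).symm }
  unit_comm U r f := Subtype.ext <| funext₂ fun V i => LinearMap.ext fun x =>
    ((f.1 V i).map_smul (A.scalar V (S.ringCatSheaf.obj.map i r)) x).symm

end End

/-- `M` is locally free of constant rank `n`, locally for the Zariski topology on `S`. -/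
def IsLocallyFreeOfRank {R : Sheaf (zar S) RingCat.{u}} (n : ℕ) (M : SheafOfModules.{u} R) : Prop :=
  ∀ x : S, ∃ U : Opens S, x ∈ U ∧
    Nonempty (M.over U ≅ SheafOfModules.free (R := R.over U) (ULift.{u} (Fin n)))

/-- The objects of the fibered category, over the open subsets `U` of `S`, of finitely presented
right `A|_U`-modules. -/
structure Coh (A : AlgSheaf S) where
  U : Opens S
  M : SheafOfModules.{u} (A.right.over U)
  isFinitePresentation : M.IsFinitePresentation

namespace Coh

variable {A : AlgSheaf S}

/-- A morphism from a module over `U` to a module over `V`, for `U ≤ V`, is a morphism to the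
restriction to `U` of the latter. -/
@[ext]
structure Hom (X Y : Coh A) where
  le : X.U ≤ Y.U
  map : X.M ⟶ (SheafOfModules.overMap A.right (homOfLE le)).obj Y.M

def id (X : Coh A) : Hom X X := ⟨le_rfl, ⟨{ app := fun W => 𝟙 (X.M.val.obj W) }⟩⟩

def comp {X Y Z : Coh A} (f : Hom X Y) (g : Hom Y Z) : Hom X Z :=
  ⟨f.le.trans g.le, f.map ≫ (SheafOfModules.overMap A.right (homOfLE f.le)).map g.map⟩

theorem comp_id {X Y : Coh A} (f : Hom X Y) : comp f (id Y) = f := by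
  refine Hom.ext (SheafOfModules.hom_ext (PresheafOfModules.hom_ext fun W =>
    ModuleCat.hom_ext (LinearMap.ext fun x => ?_)))
  have h : ∀ y, (((SheafOfModules.overMap A.right (homOfLE f.le)).map
    (id Y).map).val.app W).hom y = y := fun y => rfl
  exact h _

instance : Category (Coh A) where
  Hom := Hom
  id := id
  comp := comp
  id_comp _ := Hom.ext (SheafOfModules.hom_ext rfl)
  comp_id := comp_id
  assoc _ _ _ := Hom.ext (SheafOfModules.hom_ext rfl)

/-- The sum of two morphisms over the same inclusion of open subsets. -/
instance (X Y : Coh A) : Add (X ⟶ Y) where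
  add (f g : Hom X Y) := (⟨f.le, f.map + g.map⟩ : Hom X Y)

/-- Multiplication of sections over `W ≤ X.U` by a section `r` of `𝒪_S` over `X.U`. -/
def smul (X : Coh A) (r : S.ringCatSheaf.obj.obj (op X.U)) (W : (Over X.U)ᵒᵖ)
    (x : X.M.val.obj W) : X.M.val.obj W :=
  let a : (A.right.over X.U).obj.obj W :=
    A.scalar (op W.unop.left) (S.ringCatSheaf.obj.map W.unop.hom.op r)
  a • x

/-- The morphism `g` is `r` times the morphism `f`. -/
def IsSMul {X Y : Coh A} (r : S.ringCatSheaf.obj.obj (op X.U)) (f g : X ⟶ Y) : Prop :=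
  ∀ (W : (Over X.U)ᵒᵖ) (x : X.M.val.obj W), (Hom.map g).val.app W x =
    (Hom.map f).val.app W (X.smul r W x)

end Coh

/-- `A` and `A'` are Morita equivalent over `S`: there is an equivalence between the fibered
categories of finitely presented right modules, over the category of open subsets of `S`, which is
`𝒪_S`-linear on homomorphisms. -/
def MoritaEquivalent (A A' : AlgSheaf S) : Prop :=
  ∃ F : Coh A ⥤ Coh A', F.IsEquivalence ∧ ∃ hU : ∀ X, (F.obj X).U = X.U,
    (∀ (X Y : Coh A) (f g : X ⟶ Y), F.map (f + g) = F.map f + F.map g) ∧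
    ∀ (X Y : Coh A) (r : S.ringCatSheaf.obj.obj (op X.U)) (f g : X ⟶ Y), Coh.IsSMul r f g →
      Coh.IsSMul (S.ringCatSheaf.obj.map (homOfLE (hU X).le).op r) (F.map f) (F.map g)

/-- Every local ring of `S` is a factorial domain. -/
def IsLocallyFactorial (S : Scheme.{u}) : Prop :=
  ∀ x : S, IsDomain (S.presheaf.stalk x) ∧ UniqueFactorizationMonoid (S.presheaf.stalk x)

end Sheaves

end EvenClifford

end

/-!
Write `C₀`, `C₁` for the even Clifford algebra and the odd Clifford bimodule of `(E', q', L)`, and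
`P` for `C₀ ⊕ C₁ ⊗ N^∨`.  All three assertions follow from one explicit action of `C₀(q)` on `P`
together with the local structure of `P` as a right `C₀`-module.

*The action.*  Left multiplication by vectors of `E'` gives maps `C₀ → C₁` and `C₁ → L ⊗ C₀` (a
`CliffordPair`).  In analogy with the Clifford module of a hyperbolic plane, a product of two
vectors of `N ⊕ Hom(N, L) ⊕ E'` acts on `P` as follows: vectors of `N` contract with `N^∨`, vectors
of `Hom(N, L)` multiply in the exterior algebra, and vectors of `E'` act by Clifford
multiplication, with a sign on the second summand (`LinePairing.act`).  The relations of the even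
Clifford algebra hold, so this defines a homomorphism `LinePairing.rho`, which commutes with the
right action of `C₀` (`LinePairing.rho_op_smul`).

*Bijectivity.*  Since `q'` is primitive, every point has a neighbourhood with a section `v` of `E'`
such that `q'(v)` generates `L`; shrinking it, `N`, `L` and their duals have compatible generators
(`QuadForm.LocalFrame`, `QuadForm.exists_isFramed`).  Then `C₁ = v C₀`, and `P` has the basis
`(1, 0)`, `p₁ = v ⊗ φ₀`.  The products `n₀ h₀`, `n₀ v` and `h₀ v` act as matrix units up to sign,
which yields surjectivity onto the endomorphisms (`LinePairing.Frame.exists_rho_eq`).  For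
injectivity, the elements `n₀ h₀ a + h₀ v b` with `a`, `b` in `C₀(q')` are shown to form a left
ideal (`LinePairing.Frame.mapsColumns`), on which the action is visibly faithful, and `1` is a sum
of products with first factors in this ideal (`LinePairing.Frame.eq_zero_of_rho`).

*Sheaves.*  The definitions use presheaves of algebras and bimodules followed by sheafification.
The action is defined where local generators exist, and a linear map on a presheaf, defined over a
covering, extends to the sheafification (`LocBij.extend`).  The resulting map from the presheaf of
Clifford algebras to the sheaf `End(P)` is locally bijective, so it induces the isomorphism
`QuadForm.HypIso.isoEnd`.

*Consequences.*  The sections `(1, 0)`, `p₁` and the projection to `C₀` form a `SplitBasis`: the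
first basis vector `p₀` and the first coordinate `π₀` exist globally, while `p₁` exists locally.
Local freeness of rank two is `SplitBasis.isLocallyFreeOfRank`.  A central endomorphism commutes
with every `x ↦ π₀(x) p`, so it sends `p` to `p a` for the central section `a = π₀(f(p₀))`; this
identifies the centers (`SplitBasis.exists_center_iso`).  Finally `e = p₀ π₀` is an idempotent of
`End(P)` with `e End(P) e ≅ C₀`, and locally `1 = e + β e α` (`SplitBasis.corner`).  For such a
corner of a sheaf of rings `R`, the functor `M ↦ e M` is an equivalence, with quasi-inverse
`N ↦ Hom(e R, N)` (`Corner.functor`, `Corner.ind`).  Both preserve finite presentation, since they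
are right exact and map the structure sheaves to direct summands of finite free sheaves of modules,
locally for the first functor.  As `M ↦ e M` is compatible with restriction, it is a Morita
equivalence (`Corner.moritaEquivalent`).
-/

-- The even Clifford algebra is only used through its generators, relations and universal property;
-- unfolding it would make the unification of its elements expensive.
attribute [irreducible] EvenClifford.C0 EvenClifford.instRingC0 EvenClifford.instAlgebraC0

noncomputable section

namespace EvenClifford

/-! ### Multiplication with vectors in the Clifford bimodule -/

section Algebra

variable {R E L D : Type*} [CommRing R] [AddCommGroup E] [Module R E]
  [AddCommGroup L] [Module R L] [AddCommGroup D] [Module R D]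

section Relations

variable (q : QuadraticMap R E L) (ev : D →ₗ[R] L →ₗ[R] R)

theorem C0.ι_add_swap (v w : E) (f : D) :
    C0.ι q ev (v ⊗ₜ w ⊗ₜ f) + C0.ι q ev (w ⊗ₜ v ⊗ₜ f) =
      algebraMap R _ (ev f (QuadraticMap.polar q v w)) := by
  have h := C0.ι_sq q ev (v + w) f
  simp only [TensorProduct.add_tmul, TensorProduct.tmul_add, map_add, C0.ι_sq] at h
  rw [QuadraticMap.polar, map_sub, map_sub, map_sub, map_sub, ← h]
  abel

theorem C0.ι_contract_add_swap (u v w x : E) (f g : D) :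
    C0.ι q ev (u ⊗ₜ v ⊗ₜ f) * C0.ι q ev (w ⊗ₜ x ⊗ₜ g) +
      C0.ι q ev (u ⊗ₜ w ⊗ₜ f) * C0.ι q ev (v ⊗ₜ x ⊗ₜ g) =
      ev f (QuadraticMap.polar q v w) • C0.ι q ev (u ⊗ₜ x ⊗ₜ g) := by
  have h := C0.ι_contract q ev u (v + w) x f g
  simp only [TensorProduct.add_tmul, TensorProduct.tmul_add, map_add, C0.ι_contract,
    add_mul, mul_add] at h
  rw [QuadraticMap.polar, map_sub, map_sub, sub_smul, sub_smul, ← h]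
  abel

/-- Left multiplication by a vector `e`, as a map `C₀ → C₁`. -/
def C1.mulLeft : E →ₗ[R] C0 q ev →ₗ[R] C1 q ev :=
  LinearMap.mk₂ R (fun e c => Submodule.Quotient.mk (c ⊗ₜ[R] e))
    (fun a b c => by rw [TensorProduct.tmul_add]; rfl)
    (fun r a c => by rw [TensorProduct.tmul_smul]; rfl)
    (fun a b c => by rw [TensorProduct.add_tmul]; rfl)
    (fun r a c => rfl)

theorem C1.mulLeft_mul (e : E) (c d : C0 q ev) :
    C1.mulLeft q ev e (c * d) = MulOpposite.op d • C1.mulLeft q ev e c := rfl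

variable {q ev} in
theorem C1.induction {p : C1 q ev → Prop} (h₀ : p 0) (h₁ : ∀ e c, p (C1.mulLeft q ev e c))
    (ha : ∀ x y, p x → p y → p (x + y)) (x : C1 q ev) : p x := by
  obtain ⟨x, rfl⟩ := Submodule.Quotient.mk_surjective _ x
  induction x with
  | zero => exact h₀
  | tmul c e => exact h₁ e c
  | add x y hx hy => exact ha _ _ hx hy

/-- The defining relation of the odd Clifford bimodule. -/
theorem C1.mulLeft_ι_mul (v w : E) (f : D) (c : C0 q ev) :
    C1.mulLeft q ev v (C0.ι q ev (v ⊗ₜ w ⊗ₜ f) * c) = ev f (q v) • C1.mulLeft q ev w c := by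
  have h : C1.mulLeft q ev v (C0.ι q ev (v ⊗ₜ w ⊗ₜ f)) = ev f (q v) • C1.mulLeft q ev w 1 := by
    refine sub_eq_zero.1 ((Submodule.Quotient.mk_eq_zero (C1.rel q ev)).2 ?_)
    exact Submodule.subset_span ⟨v, w, f, rfl⟩
  rw [C1.mulLeft_mul, h, smul_comm, ← C1.mulLeft_mul, one_mul]

variable (hD : ∀ (f g : D) (a : L), ev f a • g = ev g a • f)

/-- The map `C₀ ⊗ E → C₀` underlying `C1.contract`; in `C₀ ⊗ E` the left factor `C₀` carries the
right module structure. -/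
def C1.preContract (e : E) (f : D) : C0 q ev ⊗[R] E →ₗ[(C0 q ev)ᵐᵒᵖ] C0 q ev where
  toFun := TensorProduct.lift (LinearMap.mk₂ R (fun c w => C0.ι q ev (e ⊗ₜ w ⊗ₜ f) * c)
    (fun _ _ _ => mul_add _ _ _) (fun _ _ _ => mul_smul_comm _ _ _)
    (fun c a b => by rw [TensorProduct.tmul_add, TensorProduct.add_tmul, map_add, add_mul])
    (fun r c a => by
      rw [TensorProduct.tmul_smul, ← TensorProduct.smul_tmul', map_smul, smul_mul_assoc]))
  map_add' := map_add _
  map_smul' r x := by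
    induction x with
    | zero => simp
    | tmul c w => exact (mul_assoc _ _ _).symm
    | add x y hx hy => rw [smul_add, map_add, map_add, smul_add, hx, hy]

theorem C1.preContract_tmul (e : E) (f : D) (c : C0 q ev) (w : E) :
    C1.preContract q ev e f (c ⊗ₜ w) = C0.ι q ev (e ⊗ₜ w ⊗ₜ f) * c := rfl

include hD in
theorem C1.rel_le_ker (e : E) (f : D) : C1.rel q ev ≤ (C1.preContract q ev e f).ker := by
  refine Submodule.span_le.2 ?_
  rintro _ ⟨v, w, g, rfl⟩
  rw [SetLike.mem_coe, LinearMap.mem_ker, map_sub, TensorProduct.smul_tmul',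
    C1.preContract_tmul, C1.preContract_tmul, C0.ι_contract, mul_smul_comm, mul_one, sub_eq_zero,
    ← map_smul, ← map_smul, ← TensorProduct.tmul_smul, ← TensorProduct.tmul_smul, hD]

/-- The multiplication `E × C₁ → C₂ = L ⊗ C₀`, followed by the pairing with `f ∈ D`. -/
def C1.contractAux (e : E) (f : D) : C1 q ev →ₗ[R] C0 q ev :=
  ((C1.rel q ev).liftQ (C1.preContract q ev e f) (C1.rel_le_ker q ev hD e f)).restrictScalars R

theorem C1.contractAux_mulLeft (e : E) (f : D) (w : E) (c : C0 q ev) :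
    C1.contractAux q ev hD e f (C1.mulLeft q ev w c) = C0.ι q ev (e ⊗ₜ w ⊗ₜ f) * c := rfl

theorem C1.linearMap_ext {A : Type*} [AddCommGroup A] [Module R A] {F G : C1 q ev →ₗ[R] A}
    (h : ∀ e c, F (C1.mulLeft q ev e c) = G (C1.mulLeft q ev e c)) : F = G := by
  refine LinearMap.ext fun x => ?_
  induction x using C1.induction with
  | h₀ => rw [map_zero, map_zero]
  | h₁ e c => exact h e c
  | ha x y hx hy => rw [map_add, map_add, hx, hy]

/-- The multiplication `E × C₁ → C₂ = L ⊗ C₀`, followed by the pairing with `f ∈ D`, as a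
multilinear map.  It is well defined because `L` behaves like a module of rank one. -/
def C1.contract : E →ₗ[R] D →ₗ[R] C1 q ev →ₗ[R] C0 q ev :=
  LinearMap.mk₂ R (C1.contractAux q ev hD)
    (fun a b f => C1.linearMap_ext q ev fun e c => by
      simp only [C1.contractAux_mulLeft, TensorProduct.add_tmul, map_add, add_mul,
        LinearMap.add_apply])
    (fun r a f => C1.linearMap_ext q ev fun e c => by
      simp only [C1.contractAux_mulLeft, ← TensorProduct.smul_tmul', map_smul, smul_mul_assoc,
        LinearMap.smul_apply])
    (fun a f g => C1.linearMap_ext q ev fun e c => by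
      simp only [C1.contractAux_mulLeft, TensorProduct.tmul_add, map_add, add_mul,
        LinearMap.add_apply])
    (fun r a f => C1.linearMap_ext q ev fun e c => by
      simp only [C1.contractAux_mulLeft, TensorProduct.tmul_smul, map_smul, smul_mul_assoc,
        LinearMap.smul_apply])

theorem C1.contract_mulLeft (e : E) (f : D) (w : E) (c : C0 q ev) :
    C1.contract q ev hD e f (C1.mulLeft q ev w c) = C0.ι q ev (e ⊗ₜ w ⊗ₜ f) * c := rfl

theorem C1.contract_op_smul (e : E) (f : D) (x : C1 q ev) (c : C0 q ev) :
    C1.contract q ev hD e f (MulOpposite.op c • x) = C1.contract q ev hD e f x * c :=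
  map_smul ((C1.rel q ev).liftQ (C1.preContract q ev e f) (C1.rel_le_ker q ev hD e f))
    (MulOpposite.op c) x

theorem C1.mulLeft_contract_self (e : E) (f : D) (x : C1 q ev) :
    C1.mulLeft q ev e (C1.contract q ev hD e f x) = ev f (q e) • x := by
  induction x using C1.induction with
  | h₀ => simp
  | h₁ w c => rw [C1.contract_mulLeft, C1.mulLeft_ι_mul]
  | ha x y hx hy => rw [map_add, map_add, hx, hy, smul_add]

theorem C1.contract_mulLeft_self (e : E) (f : D) (c : C0 q ev) :
    C1.contract q ev hD e f (C1.mulLeft q ev e c) = ev f (q e) • c := by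
  rw [C1.contract_mulLeft, C0.ι_sq, Algebra.smul_def]

end Relations

/-- The rank one modules which enter the hyperbolic plane `H_L(N)` and its Clifford module, with
their pairings: `D`, `H` and `P` play the roles of `Hom(L, R)`, `Hom(N, L)` and `Hom(N, R)`. -/
structure LinePairing {R L D : Type*} [CommRing R] [AddCommGroup L] [Module R L]
    [AddCommGroup D] [Module R D] (ev : D →ₗ[R] L →ₗ[R] R) (N H P : Type*)
    [AddCommGroup N] [Module R N] [AddCommGroup H] [Module R H]
    [AddCommGroup P] [Module R P] where
  app : H →ₗ[R] N →ₗ[R] L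
  evP : P →ₗ[R] N →ₗ[R] R
  comp : D →ₗ[R] H →ₗ[R] P
  evP_comp (f : D) (g : H) (n : N) : evP (comp f g) n = ev f (app g n)
  ev_swap (f g : D) (a : L) : ev f a • g = ev g a • f
  evP_swap (φ ψ : P) (n : N) : evP φ n • ψ = evP ψ n • φ
  exists_ev : ∃ f a, ev f a = 1

/-- A pair of modules `X`, `Y` on which `(E, q, L)` acts by Clifford multiplications `E × X → Y`
and `E × Y → L ⊗ X`; the latter is paired with `D`, the dual of `L`. -/
structure CliffordPair (q : QuadraticMap R E L) (ev : D →ₗ[R] L →ₗ[R] R) (X Y : Type*)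
    [AddCommGroup X] [Module R X] [AddCommGroup Y] [Module R Y] where
  A : E →ₗ[R] X →ₗ[R] Y
  B : E →ₗ[R] D →ₗ[R] Y →ₗ[R] X
  A_B (e : E) (f : D) (y : Y) : A e (B e f y) = ev f (q e) • y
  B_A (e : E) (f : D) (x : X) : B e f (A e x) = ev f (q e) • x

/-- The even Clifford algebra and the odd Clifford bimodule, with the Clifford multiplications. -/
def CliffordPair.std (q : QuadraticMap R E L) (ev : D →ₗ[R] L →ₗ[R] R)
    (hD : ∀ (f g : D) (a : L), ev f a • g = ev g a • f) :
    CliffordPair q ev (C0 q ev) (C1 q ev) where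
  A := C1.mulLeft q ev
  B := C1.contract q ev hD
  A_B := C1.mulLeft_contract_self q ev hD
  B_A := C1.contract_mulLeft_self q ev hD

section CliffordModule

variable {N H P X Y : Type*} [AddCommGroup N] [Module R N] [AddCommGroup H] [Module R H]
  [AddCommGroup P] [Module R P] [AddCommGroup X] [Module R X] [AddCommGroup Y] [Module R Y]
  {ev : D →ₗ[R] L →ₗ[R] R} (l : LinePairing ev N H P) {q : QuadraticMap R E L}
  (k : CliffordPair q ev X Y)

namespace LinePairing

/-- The component `X → X` of the action of `u ⊗ w ⊗ f`, for `u, w ∈ H_L(N) ⊥ E`. -/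
def act₁₁ (u w : (N × H) × E) (f : D) : X →ₗ[R] X :=
  k.B u.2 f ∘ₗ k.A w.2 + ev f (l.app w.1.2 u.1.1) • LinearMap.id

/-- The component `Y ⊗ P → X` of the action of `u ⊗ w ⊗ f`. -/
def act₁₂ (u w : (N × H) × E) (f : D) : Y ⊗[R] P →ₗ[R] X :=
  TensorProduct.lift (((LinearMap.lsmul R (X)).flip.compl₂ (l.evP.flip w.1.1)) ∘ₗ
      k.B u.2 f -
    ((LinearMap.lsmul R (X)).flip.compl₂ (l.evP.flip u.1.1)) ∘ₗ k.B w.2 f)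

/-- The component `X → Y ⊗ P` of the action of `u ⊗ w ⊗ f`. -/
def act₂₁ (u w : (N × H) × E) (f : D) : X →ₗ[R] Y ⊗[R] P :=
  (TensorProduct.mk R _ P).flip (l.comp f u.1.2) ∘ₗ k.A w.2 -
    (TensorProduct.mk R _ P).flip (l.comp f w.1.2) ∘ₗ k.A u.2

/-- The component `Y ⊗ P → Y ⊗ P` of the action of `u ⊗ w ⊗ f`. -/
def act₂₂ (u w : (N × H) × E) (f : D) : Y ⊗[R] P →ₗ[R] Y ⊗[R] P :=
  TensorProduct.map LinearMap.id ((l.evP.flip w.1.1).smulRight (l.comp f u.1.2)) +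
    (k.A u.2 ∘ₗ k.B w.2 f).rTensor P

theorem act₁₁_apply (u w : (N × H) × E) (f : D) (x : X) :
    l.act₁₁ k u w f x = k.B u.2 f (k.A w.2 x) + ev f (l.app w.1.2 u.1.1) • x := rfl

theorem act₁₂_tmul (u w : (N × H) × E) (f : D) (y : Y) (φ : P) :
    l.act₁₂ k u w f (y ⊗ₜ φ) =
      l.evP φ w.1.1 • k.B u.2 f y - l.evP φ u.1.1 • k.B w.2 f y := rfl

theorem act₂₁_apply (u w : (N × H) × E) (f : D) (x : X) :
    l.act₂₁ k u w f x =
      k.A w.2 x ⊗ₜ l.comp f u.1.2 - k.A u.2 x ⊗ₜ l.comp f w.1.2 := rfl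

theorem act₂₂_tmul (u w : (N × H) × E) (f : D) (y : Y) (φ : P) :
    l.act₂₂ k u w f (y ⊗ₜ φ) =
      y ⊗ₜ (l.evP φ w.1.1 • l.comp f u.1.2) + k.A u.2 (k.B w.2 f y) ⊗ₜ φ := rfl

/-- The action of `u ⊗ w ⊗ f`, for `u, w ∈ H_L(N) ⊥ E`, on the Clifford module `X ⊕ Y ⊗ P`:
the vectors of `N` contract, those of `H` multiply in the exterior algebra of the hyperbolic
plane, and those of `E` act by Clifford multiplication, with a sign on the second summand. -/
def act (u w : (N × H) × E) (f : D) : Module.End R (X × (Y ⊗[R] P)) :=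
  ((l.act₁₁ k u w f).coprod (l.act₁₂ k u w f)).prod ((l.act₂₁ k u w f).coprod (l.act₂₂ k u w f))

theorem act_apply (u w : (N × H) × E) (f : D) (x : X × (Y ⊗[R] P)) :
    l.act k u w f x = (l.act₁₁ k u w f x.1 + l.act₁₂ k u w f x.2,
      l.act₂₁ k u w f x.1 + l.act₂₂ k u w f x.2) := rfl

section Linearity

/-- A map to linear maps which is linear in each of its three arguments. -/
def IsTrilinear {A B V D : Type*} [AddCommGroup A] [Module R A] [AddCommGroup B] [Module R B]
    [AddCommGroup V] [Module R V] [AddCommGroup D] [Module R D]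
    (F : V → V → D → A →ₗ[R] B) : Prop :=
  (∀ u u' w f, F (u + u') w f = F u w f + F u' w f) ∧
  (∀ u w w' f, F u (w + w') f = F u w f + F u w' f) ∧
  (∀ u w f f', F u w (f + f') = F u w f + F u w f') ∧
  (∀ (r : R) u w f, F (r • u) w f = r • F u w f) ∧
  (∀ (r : R) u w f, F u (r • w) f = r • F u w f) ∧
  (∀ (r : R) u w f, F u w (r • f) = r • F u w f)

theorem act₁₁_lin : IsTrilinear (R := R) (l.act₁₁ k) := by
  refine ⟨fun u u' w f => ?_, fun u w w' f => ?_, fun u w f f' => ?_, fun r u w f => ?_,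
    fun r u w f => ?_, fun r u w f => ?_⟩ <;> refine LinearMap.ext fun c => ?_ <;>
  simp only [act₁₁_apply, LinearMap.add_apply, LinearMap.smul_apply, LinearMap.map_add,
    LinearMap.map_smul, Prod.fst_add, Prod.snd_add, Prod.smul_fst,
    Prod.smul_snd, add_smul, smul_add, smul_assoc]
  all_goals abel

theorem act₂₁_lin : IsTrilinear (R := R) (l.act₂₁ k) := by
  refine ⟨fun u u' w f => ?_, fun u w w' f => ?_, fun u w f f' => ?_, fun r u w f => ?_,
    fun r u w f => ?_, fun r u w f => ?_⟩ <;> refine LinearMap.ext fun c => ?_ <;>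
  simp only [act₂₁_apply, LinearMap.add_apply, LinearMap.smul_apply, LinearMap.map_add,
    LinearMap.map_smul, Prod.fst_add, Prod.snd_add, Prod.smul_fst,
    Prod.smul_snd, smul_sub, TensorProduct.add_tmul, TensorProduct.tmul_add,
    TensorProduct.smul_tmul', TensorProduct.tmul_smul]
  all_goals abel

theorem act₁₂_lin : IsTrilinear (R := R) (l.act₁₂ k) := by
  refine ⟨fun u u' w f => ?_, fun u w w' f => ?_, fun u w f f' => ?_, fun r u w f => ?_,
    fun r u w f => ?_, fun r u w f => ?_⟩ <;> refine TensorProduct.ext' fun x φ => ?_ <;>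
  simp only [act₁₂_tmul, LinearMap.add_apply, LinearMap.smul_apply, LinearMap.map_add,
    LinearMap.map_smul, Prod.fst_add, Prod.snd_add, Prod.smul_fst,
    Prod.smul_snd, add_smul, smul_add, smul_sub, smul_assoc,
    smul_comm _ (l.evP φ _)]
  all_goals abel

theorem act₂₂_lin : IsTrilinear (R := R) (l.act₂₂ k) := by
  refine ⟨fun u u' w f => ?_, fun u w w' f => ?_, fun u w f f' => ?_, fun r u w f => ?_,
    fun r u w f => ?_, fun r u w f => ?_⟩ <;> refine TensorProduct.ext' fun x φ => ?_ <;>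
  simp only [act₂₂_tmul, LinearMap.add_apply, LinearMap.smul_apply, LinearMap.map_add,
    LinearMap.map_smul, Prod.fst_add, Prod.snd_add, Prod.smul_fst,
    Prod.smul_snd, add_smul, smul_add, smul_assoc,
    smul_comm _ (l.evP φ _), TensorProduct.add_tmul, TensorProduct.tmul_add,
    ← TensorProduct.smul_tmul', TensorProduct.tmul_smul]
  all_goals abel

end Linearity

theorem act_lin : IsTrilinear (R := R) (l.act k) := by
  obtain ⟨a₁, a₂, a₃, a₄, a₅, a₆⟩ := l.act₁₁_lin k
  obtain ⟨b₁, b₂, b₃, b₄, b₅, b₆⟩ := l.act₁₂_lin k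
  obtain ⟨c₁, c₂, c₃, c₄, c₅, c₆⟩ := l.act₂₁_lin k
  obtain ⟨d₁, d₂, d₃, d₄, d₅, d₆⟩ := l.act₂₂_lin k
  have hadd {A B : Type _} [AddCommGroup A] [Module R A] [AddCommGroup B] [Module R B]
      (a a' : A →ₗ[R] A) (b b' : B →ₗ[R] A) (c c' : A →ₗ[R] B) (d d' : B →ₗ[R] B) :
      ((a + a').coprod (b + b')).prod ((c + c').coprod (d + d')) =
        (a.coprod b).prod (c.coprod d) + (a'.coprod b').prod (c'.coprod d') := by
    refine LinearMap.ext fun x => Prod.ext ?_ ?_ <;> exact add_add_add_comm _ _ _ _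
  have hsmul {A B : Type _} [AddCommGroup A] [Module R A] [AddCommGroup B] [Module R B] (r : R)
      (a : A →ₗ[R] A) (b : B →ₗ[R] A) (c : A →ₗ[R] B) (d : B →ₗ[R] B) :
      ((r • a).coprod (r • b)).prod ((r • c).coprod (r • d)) =
        r • (a.coprod b).prod (c.coprod d) := by
    refine LinearMap.ext fun x => Prod.ext ?_ ?_ <;> exact (smul_add _ _ _).symm
  refine ⟨fun u u' w f => ?_, fun u w w' f => ?_, fun u w f f' => ?_, fun r u w f => ?_,
    fun r u w f => ?_, fun r u w f => ?_⟩
  · rw [act, a₁, b₁, c₁, d₁]; exact hadd ..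
  · rw [act, a₂, b₂, c₂, d₂]; exact hadd ..
  · rw [act, a₃, b₃, c₃, d₃]; exact hadd ..
  · rw [act, a₄, b₄, c₄, d₄]; exact hsmul ..
  · rw [act, a₅, b₅, c₅, d₅]; exact hsmul ..
  · rw [act, a₆, b₆, c₆, d₆]; exact hsmul ..

/-- `LinePairing.act` as a linear map on the generators of the even Clifford algebra. -/
def actGen : ((N × H) × E) ⊗[R] ((N × H) × E) ⊗[R] D →ₗ[R] Module.End R (X × (Y ⊗[R] P)) :=
  TensorProduct.lift <| TensorProduct.lift <| LinearMap.mk₂ R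
    (fun u w => ({ toFun := l.act k u w
                   map_add' := (l.act_lin k).2.2.1 u w
                   map_smul' := fun r => (l.act_lin k).2.2.2.2.2 r u w } :
      D →ₗ[R] Module.End R (X × (Y ⊗[R] P))))
    (fun u u' w => LinearMap.ext fun f => (l.act_lin k).1 u u' w f)
    (fun r u w => LinearMap.ext fun f => (l.act_lin k).2.2.2.1 r u w f)
    (fun u w w' => LinearMap.ext fun f => (l.act_lin k).2.1 u w w' f)
    (fun r u w => LinearMap.ext fun f => (l.act_lin k).2.2.2.2.1 r u w f)

theorem actGen_tmul (u w : (N × H) × E) (f : D) :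
    l.actGen k (u ⊗ₜ w ⊗ₜ f) = l.act k u w f := rfl

end LinePairing

end CliffordModule

end Algebra

/-! ### The action of the even Clifford algebra of a hyperbolic extension -/

section CliffordAction

variable {R E L D N H P X Y : Type*} [CommRing R] [AddCommGroup E] [Module R E]
  [AddCommGroup L] [Module R L] [AddCommGroup D] [Module R D]
  [AddCommGroup N] [Module R N] [AddCommGroup H] [Module R H]
  [AddCommGroup P] [Module R P] [AddCommGroup X] [Module R X] [AddCommGroup Y] [Module R Y]
  {ev : D →ₗ[R] L →ₗ[R] R} (l : LinePairing ev N H P) {q : QuadraticMap R E L}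
  (k : CliffordPair q ev X Y)
  {Q : QuadraticMap R ((N × H) × E) L} (hQ : ∀ n h e, Q ((n, h), e) = l.app h n + q e)

section

variable {M : Type*} [AddCommGroup M] [Module R M] {s α β γ δ ω ν υ : R}

/-- The entry `X → X` of the matrix identity behind `LinePairing.act_mul_act`.  Here `s` stands for
`ev f (q v)`, and `α`, `β`, `γ`, `δ` for the values of pairings `H × N → R`. -/
theorem entry₁₁_smul (h : β * γ = α * δ) (x₁ x₂ x₃ c : M) :
    s • x₁ + β • x₃ + γ • (x₂ + β • c) + (α • x₁ - β • x₃ - (γ • x₂ - δ • s • c)) =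
      (α + s) • (x₁ + δ • c) := by
  linear_combination (norm := module) congrArg (· • c) h

/-- The entry `Y ⊗ P → X` of the same identity; `ω`, `ν`, `υ` stand for the values of an element
of `P`. -/
theorem entry₁₂_smul (h : ν * β = α * υ) (x₁ x₂ x₃ x₄ : M) :
    ω • (s • x₁ + β • x₃) - ν • (x₂ + β • x₄) +
      ((ω * α) • x₁ - (ω * β) • x₃ + (ν • x₂ - υ • s • x₄)) = (α + s) • (ω • x₁ - υ • x₄) := by
  linear_combination (norm := module) -congrArg (· • x₄) h

/-- The entry `X → Y ⊗ P` of the same identity. -/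
theorem entry₂₁_smul {e g : M} (h : γ • e = α • g) (a b d : M) :
    s • a - b + γ • (d - e) + (α • a + b - (γ • d + s • g)) = (α + s) • (a - g) := by
  linear_combination (norm := module) -h

/-- The entry `Y ⊗ P → Y ⊗ P` of the same identity. -/
theorem entry₂₂_smul {e g : M} (h : ν • e = α • g) (a b d : M) :
    ω • (s • a - b) - ν • (d - e) + (ω • (α • a + b) + (ν • d + s • g)) =
      (α + s) • (ω • a + g) := by
  linear_combination (norm := module) h

end

namespace LinePairing

include hQ in
theorem act_self (v : (N × H) × E) (f : D) :
    l.act k v v f = algebraMap R _ (ev f (Q v)) := by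
  have hv : Q v = l.app v.1.2 v.1.1 + q v.2 := hQ _ _ _
  have h₁ (c) : l.act₁₁ k v v f c = ev f (Q v) • c := by
    rw [act₁₁_apply, k.B_A, hv, LinearMap.map_add, add_smul, add_comm]
  have h₂ : l.act₁₂ k v v f = 0 := TensorProduct.ext' fun x φ => by
    rw [act₁₂_tmul, sub_self, LinearMap.zero_apply]
  have h₃ (c) : l.act₂₁ k v v f c = 0 := by rw [act₂₁_apply, sub_self]
  have h₄ : l.act₂₂ k v v f = ev f (Q v) • LinearMap.id := TensorProduct.ext' fun x φ => by
    rw [act₂₂_tmul, k.A_B, LinearMap.smul_apply, LinearMap.id_apply, hv,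
      LinearMap.map_add, l.evP_swap φ, l.evP_comp, TensorProduct.tmul_smul,
      ← TensorProduct.smul_tmul', add_smul]
  refine LinearMap.ext fun x => ?_
  rw [act_apply, h₁, h₂, h₃, h₄, LinearMap.zero_apply, add_zero, zero_add]
  rfl

/-- Contraction of two adjacent equal vectors, for a single element `f` of the dual of `L`. -/
theorem act_mul_act (u v w : (N × H) × E) (f : D) :
    l.act k u v f * l.act k v w f = ev f (l.app v.1.2 v.1.1 + q v.2) • l.act k u w f := by
  -- `r₁`, `r₂` and `r₃` express that the modules involved behave like free modules of rank one.
  have r₁ : ev f (l.app v.1.2 u.1.1) * ev f (l.app w.1.2 v.1.1) =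
      ev f (l.app v.1.2 v.1.1) * ev f (l.app w.1.2 u.1.1) := by
    have h := congrArg (fun φ => l.evP φ v.1.1) (l.evP_swap (l.comp f v.1.2) (l.comp f w.1.2) u.1.1)
    simp only [LinearMap.map_smul, LinearMap.smul_apply, l.evP_comp, smul_eq_mul] at h
    rw [h, mul_comm]
  have r₂ (φ : P) : l.evP φ v.1.1 * ev f (l.app v.1.2 u.1.1) =
      ev f (l.app v.1.2 v.1.1) * l.evP φ u.1.1 := by
    have h := congrArg (fun φ => l.evP φ u.1.1) (l.evP_swap φ (l.comp f v.1.2) v.1.1)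
    simpa only [LinearMap.map_smul, LinearMap.smul_apply, l.evP_comp, smul_eq_mul] using h
  have r₃ (y : Y) (φ : P) : l.evP φ v.1.1 • (y ⊗ₜ[R] l.comp f v.1.2) =
      ev f (l.app v.1.2 v.1.1) • (y ⊗ₜ[R] φ) := by
    rw [← TensorProduct.tmul_smul, l.evP_swap, l.evP_comp, TensorProduct.tmul_smul]
  have h₁ (c) : l.act₁₁ k u v f (l.act₁₁ k v w f c) + l.act₁₂ k u v f (l.act₂₁ k v w f c) =
      ev f (l.app v.1.2 v.1.1 + q v.2) • l.act₁₁ k u w f c := by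
    simp only [act₁₁_apply, act₂₁_apply, act₁₂_tmul, LinearMap.map_add, LinearMap.map_smul,
      LinearMap.map_sub, k.B_A, k.A_B, l.evP_comp]
    exact entry₁₁_smul r₁ _ _ _ _
  have h₂ (y) : l.act₁₁ k u v f (l.act₁₂ k v w f y) + l.act₁₂ k u v f (l.act₂₂ k v w f y) =
      ev f (l.app v.1.2 v.1.1 + q v.2) • l.act₁₂ k u w f y := by
    induction y with
    | zero => simp only [LinearMap.map_zero, add_zero, smul_zero]
    | tmul x φ =>
      simp only [act₁₁_apply, act₂₂_tmul, act₁₂_tmul, LinearMap.map_add, LinearMap.map_smul,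
        LinearMap.map_sub, k.B_A, k.A_B, l.evP_comp,
        LinearMap.smul_apply, smul_eq_mul]
      exact entry₁₂_smul (r₂ φ) _ _ _ _
    | add x y hx hy =>
      rw [LinearMap.map_add (l.act₁₂ k u w f), smul_add, ← hx, ← hy, LinearMap.map_add,
        LinearMap.map_add, LinearMap.map_add, LinearMap.map_add]
      exact add_add_add_comm _ _ _ _
  have h₃ (c) : l.act₂₁ k u v f (l.act₁₁ k v w f c) + l.act₂₂ k u v f (l.act₂₁ k v w f c) =
      ev f (l.app v.1.2 v.1.1 + q v.2) • l.act₂₁ k u w f c := by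
    simp only [act₁₁_apply, act₂₁_apply, act₂₂_tmul, LinearMap.map_add, LinearMap.map_smul,
      LinearMap.map_sub, k.B_A, k.A_B, l.evP_comp, TensorProduct.tmul_smul,
      ← TensorProduct.smul_tmul']
    refine entry₂₁_smul ?_ _ _ _
    have h := r₃ (k.A u.2 c) (l.comp f w.1.2)
    rwa [l.evP_comp] at h
  have h₄ (y) : l.act₂₁ k u v f (l.act₁₂ k v w f y) + l.act₂₂ k u v f (l.act₂₂ k v w f y) =
      ev f (l.app v.1.2 v.1.1 + q v.2) • l.act₂₂ k u w f y := by
    induction y with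
    | zero => simp only [LinearMap.map_zero, add_zero, smul_zero]
    | tmul x φ =>
      simp only [act₂₁_apply, act₂₂_tmul, act₁₂_tmul, LinearMap.map_add, LinearMap.map_smul,
        LinearMap.map_sub, k.B_A, k.A_B, l.evP_comp, TensorProduct.tmul_smul,
        ← TensorProduct.smul_tmul']
      exact entry₂₂_smul (r₃ _ φ) _ _ _
    | add x y hx hy =>
      rw [LinearMap.map_add (l.act₂₂ k u w f), smul_add, ← hx, ← hy, LinearMap.map_add,
        LinearMap.map_add, LinearMap.map_add, LinearMap.map_add]
      exact add_add_add_comm _ _ _ _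
  refine LinearMap.ext fun x => ?_
  rw [Module.End.mul_apply, act_apply, act_apply, LinearMap.smul_apply, act_apply]
  refine Prod.ext ?_ ?_
  · change l.act₁₁ k u v f (_ + _) + l.act₁₂ k u v f (_ + _) = _ • (_ + _)
    rw [LinearMap.map_add, LinearMap.map_add, smul_add, ← h₁, ← h₂]
    exact add_add_add_comm _ _ _ _
  · change l.act₂₁ k u v f (_ + _) + l.act₂₂ k u v f (_ + _) = _ • (_ + _)
    rw [LinearMap.map_add, LinearMap.map_add, smul_add, ← h₃, ← h₄]
    exact add_add_add_comm _ _ _ _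

include hQ in
theorem act_contract (u v w : (N × H) × E) (f g : D) :
    l.act k u v f * l.act k v w g = ev f (Q v) • l.act k u w g := by
  -- Both sides are linear in `f` and `g`, and `D` is generated by `f₀`.
  obtain ⟨f₀, a, h₀⟩ := l.exists_ev
  have hf (f : D) : f = ev f a • f₀ := by rw [← l.ev_swap, h₀, one_smul]
  have hs (u w : (N × H) × E) (f : D) : l.act k u w f = ev f a • l.act k u w f₀ := by
    have h := LinearMap.map_smul (l.actGen k) (ev f a) (u ⊗ₜ w ⊗ₜ f₀)
    rwa [← TensorProduct.tmul_smul, actGen_tmul, actGen_tmul, ← hf] at h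
  have hv : Q v = l.app v.1.2 v.1.1 + q v.2 := hQ _ _ _
  rw [hs u v f, hs v w g, hs u w g, smul_mul_smul_comm, act_mul_act, ← hv, smul_smul, smul_smul]
  conv_rhs => rw [hf f]
  rw [map_smul, LinearMap.smul_apply, smul_eq_mul]
  congr 1
  ring

/-- The left action of the even Clifford algebra of `H_L(N) ⊥ (E, q)` on `C₀(q) ⊕ C₁(q) ⊗ P`. -/
def rho : C0 Q ev →ₐ[R] Module.End R (X × (Y ⊗[R] P)) :=
  C0.lift Q ev (A := Module.End R (X × (Y ⊗[R] P))) (l.actGen k) (fun v f => l.act_self k hQ v f)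
    (fun u v w f g => l.act_contract k hQ u v w f g)

theorem rho_ι (u w : (N × H) × E) (f : D) :
    l.rho k hQ (C0.ι Q ev (u ⊗ₜ w ⊗ₜ f)) = l.act k u w f :=
  C0.lift_ι Q ev _ _ _ _

theorem rho_add_apply (y z : C0 Q ev) (x : X × (Y ⊗[R] P)) :
    l.rho k hQ (y + z) x = l.rho k hQ y x + l.rho k hQ z x :=
  LinearMap.congr_fun ((l.rho k hQ).map_add' y z) x

theorem rho_zero_apply (x : X × (Y ⊗[R] P)) : l.rho k hQ 0 x = 0 :=
  LinearMap.congr_fun ((l.rho k hQ).map_zero') x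

theorem rho_mul_apply (y z : C0 Q ev) (x : X × (Y ⊗[R] P)) :
    l.rho k hQ (y * z) x = l.rho k hQ y (l.rho k hQ z x) :=
  LinearMap.congr_fun ((l.rho k hQ).map_mul' y z) x

theorem rho_algebraMap_apply (r : R) (x : X × (Y ⊗[R] P)) :
    l.rho k hQ (algebraMap R _ r) x = r • x :=
  LinearMap.congr_fun ((l.rho k hQ).commutes r) x

end LinePairing

section Naturality

variable {R' E' L' D' N' H' P' X' Y' : Type*} [CommRing R'] [AddCommGroup E'] [Module R' E']
  [AddCommGroup L'] [Module R' L'] [AddCommGroup D'] [Module R' D']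
  [AddCommGroup N'] [Module R' N'] [AddCommGroup H'] [Module R' H']
  [AddCommGroup P'] [Module R' P'] [AddCommGroup X'] [Module R' X'] [AddCommGroup Y'] [Module R' Y']
  {ev' : D' →ₗ[R'] L' →ₗ[R'] R'} (l' : LinePairing ev' N' H' P')
  {q' : QuadraticMap R' E' L'} (k' : CliffordPair q' ev' X' Y')
  {Q' : QuadraticMap R' ((N' × H') × E') L'} (hQ' : ∀ n h e, Q' ((n, h), e) = l'.app h n + q' e)
  {σ : R →+* R'} (a : E →ₛₗ[σ] E') (d : D →ₛₗ[σ] D') (p : P →ₛₗ[σ] P') (b : N → N') (c : H → H')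
  (hp : ∀ φ n, l'.evP (p φ) (b n) = σ (l.evP φ n))
  (hc : ∀ f g, l'.comp (d f) (c g) = p (l.comp f g))
  (t : ((N × H) × E) →ₛₗ[σ] ((N' × H') × E'))
  (ht : ∀ u, t u = ((b u.1.1, c u.1.2), a u.2))
  (hd : ∀ f x, ev' (d f) (Q' (t x)) = σ (ev f (Q x)))
  (x₀ : X →ₛₗ[σ] X') (y₀ : Y →ₛₗ[σ] Y') (hA : ∀ e x, y₀ (k.A e x) = k'.A (a e) (x₀ x))
  (hB : ∀ e f y, x₀ (k.B e f y) = k'.B (a e) (d f) (y₀ y))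

/-- The map induced on Clifford modules by semilinear maps of their constituents. -/
def CliffordPair.map : X × (Y ⊗[R] P) →ₛₗ[σ] X' × (Y' ⊗[R'] P') where
  toFun z := (x₀ z.1, TensorProduct.map y₀ p z.2)
  map_add' _ _ := Prod.ext (x₀.map_add _ _) ((TensorProduct.map y₀ p).map_add _ _)
  map_smul' _ _ := Prod.ext (x₀.map_smulₛₗ _ _) ((TensorProduct.map y₀ p).map_smulₛₗ _ _)

include hp hc ht hA hB in
theorem LinePairing.map_act (u w : (N × H) × E) (f : D) (z : X × (Y ⊗[R] P)) :
    CliffordPair.map p x₀ y₀ (l.act k u w f z) =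
      l'.act k' (t u) (t w) (d f) (CliffordPair.map p x₀ y₀ z) := by
  have hev (g : H) (n : N) : ev' (d f) (l'.app (c g) (b n)) = σ (ev f (l.app g n)) := by
    rw [← l'.evP_comp, hc, hp, l.evP_comp]
  have h₁ (x) : x₀ (l.act₁₁ k u w f x) = l'.act₁₁ k' (t u) (t w) (d f) (x₀ x) := by
    rw [act₁₁_apply, x₀.map_add, hB, hA, x₀.map_smulₛₗ, act₁₁_apply, ht u, ht w, hev]
  have h₂ (y) : x₀ (l.act₁₂ k u w f y) =
      l'.act₁₂ k' (t u) (t w) (d f) (TensorProduct.map y₀ p y) := by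
    induction y with
    | zero => rw [LinearMap.map_zero, LinearMap.map_zero, LinearMap.map_zero, LinearMap.map_zero]
    | tmul x φ =>
      rw [act₁₂_tmul, x₀.map_sub, x₀.map_smulₛₗ, x₀.map_smulₛₗ, hB, hB, TensorProduct.map_tmul,
        act₁₂_tmul, ht u, ht w, hp, hp]
    | add x y hx hy =>
      rw [LinearMap.map_add, LinearMap.map_add, LinearMap.map_add, LinearMap.map_add, hx, hy]
  have h₃ (x) : TensorProduct.map y₀ p (l.act₂₁ k u w f x) =
      l'.act₂₁ k' (t u) (t w) (d f) (x₀ x) := by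
    rw [act₂₁_apply, LinearMap.map_sub, TensorProduct.map_tmul, TensorProduct.map_tmul, hA, hA,
      act₂₁_apply, ht u, ht w, hc, hc]
  have h₄ (y) : TensorProduct.map y₀ p (l.act₂₂ k u w f y) =
      l'.act₂₂ k' (t u) (t w) (d f) (TensorProduct.map y₀ p y) := by
    induction y with
    | zero => rw [LinearMap.map_zero, LinearMap.map_zero, LinearMap.map_zero]
    | tmul x φ =>
      rw [act₂₂_tmul, LinearMap.map_add, TensorProduct.map_tmul, TensorProduct.map_tmul, hA, hB,
        TensorProduct.map_tmul, act₂₂_tmul, ht u, ht w, hp, hc, LinearMap.map_smulₛₗ]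
    | add x y hx hy =>
      rw [LinearMap.map_add, LinearMap.map_add, LinearMap.map_add, LinearMap.map_add, hx, hy]
  refine Prod.ext ?_ ?_
  · change x₀ (l.act₁₁ k u w f z.1 + l.act₁₂ k u w f z.2) =
      l'.act₁₁ k' (t u) (t w) (d f) (x₀ z.1) +
        l'.act₁₂ k' (t u) (t w) (d f) (TensorProduct.map y₀ p z.2)
    rw [x₀.map_add, h₁, h₂]
  · change TensorProduct.map y₀ p (l.act₂₁ k u w f z.1 + l.act₂₂ k u w f z.2) =
      l'.act₂₁ k' (t u) (t w) (d f) (x₀ z.1) +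
        l'.act₂₂ k' (t u) (t w) (d f) (TensorProduct.map y₀ p z.2)
    rw [LinearMap.map_add, h₃, h₄]

include hp hc ht hA hB in
/-- The action of the even Clifford algebra is compatible with semilinear maps. -/
theorem LinePairing.map_rho (z : C0 Q ev) (x : X × (Y ⊗[R] P)) :
    CliffordPair.map p x₀ y₀ (l.rho k hQ z x) =
      l'.rho k' hQ' (C0.map t d hd z) (CliffordPair.map p x₀ y₀ x) := by
  have ma (y z : C0 Q ev) : C0.map t d hd (y + z) = C0.map t d hd y + C0.map t d hd z :=
    (C0.map t d hd).map_add y z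
  induction z using C0.induction generalizing x with
  | h₀ r =>
    rw [rho_algebraMap_apply, C0.map_algebraMap, rho_algebraMap_apply, LinearMap.map_smulₛₗ]
  | h₁ s =>
    rw [C0.map_ι]
    induction s with
    | zero => rw [LinearMap.map_zero, LinearMap.map_zero, LinearMap.map_zero, rho_zero_apply,
        rho_zero_apply, LinearMap.map_zero]
    | tmul s f =>
      rw [TensorProduct.map_tmul]
      induction s with
      | zero => rw [LinearMap.map_zero, TensorProduct.zero_tmul, TensorProduct.zero_tmul,
          LinearMap.map_zero, LinearMap.map_zero, rho_zero_apply, rho_zero_apply,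
          LinearMap.map_zero]
      | tmul u w =>
        rw [rho_ι, l.map_act k l' k' a d p b c hp hc t ht x₀ y₀ hA hB, TensorProduct.map_tmul,
          rho_ι]
      | add s r hs hr => rw [LinearMap.map_add, TensorProduct.add_tmul, TensorProduct.add_tmul,
          LinearMap.map_add, LinearMap.map_add, rho_add_apply, rho_add_apply, LinearMap.map_add,
          hs, hr]
    | add s r hs hr => rw [LinearMap.map_add, LinearMap.map_add, LinearMap.map_add, rho_add_apply,
        rho_add_apply, LinearMap.map_add, hs, hr]
  | hm y z hy hz => rw [rho_mul_apply, hy, hz, (C0.map t d hd).map_mul, rho_mul_apply]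
  | ha y z hy hz => rw [rho_add_apply, LinearMap.map_add, hy, hz, ma, rho_add_apply]

end Naturality

end CliffordAction

/-! ### Bases of the Clifford module -/

section Frames

variable {R E L D N H P : Type*} [CommRing R] [AddCommGroup E] [Module R E]
  [AddCommGroup L] [Module R L] [AddCommGroup D] [Module R D]
  [AddCommGroup N] [Module R N] [AddCommGroup H] [Module R H]
  [AddCommGroup P] [Module R P]
  {ev : D →ₗ[R] L →ₗ[R] R} (l : LinePairing ev N H P) {q : QuadraticMap R E L}
  {Q : QuadraticMap R ((N × H) × E) L} (hQ : ∀ n h e, Q ((n, h), e) = l.app h n + q e)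

namespace LinePairing

variable (q) in
/-- The even and the odd Clifford modules of `q`. -/
abbrev std : CliffordPair q ev (C0 q ev) (C1 q ev) := CliffordPair.std q ev l.ev_swap

/-- The action of the even Clifford algebra of `H_L(N) ⊥ (E, q)` is linear over the even Clifford
algebra of `q`. -/
theorem rho_op_smul (z : C0 Q ev) (c : C0 q ev) (x : Bimod P q ev) :
    l.rho (l.std q) hQ z (MulOpposite.op c • x) = MulOpposite.op c • l.rho (l.std q) hQ z x := by
  let x₀ : C0 q ev →ₗ[R] C0 q ev := LinearMap.mulRight R c
  let y₀ : C1 q ev →ₗ[R] C1 q ev :=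
    { toFun := fun y => MulOpposite.op c • y
      map_add' := smul_add _
      map_smul' := fun r y => smul_comm _ r y }
  have h := l.map_rho (l.std q) hQ l (l.std q) hQ LinearMap.id LinearMap.id LinearMap.id id id
    (fun _ _ => rfl) (fun _ _ => rfl) LinearMap.id (fun _ => rfl) (fun _ _ => rfl)
    x₀ y₀ (fun e x => (C1.mulLeft_mul q ev e x c).symm)
    (fun e f y => (C1.contract_op_smul q ev l.ev_swap e f y c).symm) z
  have h' (x : Bimod P q ev) :
      CliffordPair.map LinearMap.id x₀ y₀ x = MulOpposite.op c • x := by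
    refine Prod.ext rfl ?_
    change TensorProduct.map y₀ LinearMap.id x.2 = MulOpposite.op c • x.2
    induction x.2 with
    | zero => rw [LinearMap.map_zero, smul_zero]
    | tmul => rfl
    | add x y hx hy => rw [LinearMap.map_add, smul_add, hx, hy]
  rw [C0.map_id' _ _ _ (fun _ => rfl) (fun _ => rfl) (fun _ => rfl)] at h
  rw [← h', ← h']
  exact (h x).symm

/-- Generators of the rank one modules, together with a vector `v` for which `q v` generates `L`. -/
structure Frame (q : QuadraticMap R E L) where
  f₀ : D
  n₀ : N
  h₀ : H
  v : E
  ev_v : ev f₀ (q v) = 1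
  ev_app : ev f₀ (l.app h₀ n₀) = 1
  eq_smul_n (n : N) : n = l.evP (l.comp f₀ h₀) n • n₀
  eq_smul_h (h : H) : h = ev f₀ (l.app h n₀) • h₀

namespace Frame

variable {l} (F : l.Frame q)

/-- The generator of `P`. -/
def φ₀ : P := l.comp F.f₀ F.h₀

theorem evP_φ₀ : l.evP F.φ₀ F.n₀ = 1 := by rw [φ₀, l.evP_comp, F.ev_app]

theorem eq_smul_f (f : D) : f = ev f (q F.v) • F.f₀ := by
  rw [l.ev_swap, F.ev_v, one_smul]

theorem eq_smul_φ (φ : P) : φ = l.evP φ F.n₀ • F.φ₀ := by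
  rw [l.evP_swap, F.evP_φ₀, one_smul]

/-- The second vector of the basis of the Clifford module; the first one is `(1, 0)`. -/
def p₁ : Bimod P q ev := (0, C1.mulLeft q ev F.v 1 ⊗ₜ F.φ₀)

/-- The second coordinate on the Clifford module. -/
def coord₂ : C1 q ev ⊗[R] P →ₗ[R] C0 q ev :=
  TensorProduct.lift (((LinearMap.lsmul R (C0 q ev)).flip.compl₂ (l.evP.flip F.n₀)) ∘ₗ
    C1.contract q ev l.ev_swap F.v F.f₀)

theorem coord₂_tmul (y : C1 q ev) (φ : P) :
    F.coord₂ (y ⊗ₜ φ) = l.evP φ F.n₀ • C1.contract q ev l.ev_swap F.v F.f₀ y := rfl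

theorem op_smul_p₁ (b : C0 q ev) :
    MulOpposite.op b • F.p₁ = ((0, C1.mulLeft q ev F.v b ⊗ₜ F.φ₀) : Bimod P q ev) := by
  refine Prod.ext (zero_mul b) ?_
  change (MulOpposite.op b • C1.mulLeft q ev F.v 1) ⊗ₜ F.φ₀ = C1.mulLeft q ev F.v b ⊗ₜ F.φ₀
  rw [← C1.mulLeft_mul, one_mul]

theorem coord₂_mulLeft (b : C0 q ev) :
    F.coord₂ (C1.mulLeft q ev F.v b ⊗ₜ F.φ₀) = b := by
  rw [coord₂_tmul, F.evP_φ₀, one_smul, C1.contract_mulLeft_self, F.ev_v, one_smul]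

theorem mulLeft_coord₂ (y : C1 q ev ⊗[R] P) :
    C1.mulLeft q ev F.v (F.coord₂ y) ⊗ₜ F.φ₀ = y := by
  induction y with
  | zero => rw [LinearMap.map_zero, LinearMap.map_zero, TensorProduct.zero_tmul]
  | tmul y φ =>
    rw [coord₂_tmul, LinearMap.map_smul, C1.mulLeft_contract_self, F.ev_v, one_smul,
      TensorProduct.smul_tmul, ← F.eq_smul_φ]
  | add x y hx hy =>
    rw [LinearMap.map_add, LinearMap.map_add, TensorProduct.add_tmul, hx, hy]

theorem coord₂_op_smul (y : C1 q ev ⊗[R] P) (c : C0 q ev) :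
    F.coord₂ (MulOpposite.op c • y) = F.coord₂ y * c := by
  induction y with
  | zero => rw [smul_zero, LinearMap.map_zero, zero_mul]
  | tmul y φ =>
    change F.coord₂ ((MulOpposite.op c • y) ⊗ₜ φ) = _
    rw [coord₂_tmul, C1.contract_op_smul, coord₂_tmul, smul_mul_assoc]
  | add x y hx hy => rw [smul_add, LinearMap.map_add, LinearMap.map_add, add_mul, hx, hy]

/-- The vectors `(1, 0)` and `p₁` generate the Clifford module. -/
theorem eq_coord (x : Bimod P q ev) :
    x = MulOpposite.op x.1 • ((1, 0) : Bimod P q ev) + MulOpposite.op (F.coord₂ x.2) • F.p₁ := by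
  rw [op_smul_p₁, mulLeft_coord₂]
  refine Prod.ext ?_ ?_
  · change x.1 = 1 * x.1 + 0
    rw [one_mul, add_zero]
  · change x.2 = MulOpposite.op x.1 • 0 + x.2
    rw [smul_zero, zero_add]

section Brackets

variable (Q) in
/-- The product of two vectors of `H_L(N) ⊥ (E, q)`, paired with `f₀`. -/
def br : ((N × H) × E) →ₗ[R] ((N × H) × E) →ₗ[R] C0 Q ev :=
  LinearMap.mk₂ R (fun u w => C0.ι Q ev (u ⊗ₜ w ⊗ₜ F.f₀))
    (fun u u' w => by rw [TensorProduct.add_tmul, TensorProduct.add_tmul, LinearMap.map_add])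
    (fun r u w => by
      rw [← TensorProduct.smul_tmul', ← TensorProduct.smul_tmul', LinearMap.map_smul])
    (fun u w w' => by rw [TensorProduct.tmul_add, TensorProduct.add_tmul, LinearMap.map_add])
    (fun r u w => by
      rw [TensorProduct.tmul_smul, ← TensorProduct.smul_tmul', LinearMap.map_smul])

theorem br_apply (u w : (N × H) × E) : F.br Q u w = C0.ι Q ev (u ⊗ₜ w ⊗ₜ F.f₀) := rfl

/-- The vector `n₀` of `H_L(N) ⊥ (E, q)`. -/
def n : (N × H) × E := ((F.n₀, 0), 0)

/-- The vector `h₀` of `H_L(N) ⊥ (E, q)`. -/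
def h : (N × H) × E := ((0, F.h₀), 0)

/-- A vector of `E`, as a vector of `H_L(N) ⊥ (E, q)`. -/
def inE {ev : D →ₗ[R] L →ₗ[R] R} (_l : LinePairing ev N H P) : E →ₗ[R] (N × H) × E :=
  LinearMap.inr R _ _

theorem eq_sum (u : (N × H) × E) :
    u = l.evP (l.comp F.f₀ F.h₀) u.1.1 • F.n + ev F.f₀ (l.app u.1.2 F.n₀) • F.h +
      inE l u.2 := by
  refine Prod.ext (Prod.ext ?_ ?_) ?_
  · change u.1.1 = _ • F.n₀ + _ • 0 + 0
    rw [← F.eq_smul_n, smul_zero, add_zero, add_zero]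
  · change u.1.2 = _ • 0 + _ • F.h₀ + 0
    rw [← F.eq_smul_h, smul_zero, zero_add, add_zero]
  · change u.2 = _ • 0 + _ • 0 + u.2
    rw [smul_zero, smul_zero, zero_add, zero_add]

theorem br_self (u : (N × H) × E) : F.br Q u u = algebraMap R _ (ev F.f₀ (Q u)) :=
  C0.ι_sq Q ev u F.f₀

theorem br_swap {u w : (N × H) × E} (h : QuadraticMap.polar Q u w = 0) :
    F.br Q u w = -F.br Q w u := by
  have h' := C0.ι_add_swap Q ev u w F.f₀
  rw [h, LinearMap.map_zero, RingHom.map_zero] at h'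
  exact eq_neg_of_add_eq_zero_left h'

theorem br_mul_swap (u x : (N × H) × E) {v w : (N × H) × E} (h : QuadraticMap.polar Q v w = 0) :
    F.br Q u v * F.br Q w x = -(F.br Q u w * F.br Q v x) := by
  have h' := C0.ι_contract_add_swap Q ev u v w x F.f₀ F.f₀
  rw [h, LinearMap.map_zero, zero_smul] at h'
  exact eq_neg_of_add_eq_zero_left h'

theorem polar_comm {u w : (N × H) × E} (h : QuadraticMap.polar Q u w = 0) :
    QuadraticMap.polar Q w u = 0 := by rw [QuadraticMap.polar_comm, h]

include hQ in
theorem Q_inE (e : E) : Q (inE l e) = q e := by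
  rw [show inE l e = ((0, 0), e) from rfl, hQ, LinearMap.map_zero, zero_add]

include hQ in
theorem Q_n : Q F.n = 0 := by
  rw [show F.n = ((F.n₀, 0), 0) from rfl, hQ, LinearMap.map_zero, QuadraticMap.map_zero, add_zero,
    LinearMap.zero_apply]

include hQ in
theorem Q_h : Q F.h = 0 := by
  rw [show F.h = ((0, F.h₀), 0) from rfl, hQ, LinearMap.map_zero, QuadraticMap.map_zero, add_zero]

include hQ in
theorem polar_n_inE (e : E) : QuadraticMap.polar Q F.n (inE l e) = 0 := by
  have h : F.n + inE l e = ((F.n₀, 0), e) :=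
    Prod.ext (Prod.ext (add_zero _) (add_zero _)) (zero_add _)
  rw [QuadraticMap.polar, h, F.Q_n hQ, Q_inE hQ, hQ, LinearMap.map_zero, LinearMap.zero_apply,
    zero_add, sub_zero, sub_self]

include hQ in
theorem polar_h_inE (e : E) : QuadraticMap.polar Q F.h (inE l e) = 0 := by
  have h : F.h + inE l e = ((0, F.h₀), e) :=
    Prod.ext (Prod.ext (add_zero _) (add_zero _)) (zero_add _)
  rw [QuadraticMap.polar, h, F.Q_h hQ, Q_inE hQ, hQ, LinearMap.map_zero,
    zero_add, sub_zero, sub_self]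

include hQ in
theorem br_v_v : F.br Q (inE l F.v) (inE l F.v) = 1 := by
  rw [br_self, Q_inE hQ, F.ev_v, RingHom.map_one]

include hQ in
/-- Every product of two vectors factors through `v`. -/
theorem br_mul_br (u w : (N × H) × E) :
    F.br Q u (inE l F.v) * F.br Q (inE l F.v) w = F.br Q u w := by
  have h := C0.ι_contract Q ev u (inE l F.v) w F.f₀ F.f₀
  rwa [Q_inE hQ, F.ev_v, one_smul] at h

include hQ in
theorem br_n_n : F.br Q F.n F.n = 0 := by
  rw [br_self, F.Q_n hQ, LinearMap.map_zero, RingHom.map_zero]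

include hQ in
theorem br_h_h : F.br Q F.h F.h = 0 := by
  rw [br_self, F.Q_h hQ, LinearMap.map_zero, RingHom.map_zero]

include hQ in
theorem br_n_h_add : F.br Q F.n F.h + F.br Q F.h F.n = 1 := by
  have h : F.n + F.h = ((F.n₀, F.h₀), 0) :=
    Prod.ext (Prod.ext (add_zero _) (zero_add _)) (zero_add _)
  have h' := C0.ι_add_swap Q ev F.n F.h F.f₀
  rwa [QuadraticMap.polar, h, F.Q_n hQ, F.Q_h hQ, sub_zero, sub_zero, hQ, QuadraticMap.map_zero,
    add_zero, F.ev_app, RingHom.map_one] at h'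

include hQ in
theorem br_n_v_mul_n_h : F.br Q F.n (inE l F.v) * F.br Q F.n F.h = 0 := by
  rw [F.br_mul_swap _ _ (polar_comm (F.polar_n_inE hQ _)), F.br_n_n hQ, zero_mul, neg_zero]

include hQ in
theorem br_n_v_mul_h_v :
    F.br Q F.n (inE l F.v) * F.br Q F.h (inE l F.v) = -F.br Q F.n F.h := by
  rw [F.br_mul_swap _ _ (polar_comm (F.polar_h_inE hQ _)), F.br_v_v hQ, mul_one]

include hQ in
theorem br_h_v_mul_h_v : F.br Q F.h (inE l F.v) * F.br Q F.h (inE l F.v) = 0 := by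
  rw [F.br_mul_swap _ _ (polar_comm (F.polar_h_inE hQ _)), F.br_h_h hQ, zero_mul, neg_zero]

include hQ in
theorem br_h_v_mul_n_h :
    F.br Q F.h (inE l F.v) * F.br Q F.n F.h = F.br Q F.h (inE l F.v) := by
  have h : F.br Q F.h (inE l F.v) * F.br Q F.h F.n = 0 := by
    rw [F.br_mul_swap _ _ (polar_comm (F.polar_h_inE hQ _)), F.br_h_h hQ, zero_mul, neg_zero]
  have h' := congrArg (F.br Q F.h (inE l F.v) * ·) (F.br_n_h_add hQ)
  simp only [mul_add, mul_one, h, add_zero] at h'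
  exact h'

include hQ in
theorem br_inE_mul_n_h (e e' : E) :
    F.br Q (inE l e) (inE l e') * F.br Q F.n F.h =
      F.br Q F.n F.h * F.br Q (inE l e) (inE l e') := by
  rw [F.br_mul_swap _ _ (polar_comm (F.polar_n_inE hQ _)), F.br_mul_swap _ _ (F.polar_h_inE hQ _),
    F.br_swap (polar_comm (F.polar_n_inE hQ e)), F.br_swap (F.polar_h_inE hQ e'), neg_mul,
    mul_neg]

include hQ in
theorem br_inE_mul_h_v (e : E) :
    F.br Q (inE l e) (inE l F.v) * F.br Q F.h (inE l F.v) =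
      F.br Q F.h (inE l F.v) * F.br Q (inE l F.v) (inE l e) := by
  rw [F.br_mul_swap _ _ (polar_comm (F.polar_h_inE hQ _)), F.br_v_v hQ, mul_one,
    F.br_mul_br hQ, F.br_swap (F.polar_h_inE hQ e)]

end Brackets

end Frame

end LinePairing

end Frames

/-! ### Bijectivity of the action -/

section Bijectivity

variable {R E L D N H P : Type*} [CommRing R] [AddCommGroup E] [Module R E]
  [AddCommGroup L] [Module R L] [AddCommGroup D] [Module R D]
  [AddCommGroup N] [Module R N] [AddCommGroup H] [Module R H]
  [AddCommGroup P] [Module R P]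
  {ev : D →ₗ[R] L →ₗ[R] R} (l : LinePairing ev N H P) {q : QuadraticMap R E L}
  {Q : QuadraticMap R ((N × H) × E) L} (hQ : ∀ n h e, Q ((n, h), e) = l.app h n + q e)

namespace LinePairing

/-- The map from the even Clifford algebra of `q` to that of `H_L(N) ⊥ (E, q)`. -/
def incl : C0 q ev →+* C0 Q ev :=
  C0.map (σ := RingHom.id R) (Frame.inE l) LinearMap.id
    (fun f x => congrArg (ev f) (Frame.Q_inE (l := l) hQ x))

theorem incl_algebraMap (r : R) : l.incl hQ (algebraMap R _ r) = algebraMap R _ r :=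
  C0.map_algebraMap _ _ _ r

theorem incl_ι (u w : E) (f : D) :
    l.incl hQ (C0.ι q ev (u ⊗ₜ w ⊗ₜ f)) = C0.ι Q ev (Frame.inE l u ⊗ₜ Frame.inE l w ⊗ₜ f) :=
  C0.map_ι _ _ _ _

theorem incl_mul (x y : C0 q ev) : l.incl hQ (x * y) = l.incl hQ x * l.incl hQ y :=
  (l.incl hQ).map_mul' x y

theorem incl_add (x y : C0 q ev) : l.incl hQ (x + y) = l.incl hQ x + l.incl hQ y :=
  (l.incl hQ).map_add' x y

theorem act_inE_inE (u w : E) (f : D) (x : C0 q ev) :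
    l.act (l.std q) (Frame.inE l u) (Frame.inE l w) f (x, 0) =
      (C0.ι q ev (u ⊗ₜ w ⊗ₜ f) * x, 0) := by
  rw [act_apply, LinearMap.map_zero, LinearMap.map_zero, act₁₁_apply, act₂₁_apply]
  refine Prod.ext ?_ ?_
  · change C0.ι q ev (u ⊗ₜ w ⊗ₜ f) * x + ev f (l.app 0 0) • x + 0 = C0.ι q ev (u ⊗ₜ w ⊗ₜ f) * x
    rw [LinearMap.map_zero, LinearMap.map_zero, zero_smul, add_zero, add_zero]
  · change C1.mulLeft q ev w x ⊗ₜ l.comp f 0 - C1.mulLeft q ev u x ⊗ₜ l.comp f 0 + 0 = 0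
    rw [LinearMap.map_zero, TensorProduct.tmul_zero, TensorProduct.tmul_zero, sub_zero, add_zero]

theorem rho_add_eq {X Y : Type*} [AddCommGroup X] [Module R X] [AddCommGroup Y] [Module R Y]
    (k : CliffordPair q ev X Y) {y z : C0 Q ev} {w : X × (Y ⊗[R] P)} {a b : X}
    (hy : l.rho k hQ y w = (a, 0)) (hz : l.rho k hQ z w = (b, 0)) :
    l.rho k hQ (y + z) w = (a + b, 0) := by
  rw [rho_add_apply, hy, hz]
  exact Prod.ext rfl (add_zero _)

/-- The even Clifford algebra of `q` acts on the first summand by left multiplication. -/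
theorem rho_incl (a x : C0 q ev) : l.rho (l.std q) hQ (l.incl hQ a) (x, 0) = (a * x, 0) := by
  induction a using C0.induction generalizing x with
  | h₀ r =>
    rw [incl_algebraMap, rho_algebraMap_apply, ← Algebra.smul_def]
    exact Prod.ext rfl (smul_zero _)
  | h₁ t =>
    induction t with
    | zero =>
      rw [LinearMap.map_zero, zero_mul, incl, RingHom.map_zero, rho_zero_apply]
      rfl
    | tmul s f =>
      induction s with
      | zero =>
        rw [TensorProduct.zero_tmul, LinearMap.map_zero, zero_mul, incl, RingHom.map_zero,
          rho_zero_apply]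
        rfl
      | tmul u w => rw [incl_ι, rho_ι, act_inE_inE]
      | add s r hs hr =>
        rw [TensorProduct.add_tmul, LinearMap.map_add, incl_add, add_mul]
        exact l.rho_add_eq hQ _ hs hr
    | add s r hs hr =>
      rw [LinearMap.map_add, incl_add, add_mul]
      exact l.rho_add_eq hQ _ hs hr
  | hm a b ha hb =>
    have h := congrArg (fun y => l.rho (l.std q) hQ y (x, 0)) (l.incl_mul hQ a b)
    have h' := congrArg (fun y => l.rho (l.std q) hQ (l.incl hQ a) y) (hb x)
    exact h.trans ((l.rho_mul_apply (l.std q) hQ _ _ (x, 0)).trans (h'.trans ((ha (b * x)).trans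
      (Prod.ext (mul_assoc a b x).symm rfl))))
  | ha a b ha hb =>
    have h := congrArg (fun y => l.rho (l.std q) hQ y (x, 0)) (l.incl_add hQ a b)
    exact h.trans ((l.rho_add_eq hQ _ (ha x) (hb x)).trans (Prod.ext (add_mul a b x).symm rfl))

namespace Frame

variable {l} (F : l.Frame q)

/-- The product of `n₀` and `h₀` acts as the projection to the first summand. -/
theorem rho_n_h (x : Bimod P q ev) : l.rho (l.std q) hQ (F.br Q F.n F.h) x = (x.1, 0) := by
  rw [br_apply, rho_ι, act_apply]
  have h (y : C1 q ev ⊗[R] P) : l.act₁₂ (l.std q) F.n F.h F.f₀ y = 0 := by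
    induction y with
    | zero => rw [LinearMap.map_zero]
    | tmul y φ =>
      rw [act₁₂_tmul]
      change l.evP φ 0 • _ - _ • (l.std q).B 0 F.f₀ y = 0
      rw [LinearMap.map_zero, LinearMap.map_zero, LinearMap.zero_apply, LinearMap.zero_apply,
        zero_smul, smul_zero, sub_zero]
    | add x y hx hy => rw [LinearMap.map_add, hx, hy, add_zero]
  have h' (y : C1 q ev ⊗[R] P) : l.act₂₂ (l.std q) F.n F.h F.f₀ y = 0 := by
    induction y with
    | zero => rw [LinearMap.map_zero]
    | tmul y φ =>
      rw [act₂₂_tmul]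
      change y ⊗ₜ (l.evP φ 0 • _) + (l.std q).A 0 ((l.std q).B 0 F.f₀ y) ⊗ₜ φ = 0
      rw [LinearMap.map_zero, zero_smul, LinearMap.map_zero, LinearMap.zero_apply,
        TensorProduct.tmul_zero, TensorProduct.zero_tmul, add_zero]
    | add x y hx hy => rw [LinearMap.map_add, hx, hy, add_zero]
  rw [h, h', act₁₁_apply, act₂₁_apply]
  refine Prod.ext ?_ ?_
  · change (l.std q).B 0 F.f₀ _ + ev F.f₀ (l.app F.h₀ F.n₀) • x.1 + 0 = x.1
    rw [F.ev_app, LinearMap.map_zero, LinearMap.zero_apply, LinearMap.zero_apply, one_smul,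
      zero_add, add_zero]
  · change (l.std q).A 0 x.1 ⊗ₜ _ - (l.std q).A 0 x.1 ⊗ₜ _ + 0 = (0 : C1 q ev ⊗[R] P)
    rw [LinearMap.map_zero, LinearMap.zero_apply, TensorProduct.zero_tmul, TensorProduct.zero_tmul,
      sub_zero, add_zero]

/-- The product of `h₀` and `v` maps the first basis vector to the second one. -/
theorem rho_h_v (x : C0 q ev) :
    l.rho (l.std q) hQ (F.br Q F.h (inE l F.v)) (x, 0) =
      (0, C1.mulLeft q ev F.v x ⊗ₜ F.φ₀) := by
  rw [br_apply, rho_ι, act_apply, LinearMap.map_zero, LinearMap.map_zero, act₁₁_apply, act₂₁_apply]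
  refine Prod.ext ?_ ?_
  · change (l.std q).B 0 F.f₀ _ + ev F.f₀ (l.app 0 0) • x + 0 = 0
    rw [LinearMap.map_zero, LinearMap.map_zero, LinearMap.map_zero, LinearMap.zero_apply,
      LinearMap.zero_apply, zero_smul, add_zero, add_zero]
  · change (l.std q).A F.v x ⊗ₜ F.φ₀ - (l.std q).A 0 x ⊗ₜ _ + 0 = (l.std q).A F.v x ⊗ₜ[R] F.φ₀
    rw [LinearMap.map_zero, LinearMap.zero_apply, TensorProduct.zero_tmul, sub_zero, add_zero]

/-- The product of `n₀` and `v` maps the second basis vector to the negative of the first one, and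
kills the first one. -/
theorem rho_n_v (x : Bimod P q ev) :
    l.rho (l.std q) hQ (F.br Q F.n (inE l F.v)) x = (-F.coord₂ x.2, 0) := by
  rw [br_apply, rho_ι, act_apply]
  have h (y : C1 q ev ⊗[R] P) :
      l.act₁₂ (l.std q) F.n (inE l F.v) F.f₀ y = -F.coord₂ y := by
    induction y with
    | zero => rw [LinearMap.map_zero, LinearMap.map_zero, neg_zero]
    | tmul y φ =>
      rw [act₁₂_tmul, coord₂_tmul]
      change l.evP φ 0 • _ - l.evP φ F.n₀ • (l.std q).B F.v F.f₀ y =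
        -(l.evP φ F.n₀ • (l.std q).B F.v F.f₀ y)
      rw [LinearMap.map_zero, zero_smul, zero_sub]
    | add x y hx hy => rw [LinearMap.map_add, hx, hy, LinearMap.map_add, neg_add]
  have h' (y : C1 q ev ⊗[R] P) : l.act₂₂ (l.std q) F.n (inE l F.v) F.f₀ y = 0 := by
    induction y with
    | zero => rw [LinearMap.map_zero]
    | tmul y φ =>
      rw [act₂₂_tmul]
      change y ⊗ₜ (l.evP φ 0 • _) + (l.std q).A 0 ((l.std q).B F.v F.f₀ y) ⊗ₜ φ = 0
      rw [LinearMap.map_zero, zero_smul, LinearMap.map_zero, LinearMap.zero_apply,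
        TensorProduct.tmul_zero, TensorProduct.zero_tmul, add_zero]
    | add x y hx hy => rw [LinearMap.map_add, hx, hy, add_zero]
  rw [h, h', act₁₁_apply, act₂₁_apply]
  refine Prod.ext ?_ ?_
  · change (l.std q).B 0 F.f₀ _ + ev F.f₀ (l.app 0 F.n₀) • x.1 + -_ = -_
    rw [LinearMap.map_zero, LinearMap.map_zero, LinearMap.zero_apply, LinearMap.zero_apply,
      LinearMap.zero_apply, LinearMap.map_zero, zero_smul, zero_add, zero_add]
  · change (l.std q).A F.v x.1 ⊗ₜ l.comp F.f₀ 0 - (l.std q).A 0 x.1 ⊗ₜ _ + 0 =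
      (0 : C1 q ev ⊗[R] P)
    rw [LinearMap.map_zero, LinearMap.map_zero, LinearMap.zero_apply, TensorProduct.zero_tmul,
      TensorProduct.tmul_zero, sub_zero, add_zero]

/-- The element of the even Clifford algebra of `H_L(N) ⊥ (E, q)` which maps `(1, 0)` to the element
with coordinates `a` and `b`. -/
def column (a b : C0 q ev) : C0 Q ev :=
  F.br Q F.n F.h * l.incl hQ a + F.br Q F.h (inE l F.v) * l.incl hQ b

theorem rho_column (a b x : C0 q ev) :
    l.rho (l.std q) hQ (F.column hQ a b) (x, 0) =
      (a * x, C1.mulLeft q ev F.v (b * x) ⊗ₜ F.φ₀) := by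
  rw [column, rho_add_apply, rho_mul_apply, rho_mul_apply, rho_incl, rho_incl, rho_n_h, rho_h_v]
  exact Prod.ext (add_zero _) (zero_add _)

/-- Every pair of elements of the Clifford module is the image of the basis. -/
theorem exists_rho_eq (x₀ x₁ : Bimod P q ev) : ∃ z : C0 Q ev,
    l.rho (l.std q) hQ z (1, 0) = x₀ ∧ l.rho (l.std q) hQ z F.p₁ = x₁ := by
  -- The products `n₀ h₀` and `-n₀ v` act as the matrix units in the first row, and a column maps
  -- `(1, 0)` to any prescribed element.
  refine ⟨F.column hQ x₀.1 (F.coord₂ x₀.2) * F.br Q F.n F.h +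
    F.column hQ (-x₁.1) (-F.coord₂ x₁.2) * F.br Q F.n (inE l F.v), ?_, ?_⟩
  · have h₁ := F.rho_n_h hQ ((1, 0) : Bimod P q ev)
    have h₂ : l.rho (l.std q) hQ (F.br Q F.n (inE l F.v)) ((1, 0) : Bimod P q ev) = 0 := by
      refine (F.rho_n_v hQ (1, 0)).trans ?_
      rw [LinearMap.map_zero, neg_zero]
      rfl
    have h₃ := F.rho_column hQ x₀.1 (F.coord₂ x₀.2) 1
    rw [mul_one, mul_one, mulLeft_coord₂] at h₃
    rw [rho_add_apply, rho_mul_apply, rho_mul_apply]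
    refine (congrArg₂ (· + ·) ((congrArg _ h₁).trans h₃)
      ((congrArg _ h₂).trans (LinearMap.map_zero _))).trans (add_zero x₀)
  · have h₁ : l.rho (l.std q) hQ (F.br Q F.n F.h) F.p₁ = 0 := F.rho_n_h hQ F.p₁
    have h₂ : l.rho (l.std q) hQ (F.br Q F.n (inE l F.v)) F.p₁ = (-1, 0) := by
      refine (F.rho_n_v hQ F.p₁).trans ?_
      rw [p₁, coord₂_mulLeft]
    have h₃ := F.rho_column hQ (-x₁.1) (-F.coord₂ x₁.2) (-1)
    rw [neg_mul_neg, neg_mul_neg, mul_one, mul_one, mulLeft_coord₂] at h₃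
    rw [rho_add_apply, rho_mul_apply, rho_mul_apply]
    refine (congrArg₂ (· + ·) ((congrArg _ h₁).trans (LinearMap.map_zero _))
      ((congrArg _ h₂).trans h₃)).trans (zero_add x₁)

theorem column_add (a b a' b' : C0 q ev) :
    F.column hQ a b + F.column hQ a' b' = F.column hQ (a + a') (b + b') := by
  rw [column, column, column, incl_add, incl_add, mul_add, mul_add]
  exact add_add_add_comm _ _ _ _

/-- An element whose products with columns are columns. -/
def MapsColumns (z : C0 Q ev) : Prop :=
  ∀ a b, ∃ a' b', z * F.column hQ a b = F.column hQ a' b'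

section

variable {F} {hQ}

theorem MapsColumns.add {y z : C0 Q ev} (hy : F.MapsColumns hQ y) (hz : F.MapsColumns hQ z) :
    F.MapsColumns hQ (y + z) := fun a b => by
  obtain ⟨a', b', h⟩ := hy a b
  obtain ⟨a'', b'', h'⟩ := hz a b
  exact ⟨_, _, by rw [add_mul, h, h', column_add]⟩

theorem MapsColumns.mul {y z : C0 Q ev} (hy : F.MapsColumns hQ y) (hz : F.MapsColumns hQ z) :
    F.MapsColumns hQ (y * z) := fun a b => by
  obtain ⟨a', b', h⟩ := hz a b
  obtain ⟨a'', b'', h'⟩ := hy a' b'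
  exact ⟨_, _, by rw [mul_assoc, h, h']⟩

theorem MapsColumns.of_algebraMap (r : R) : F.MapsColumns hQ (algebraMap R _ r) := fun a b =>
  ⟨algebraMap R _ r * a, algebraMap R _ r * b, by
    rw [column, mul_add, column, incl_mul, incl_mul, incl_algebraMap, ← mul_assoc, ← mul_assoc,
      ← mul_assoc, ← mul_assoc, Algebra.commutes, Algebra.commutes r (F.br Q F.h _)]⟩

theorem MapsColumns.smul (r : R) {z : C0 Q ev} (hz : F.MapsColumns hQ z) :
    F.MapsColumns hQ (r • z) := by
  rw [Algebra.smul_def]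
  exact (MapsColumns.of_algebraMap r).mul hz

theorem MapsColumns.neg {z : C0 Q ev} (hz : F.MapsColumns hQ z) : F.MapsColumns hQ (-z) := by
  rw [← neg_one_smul R]
  exact hz.smul _

end

theorem column_zero_left (b : C0 q ev) :
    F.column hQ 0 b = F.br Q F.h (inE l F.v) * l.incl hQ b := by
  rw [column, incl, RingHom.map_zero, mul_zero, zero_add]

theorem column_zero_right (a : C0 q ev) : F.column hQ a 0 = F.br Q F.n F.h * l.incl hQ a := by
  rw [column, incl, RingHom.map_zero, mul_zero, add_zero]

theorem incl_neg (a : C0 q ev) : l.incl hQ (-a) = -l.incl hQ a := RingHom.map_neg _ _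

theorem mapsColumns_n_v : F.MapsColumns hQ (F.br Q F.n (inE l F.v)) := fun a b => by
  refine ⟨-b, 0, ?_⟩
  rw [column_zero_right, column, mul_add, ← mul_assoc, ← mul_assoc, F.br_n_v_mul_n_h hQ,
    F.br_n_v_mul_h_v hQ, zero_mul, zero_add, incl_neg, neg_mul, mul_neg]

theorem mapsColumns_h_v : F.MapsColumns hQ (F.br Q F.h (inE l F.v)) := fun a b => by
  refine ⟨0, a, ?_⟩
  rw [column_zero_left, column, mul_add, ← mul_assoc, ← mul_assoc, F.br_h_v_mul_n_h hQ,
    F.br_h_v_mul_h_v hQ, zero_mul, add_zero]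

theorem mapsColumns_inE_v (e : E) : F.MapsColumns hQ (F.br Q (inE l e) (inE l F.v)) := fun a b => by
  refine ⟨C0.ι q ev (e ⊗ₜ F.v ⊗ₜ F.f₀) * a, C0.ι q ev (F.v ⊗ₜ e ⊗ₜ F.f₀) * b, ?_⟩
  rw [column, column, mul_add, ← mul_assoc, ← mul_assoc, F.br_inE_mul_n_h hQ,
    F.br_inE_mul_h_v hQ, incl_mul, incl_mul, incl_ι, incl_ι, mul_assoc, mul_assoc]
  rfl

theorem mapsColumns_v (u : (N × H) × E) : F.MapsColumns hQ (F.br Q u (inE l F.v)) := by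
  rw [F.eq_sum u, LinearMap.map_add, LinearMap.map_add, LinearMap.map_smul, LinearMap.map_smul,
    LinearMap.add_apply, LinearMap.add_apply, LinearMap.smul_apply, LinearMap.smul_apply]
  exact (((F.mapsColumns_n_v hQ).smul _).add ((F.mapsColumns_h_v hQ).smul _)).add
    (F.mapsColumns_inE_v hQ _)

theorem mapsColumns_ι (u w : (N × H) × E) (f : D) :
    F.MapsColumns hQ (C0.ι Q ev (u ⊗ₜ w ⊗ₜ f)) := by
  rw [F.eq_smul_f f, TensorProduct.tmul_smul, LinearMap.map_smul, ← br_apply, ← F.br_mul_br hQ]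
  refine ((F.mapsColumns_v hQ u).mul ?_).smul _
  have h := C0.ι_add_swap Q ev (inE l F.v) w F.f₀
  rw [← br_apply, ← br_apply, ← eq_sub_iff_add_eq, sub_eq_add_neg] at h
  rw [h]
  exact (MapsColumns.of_algebraMap _).add (F.mapsColumns_v hQ w).neg

/-- The columns form a left ideal, the one generated by the product of `n₀` and `h₀`. -/
theorem mapsColumns (z : C0 Q ev) : F.MapsColumns hQ z := by
  have h₀ : F.MapsColumns hQ 0 := by
    rw [← RingHom.map_zero (algebraMap R (C0 Q ev))]
    exact MapsColumns.of_algebraMap 0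
  induction z using C0.induction with
  | h₀ r => exact MapsColumns.of_algebraMap r
  | h₁ t =>
    induction t with
    | zero => rwa [LinearMap.map_zero]
    | tmul s f =>
      induction s with
      | zero => rwa [TensorProduct.zero_tmul, LinearMap.map_zero]
      | tmul u w => exact F.mapsColumns_ι hQ u w f
      | add s r hs hr =>
        rw [TensorProduct.add_tmul, LinearMap.map_add]
        exact hs.add hr
    | add s r hs hr =>
      rw [LinearMap.map_add]
      exact hs.add hr
  | hm a b ha hb => exact ha.mul hb
  | ha a b ha hb => exact ha.add hb

/-- An element which kills `(1, 0)` kills the first column. -/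
theorem mul_n_h_eq_zero (z : C0 Q ev) (h : l.rho (l.std q) hQ z (1, 0) = 0) :
    z * F.br Q F.n F.h = 0 := by
  obtain ⟨a, b, hz⟩ := F.mapsColumns hQ z 1 0
  rw [column_zero_right, incl, RingHom.map_one, mul_one] at hz
  have h' := F.rho_column hQ a b 1
  rw [← hz, rho_mul_apply, rho_n_h, h, mul_one, mul_one] at h'
  have ha : a = 0 := (congrArg Prod.fst h').symm
  have hb : b = 0 := by
    have h'' : C1.mulLeft q ev F.v b ⊗ₜ F.φ₀ = (0 : C1 q ev ⊗[R] P) :=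
      (congrArg Prod.snd h').symm
    rw [← F.coord₂_mulLeft b, h'', LinearMap.map_zero]
  rw [hz, ha, hb, column_zero_left, incl, RingHom.map_zero, mul_zero]

/-- The action on the Clifford module is faithful: with `e` the product of `n₀` and `h₀`, the unit is
`e + (h₀ v) (v n₀)`, and both `z e` and `z (h₀ v)` are columns, which are determined by the images
of `(1, 0)` and `p₁`. -/
theorem eq_zero_of_rho (z : C0 Q ev) (h₀ : l.rho (l.std q) hQ z (1, 0) = 0)
    (h₁ : l.rho (l.std q) hQ z F.p₁ = 0) : z = 0 := by
  have h : z * F.br Q F.h (inE l F.v) = 0 := by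
    rw [← F.br_h_v_mul_n_h hQ, ← mul_assoc]
    refine F.mul_n_h_eq_zero hQ _ ?_
    rw [rho_mul_apply, rho_h_v]
    exact h₁
  rw [← mul_one z, ← F.br_n_h_add hQ, mul_add, F.mul_n_h_eq_zero hQ z h₀, ← F.br_mul_br hQ F.h,
    ← mul_assoc, h, zero_mul, add_zero]

end Frame

end LinePairing

end Bijectivity

/-! ### Isometries and base change -/

section BaseChange

variable {R E L D N H P E₁ : Type*} [CommRing R] [AddCommGroup E] [Module R E]
  [AddCommGroup L] [Module R L] [AddCommGroup D] [Module R D]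
  [AddCommGroup N] [Module R N] [AddCommGroup H] [Module R H]
  [AddCommGroup P] [Module R P] [AddCommGroup E₁] [Module R E₁]
  {ev : D →ₗ[R] L →ₗ[R] R} (l : LinePairing ev N H P) {q : QuadraticMap R E L}
  {Q₁ : QuadraticMap R E₁ L}

theorem C0.map_eq_self_of_inverse {E' : Type*} [AddCommGroup E'] [Module R E']
    {ev : D →ₗ[R] L →ₗ[R] R} {q : QuadraticMap R E L} {q' : QuadraticMap R E' L}
    (a : E →ₗ[R] E') (a' : E' →ₗ[R] E)
    (h : ∀ (f : D) x, ev f (q' (a x)) = RingHom.id R (ev f (q x)))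
    (h' : ∀ (f : D) x, ev f (q (a' x)) = RingHom.id R (ev f (q' x))) (ha : ∀ x, a' (a x) = x)
    (z : C0 q ev) : C0.map a' LinearMap.id h' (C0.map a LinearMap.id h z) = z := by
  rw [← C0.map_comp' a LinearMap.id h a' LinearMap.id h' (LinearMap.id (R := R)) LinearMap.id
    (fun _ _ => rfl) (fun _ => rfl) (fun x => (ha x).symm) (fun _ => rfl)]
  exact C0.map_id' _ _ _ (fun _ => rfl) (fun _ => rfl) (fun _ => rfl) z

namespace LinePairing

variable (q) in
/-- The quadratic form `H_L(N) ⊥ (E, q)`. -/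
def form : QuadraticMap R ((N × H) × E) L :=
  (LinearMap.BilinMap.toQuadraticMap
    (l.app.flip.compl₁₂ (LinearMap.fst R N H) (LinearMap.snd R N H))).prod q

theorem form_apply (n : N) (h : H) (e : E) : l.form q ((n, h), e) = l.app h n + q e := rfl

section

variable (t : E₁ →ₗ[R] (N × H) × E) (ht : ∀ x, l.form q (t x) = Q₁ x)

/-- The action of the even Clifford algebra of a form isometric to `H_L(N) ⊥ (E, q)`. -/
def isoAct : C0 Q₁ ev →+* Module.End R (Bimod P q ev) :=
  ((l.rho (l.std q) (l.form_apply (q := q))).toRingHom).comp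
    (C0.map (σ := RingHom.id R) t LinearMap.id fun f x => congrArg (ev f) (ht x))

theorem isoAct_apply (z : C0 Q₁ ev) : l.isoAct t ht z =
    l.rho (l.std q) (l.form_apply (q := q))
      (C0.map (σ := RingHom.id R) t LinearMap.id (fun f x => congrArg (ev f) (ht x)) z) := rfl

theorem isoAct_op_smul (z : C0 Q₁ ev) (c : C0 q ev) (x : Bimod P q ev) :
    l.isoAct t ht z (MulOpposite.op c • x) = MulOpposite.op c • l.isoAct t ht z x :=
  l.rho_op_smul _ _ c x

theorem isoAct_algebraMap (r : R) (x : Bimod P q ev) :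
    l.isoAct t ht (algebraMap R _ r) x = r • x := by
  rw [isoAct_apply, C0.map_algebraMap]
  exact l.rho_algebraMap_apply _ _ r x

variable (t' : (N × H) × E →ₗ[R] E₁) (htt' : ∀ x, t (t' x) = x) (ht't : ∀ x, t' (t x) = x)

include htt' in
theorem exists_isoAct_eq (F : l.Frame q) (x₀ x₁ : Bimod P q ev) : ∃ z : C0 Q₁ ev,
    l.isoAct t ht z (1, 0) = x₀ ∧ l.isoAct t ht z F.p₁ = x₁ := by
  obtain ⟨z, h₀, h₁⟩ := F.exists_rho_eq (l.form_apply (q := q)) x₀ x₁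
  have h' (f : D) (x) : ev f (Q₁ (t' x)) = RingHom.id R (ev f (l.form q x)) :=
    congrArg (ev f) (by rw [← ht, htt'])
  have h := C0.map_eq_self_of_inverse (q := l.form q) (q' := Q₁) t' t
    h' (fun f x => congrArg (ev f) (ht x)) htt' z
  refine ⟨C0.map t' LinearMap.id h' z, ?_, ?_⟩
  · rw [isoAct_apply, h]
    exact h₀
  · rw [isoAct_apply, h]
    exact h₁

include ht't htt' in
theorem eq_zero_of_isoAct (F : l.Frame q) (z : C0 Q₁ ev) (h₀ : l.isoAct t ht z (1, 0) = 0)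
    (h₁ : l.isoAct t ht z F.p₁ = 0) : z = 0 := by
  rw [← C0.map_eq_self_of_inverse (q := Q₁) (q' := l.form q) t t'
    (fun f x => congrArg (ev f) (ht x)) (fun f x => congrArg (ev f) (by rw [← ht, htt'])) ht't z,
    F.eq_zero_of_rho _ _ h₀ h₁, RingHom.map_zero]

end

variable {R' E' L' D' N' H' P' E₁' : Type*} [CommRing R'] [AddCommGroup E'] [Module R' E']
  [AddCommGroup L'] [Module R' L'] [AddCommGroup D'] [Module R' D']
  [AddCommGroup N'] [Module R' N'] [AddCommGroup H'] [Module R' H']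
  [AddCommGroup P'] [Module R' P'] [AddCommGroup E₁'] [Module R' E₁']
  {ev' : D' →ₗ[R'] L' →ₗ[R'] R'} (l' : LinePairing ev' N' H' P') {q' : QuadraticMap R' E' L'}
  {Q₁' : QuadraticMap R' E₁' L'}
  (t : E₁ →ₗ[R] (N × H) × E) (ht : ∀ x, l.form q (t x) = Q₁ x)
  (t' : E₁' →ₗ[R'] (N' × H') × E') (ht' : ∀ x, l'.form q' (t' x) = Q₁' x)
  {σ : R →+* R'} (a : E →ₛₗ[σ] E') (d : D →ₛₗ[σ] D') (p : P →ₛₗ[σ] P') (b : N →ₛₗ[σ] N')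
  (c : H →ₛₗ[σ] H') (a₁ : E₁ →ₛₗ[σ] E₁')
  (hp : ∀ φ n, l'.evP (p φ) (b n) = σ (l.evP φ n))
  (hc : ∀ f g, l'.comp (d f) (c g) = p (l.comp f g))
  (hd : ∀ f x, ev' (d f) (q' (a x)) = σ (ev f (q x)))
  (hd₁ : ∀ f x, ev' (d f) (Q₁' (a₁ x)) = σ (ev f (Q₁ x)))
  (htt : ∀ x, t' (a₁ x) = ((b (t x).1.1, c (t x).1.2), a (t x).2))

include hp hc hd in
theorem ev_form (f : D) (x : (N × H) × E) :
    ev' (d f) (l'.form q' ((b x.1.1, c x.1.2), a x.2)) = σ (ev f (l.form q x)) := by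
  rw [form_apply, LinearMap.map_add, ← l'.evP_comp, hc, hp, hd, l.evP_comp, ← RingHom.map_add,
    ← LinearMap.map_add]
  rfl

include hp hc htt in
/-- The action of the even Clifford algebra is compatible with base change. -/
theorem map_isoAct (z : C0 Q₁ ev) (x : Bimod P q ev) :
    Bimod.map a d hd p (l.isoAct t ht z x) =
      l'.isoAct t' ht' (C0.map a₁ d hd₁ z) (Bimod.map a d hd p x) := by
  let T : ((N × H) × E) →ₛₗ[σ] ((N' × H') × E') :=
    { toFun := fun x => ((b x.1.1, c x.1.2), a x.2)
      map_add' := fun x y => by simp only [Prod.fst_add, Prod.snd_add, LinearMap.map_add,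
        Prod.mk_add_mk]
      map_smul' := fun r x => by simp only [Prod.smul_fst, Prod.smul_snd, LinearMap.map_smulₛₗ,
        Prod.smul_mk] }
  have hB (e : E) (f : D) (y : C1 q ev) : C0.mapₛₗ a d hd ((l.std q).B e f y) =
      (l'.std q').B (a e) (d f) (C1.mapₛₗ a d hd y) := by
    induction y using C1.induction with
    | h₀ => rw [LinearMap.map_zero, LinearMap.map_zero, LinearMap.map_zero, LinearMap.map_zero]
    | h₁ w x =>
      change C0.map a d hd (C0.ι q ev (e ⊗ₜ w ⊗ₜ f) * x) =
        C0.ι q' ev' (a e ⊗ₜ a w ⊗ₜ d f) * C0.map a d hd x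
      rw [RingHom.map_mul, C0.map_ι]
      rfl
    | ha x y hx hy =>
      rw [LinearMap.map_add, LinearMap.map_add, LinearMap.map_add, LinearMap.map_add, hx, hy]
  have hT (f : D) (x) : ev' (d f) (l'.form q' (T x)) = σ (ev f (l.form q x)) :=
    l.ev_form l' a d p b c hp hc hd f x
  have h := l.map_rho (l.std q) (l.form_apply (q := q)) l' (l'.std q') (l'.form_apply (q := q'))
    a d p b c hp hc T (fun _ => rfl) hT (C0.mapₛₗ a d hd) (C1.mapₛₗ a d hd) (fun _ _ => rfl) hB
    (C0.map (σ := RingHom.id R) t LinearMap.id (fun f x => congrArg (ev f) (ht x)) z) x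
  rw [← C0.map_comp' t LinearMap.id _ T d hT (T.comp t) d (fun f x => by
      rw [← ht]; exact hT f (t x))
    (fun _ => rfl) (fun _ => rfl) (fun _ => rfl)] at h
  refine h.trans ?_
  rw [isoAct_apply]
  rw [← C0.map_comp' a₁ d hd₁ t' LinearMap.id _ (T.comp t) d _
    (fun _ => rfl) (fun x => (htt x).symm) (fun _ => rfl)]
  rfl

variable {l l'} in
include hp hd in
/-- The second coordinate is compatible with base change. -/
theorem Frame.map_coord₂ (F : l.Frame q) (F' : l'.Frame q') (hf : F'.f₀ = d F.f₀)
    (hn : F'.n₀ = b F.n₀) (hv : F'.v = a F.v) (y : C1 q ev ⊗[R] P) :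
    F'.coord₂ (TensorProduct.map (C1.mapₛₗ a d hd) p y) = C0.map a d hd (F.coord₂ y) := by
  induction y with
  | zero => rw [LinearMap.map_zero, LinearMap.map_zero, LinearMap.map_zero, RingHom.map_zero]
  | tmul y φ =>
    induction y using C1.induction with
    | h₀ => rw [TensorProduct.zero_tmul, LinearMap.map_zero, LinearMap.map_zero,
        LinearMap.map_zero, RingHom.map_zero]
    | h₁ w x =>
      rw [TensorProduct.map_tmul, coord₂_tmul, coord₂_tmul, hn, hp, hf, hv]
      change σ _ • (C0.ι q' ev' (a F.v ⊗ₜ a w ⊗ₜ d F.f₀) * C0.map a d hd x) =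
        C0.mapₛₗ a d hd (l.evP φ F.n₀ • (C0.ι q ev (F.v ⊗ₜ w ⊗ₜ F.f₀) * x))
      rw [LinearMap.map_smulₛₗ]
      change _ = σ _ • C0.map a d hd _
      rw [RingHom.map_mul, C0.map_ι]
      rfl
    | ha x y hx hy => rw [TensorProduct.add_tmul, LinearMap.map_add, LinearMap.map_add,
        LinearMap.map_add, RingHom.map_add, hx, hy]
  | add x y hx hy =>
    rw [LinearMap.map_add, LinearMap.map_add, LinearMap.map_add, RingHom.map_add, hx, hy]

end LinePairing

end BaseChange

/-! ### Sections over an open subset -/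

section Sections

open CategoryTheory Opposite AlgebraicGeometry TopologicalSpace

variable {S : Scheme.{u}} {M N L : S.PresheafOfModules}

namespace QuadForm

/-- The evaluation pairing `Hom(N, L) × N ⟶ L` on sections over `U`. -/
def evHom (N L : S.PresheafOfModules) (U : (Opens S)ᵒᵖ) :
    homOn N L U →ₗ[S.presheaf.obj U] N.obj U →ₗ[S.presheaf.obj U] L.obj U where
  toFun f := f.1 U (𝟙 U)
  map_add' _ _ := rfl
  map_smul' r f := by rw [homOn.smul_val, S.presheaf.map_id]; rfl

/-- The composition pairing `Hom(L, 𝒪) × Hom(N, L) ⟶ Hom(N, 𝒪)` on sections over `U`. -/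
def compHom (N L : S.PresheafOfModules) (U : (Opens S)ᵒᵖ) :
    homOn L (struc S) U →ₗ[S.presheaf.obj U] homOn N L U →ₗ[S.presheaf.obj U]
      homOn N (struc S) U :=
  LinearMap.mk₂ _ (fun f g => ⟨fun V i => f.1 V i ∘ₗ g.1 V i, fun V W i j x =>
      (f.2 V W i j (g.1 V i x)).trans (congrArg (f.1 W (i ≫ j)) (g.2 V W i j x))⟩)
    (fun _ _ _ => rfl) (fun _ _ _ => rfl)
    (fun f _ _ => homOn.ext' fun V i => LinearMap.ext fun _ => (f.1 V i).map_add _ _)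
    (fun _ f _ => homOn.ext' fun V i => LinearMap.ext fun _ => (f.1 V i).map_smul _ _)

/-- The restriction to `V` of a linear form over `U`. -/
def evAt {U V : (Opens S)ᵒᵖ} (i : U ⟶ V) (f : homOn N (struc S) U) :
    N.obj V →ₗ[S.presheaf.obj V] S.presheaf.obj V := f.1 V i

/-- Generators of `N`, `L` and their duals over `U`, that of `L` being a value of the form `q`.
They are required to generate the sections over all smaller open subsets as well. -/
@[ext]
structure LocalFrame (q : QuadForm M L) (N : S.PresheafOfModules) (U : (Opens S)ᵒᵖ) where
  f₀ : homOn L (struc S) U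
  n₀ : N.obj U
  h₀ : homOn N L U
  v : M.obj U
  ev_v : ev L U f₀ (q.app U v) = 1
  ev_app : ev L U f₀ (evHom N L U h₀ n₀) = 1
  eq_smul_n (V : (Opens S)ᵒᵖ) (i : U ⟶ V) (n : N.obj V) :
    n = evAt i f₀ (h₀.1 V i n) • res N i n₀
  eq_smul_l (V : (Opens S)ᵒᵖ) (i : U ⟶ V) (a : L.obj V) :
    a = evAt i f₀ a • res L i (q.app U v)

variable (q : QuadForm M L)

theorem ev_homOn_res {U V : (Opens S)ᵒᵖ} (i : U ⟶ V) (f : homOn L (struc S) U) (x : L.obj U) :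
    ev L V (homOn.res L (struc S) i f) (res L i x) = (S.presheaf.map i).hom (ev L U f x) :=
  (f.2 U V (𝟙 U) i x).symm

theorem evHom_res {U V : (Opens S)ᵒᵖ} (i : U ⟶ V) (g : homOn N L U) (n : N.obj U) :
    evHom N L V (homOn.res N L i g) (res N i n) = res L i (evHom N L U g n) :=
  (g.2 U V (𝟙 U) i n).symm

theorem ext_ev {U : (Opens S)ᵒᵖ} {f g : homOn N (struc S) U} (h : ∀ (V : (Opens S)ᵒᵖ) (i : U ⟶ V)
    (x : N.obj V), ev N V (homOn.res N (struc S) i f) x = ev N V (homOn.res N (struc S) i g) x) :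
    f = g := homOn.ext' fun V i => LinearMap.ext fun x => h V i x

theorem ev_res_smul {U V : (Opens S)ᵒᵖ} (i : U ⟶ V) (r : S.presheaf.obj U)
    (f : homOn N (struc S) U) (x : N.obj V) : ev N V (homOn.res N (struc S) i (r • f)) x =
      (S.presheaf.map i).hom r * ev N V (homOn.res N (struc S) i f) x := by
  rw [LinearMap.map_smulₛₗ, LinearMap.map_smul, LinearMap.smul_apply, smul_eq_mul]

theorem mul_mul_mul_swap {A : Type*} [CommRing A] (a b c d : A) :
    a * b * (c * d) = a * d * (c * b) := by ring

namespace LocalFrame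

variable {q} {U : (Opens S)ᵒᵖ} (F : q.LocalFrame N U)

/-- The restriction of local generators. -/
def restrict {V : (Opens S)ᵒᵖ} (i : U ⟶ V) : q.LocalFrame N V where
  f₀ := homOn.res L (struc S) i F.f₀
  n₀ := EvenClifford.res N i F.n₀
  h₀ := homOn.res N L i F.h₀
  v := EvenClifford.res M i F.v
  ev_v := by rw [q.ev_res, F.ev_v, map_one]
  ev_app := by rw [evHom_res, ev_homOn_res, F.ev_app, map_one]
  eq_smul_n W j n := by
    have h := F.eq_smul_n W (i ≫ j) n
    rw [← res_res N i j (i ≫ j)] at h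
    exact h
  eq_smul_l W j a := by
    have h := F.eq_smul_l W (i ≫ j) a
    rw [← res_res L i j (i ≫ j), ← q.naturality] at h
    exact h

include F in
theorem ev_eq_mul {V : (Opens S)ᵒᵖ} (i : U ⟶ V) (f : homOn L (struc S) V) (a : L.obj V) :
    ev L V f a = evAt i F.f₀ a * ev L V f (res L i (q.app U F.v)) := by
  have h := congrArg (ev L V f) (F.eq_smul_l V i a)
  rw [LinearMap.map_smul] at h
  exact h

include F in
theorem evP_eq_mul {V : (Opens S)ᵒᵖ} (i : U ⟶ V) (f : homOn N (struc S) V) (n : N.obj V) :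
    ev N V f n = evAt i F.f₀ (F.h₀.1 V i n) * ev N V f (res N i F.n₀) := by
  have h := congrArg (ev N V f) (F.eq_smul_n V i n)
  rw [LinearMap.map_smul] at h
  exact h

include F in
theorem ev_swap (f g : homOn L (struc S) U) (a : L.obj U) : ev L U f a • g = ev L U g a • f := by
  refine ext_ev fun V i b => ?_
  have h (f : homOn L (struc S) U) := (ev_homOn_res i f a).symm.trans (F.ev_eq_mul i _ _)
  refine (ev_res_smul i _ g b).trans (Eq.trans ?_ (ev_res_smul i _ f b).symm)
  refine (congrArg₂ (· * ·) (h f) (F.ev_eq_mul i _ b)).trans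
    (Eq.trans ?_ (congrArg₂ (· * ·) (h g) (F.ev_eq_mul i _ b)).symm)
  exact mul_mul_mul_swap _ _ _ _

include F in
theorem evP_swap (f g : homOn N (struc S) U) (a : N.obj U) : ev N U f a • g = ev N U g a • f := by
  refine ext_ev fun V i b => ?_
  have h (f : homOn N (struc S) U) := (ev_homOn_res i f a).symm.trans (F.evP_eq_mul i _ _)
  refine (ev_res_smul i _ g b).trans (Eq.trans ?_ (ev_res_smul i _ f b).symm)
  refine (congrArg₂ (· * ·) (h f) (F.evP_eq_mul i _ b)).trans
    (Eq.trans ?_ (congrArg₂ (· * ·) (h g) (F.evP_eq_mul i _ b)).symm)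
  exact mul_mul_mul_swap _ _ _ _

end LocalFrame

/-- The open subsets over which local generators exist. -/
def IsFramed (N : S.PresheafOfModules) (U : (Opens S)ᵒᵖ) : Prop := Nonempty (q.LocalFrame N U)

variable {q}

theorem LocalFrame.restrict_restrict {U V W : (Opens S)ᵒᵖ} (F : q.LocalFrame N U) (i : U ⟶ V)
    (j : V ⟶ W) : (F.restrict i).restrict j = F.restrict (i ≫ j) :=
  LocalFrame.ext rfl (res_res N i j _ F.n₀) rfl (res_res M i j _ F.v)

theorem IsFramed.restrict {U V : (Opens S)ᵒᵖ} (hU : q.IsFramed N U) (i : U ⟶ V) :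
    q.IsFramed N V := hU.map fun F => F.restrict i

/-- The pairings between the sections over `U` of the line bundles `L`, `N` and their duals. -/
def linePairing {U : (Opens S)ᵒᵖ} (hU : q.IsFramed N U) :
    LinePairing (ev L U) (N.obj U) (homOn N L U) (homOn N (struc S) U) where
  app := evHom N L U
  evP := ev N U
  comp := compHom N L U
  evP_comp _ _ _ := rfl
  ev_swap := hU.some.ev_swap
  evP_swap := hU.some.evP_swap
  exists_ev := ⟨_, _, hU.some.ev_v⟩

theorem LocalFrame.evHom_eq_smul {U : (Opens S)ᵒᵖ} (F : q.LocalFrame N U) (h : homOn N L U) :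
    h = ev L U F.f₀ (evHom N L U h F.n₀) • F.h₀ := by
  refine homOn.ext' fun V i => LinearMap.ext fun b => ?_
  have e (h : homOn N L U) : (S.presheaf.map i).hom (ev L U F.f₀ (evHom N L U h F.n₀)) =
      evAt i F.f₀ (h.1 V i (res N i F.n₀)) :=
    (F.f₀.2 U V (𝟙 U) i _).trans (congrArg (F.f₀.1 V i) (h.2 U V (𝟙 U) i F.n₀))
  have hb := congrArg (h.1 V i) (F.eq_smul_n V i b)
  rw [LinearMap.map_smul, F.eq_smul_l V i (h.1 V i (res N i F.n₀))] at hb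
  have hb' := congrArg (evAt i F.f₀ (h.1 V i (res N i F.n₀)) • ·)
    (F.eq_smul_l V i (F.h₀.1 V i b))
  rw [homOn.smul_val, e]
  refine hb.trans ((smul_comm _ _ _).trans hb'.symm)

/-- The frame of sections over `U` given by local generators. -/
def LocalFrame.toFrame {U : (Opens S)ᵒᵖ} (F : q.LocalFrame N U) (hU : q.IsFramed N U) :
    (linePairing hU).Frame (q.app U) where
  f₀ := F.f₀
  n₀ := F.n₀
  h₀ := F.h₀
  v := F.v
  ev_v := F.ev_v
  ev_app := F.ev_app
  eq_smul_n n := by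
    have h := F.eq_smul_n U (𝟙 U) n
    rw [EvenClifford.res_id] at h
    exact h
  eq_smul_h := F.evHom_eq_smul

/-- An isometry of a quadratic form with `H_L(N) ⊥ q`, as in the definition of `Isometric`. -/
structure HypIso {E : S.PresheafOfModules} (Q : QuadForm E L) (q : QuadForm M L)
    (N : S.PresheafOfModules) where
  iso : E ≅ prod (prod N (hom N L)) M
  app_eq (U : (Opens S)ᵒᵖ) (x : E.obj U) :
    ((hyperbolic N L).perp q).app U (iso.hom.app U x) = Q.app U x

variable {E : S.PresheafOfModules} {Q : QuadForm E L} (φ : HypIso Q q N)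

/-- A morphism of presheaves of modules on sections. -/
def sectionMap {A B : S.PresheafOfModules} (f : A ⟶ B) (U : (Opens S)ᵒᵖ) :
    A.obj U →ₗ[S.presheaf.obj U] B.obj U where
  toFun x := f.app U x
  map_add' x y := (f.app U).hom.map_add x y
  map_smul' r x := (f.app U).hom.map_smul r x

/-- The isometry on sections. -/
def HypIso.app (U : (Opens S)ᵒᵖ) :
    E.obj U →ₗ[S.presheaf.obj U] (N.obj U × homOn N L U) × M.obj U := sectionMap φ.iso.hom U

/-- The inverse of the isometry on sections. -/
def HypIso.inv (U : (Opens S)ᵒᵖ) :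
    (N.obj U × homOn N L U) × M.obj U →ₗ[S.presheaf.obj U] E.obj U := sectionMap φ.iso.inv U

theorem HypIso.app_inv (U : (Opens S)ᵒᵖ) (x : (N.obj U × homOn N L U) × M.obj U) :
    φ.app U (φ.inv U x) = x :=
  congrArg (fun f => sectionMap f U x) φ.iso.inv_hom_id

theorem HypIso.inv_app (U : (Opens S)ᵒᵖ) (x : E.obj U) : φ.inv U (φ.app U x) = x :=
  congrArg (fun f => sectionMap f U x) φ.iso.hom_inv_id

theorem HypIso.form_app {U : (Opens S)ᵒᵖ} (hU : q.IsFramed N U) (x : E.obj U) :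
    (linePairing hU).form (q.app U) (φ.app U x) = Q.app U x := φ.app_eq U x

theorem HypIso.app_res {U V : (Opens S)ᵒᵖ} (i : U ⟶ V) (x : E.obj U) :
    φ.app V (res E i x) = ((res N i (φ.app U x).1.1, homOn.res N L i (φ.app U x).1.2),
      res M i (φ.app U x).2) :=
  PresheafOfModules.naturality_apply φ.iso.hom i x

variable (q) in
/-- The ring of sections over `U` of the even Clifford algebra, acting on right modules. -/
abbrev opC0 (U : (Opens S)ᵒᵖ) : RingCat.{u} := (q.preC0 ⋙ opRing).obj U

/-- The action of the even Clifford algebra of `Q ≅ H_L(N) ⊥ q` on `C₀(q) ⊕ C₁(q) ⊗ N^∨`, on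
sections over `U`. -/
def HypIso.act {U : (Opens S)ᵒᵖ} (hU : q.IsFramed N U) :
    Q.preC0.obj U →+* Module.End (q.opC0 U) ((q.preP N).obj U) where
  toFun z :=
    { toFun := fun x => (linePairing hU).isoAct (φ.app U) (φ.form_app hU) z x
      map_add' := ((linePairing hU).isoAct (φ.app U) (φ.form_app hU) z).map_add'
      map_smul' := fun c x =>
        (linePairing hU).isoAct_op_smul (φ.app U) (φ.form_app hU) z (MulOpposite.unop c) x }
  map_one' := LinearMap.ext fun x => LinearMap.congr_fun
    (RingHom.map_one ((linePairing hU).isoAct (φ.app U) (φ.form_app hU))) x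
  map_mul' y z := LinearMap.ext fun x => LinearMap.congr_fun
    (RingHom.map_mul ((linePairing hU).isoAct (φ.app U) (φ.form_app hU)) y z) x
  map_zero' := LinearMap.ext fun x => LinearMap.congr_fun
    (RingHom.map_zero ((linePairing hU).isoAct (φ.app U) (φ.form_app hU))) x
  map_add' y z := LinearMap.ext fun x => LinearMap.congr_fun
    (RingHom.map_add ((linePairing hU).isoAct (φ.app U) (φ.form_app hU)) y z) x

theorem HypIso.act_unit {U : (Opens S)ᵒᵖ} (hU : q.IsFramed N U) (r : S.ringCatSheaf.obj.obj U)
    (x : (q.preP N).obj U) : φ.act hU (Q.preC0Unit.app U r) x =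
      (opRing.map (q.preC0Unit.app U) (MulOpposite.op r) : q.opC0 U) • x :=
  have h (y : q.Bimod N U) (r : S.presheaf.obj U) : algebraMap _ (q.C0 U)ᵐᵒᵖ r • y = r • y :=
    algebraMap_smul _ r y
  ((linePairing hU).isoAct_algebraMap (φ.app U) (φ.form_app hU) r x).trans (h x r).symm

theorem HypIso.act_res {U V : (Opens S)ᵒᵖ} (hU : q.IsFramed N U) (i : U ⟶ V) (z : Q.preC0.obj U)
    (x : (q.preP N).obj U) : (q.preP N).restrictₛₗ i (φ.act hU z x) =
      φ.act (hU.restrict i) (Q.preC0.map i z) ((q.preP N).restrictₛₗ i x) :=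
  (linePairing hU).map_isoAct (linePairing (hU.restrict i)) (φ.app U) (φ.form_app hU) (φ.app V)
    (φ.form_app _) (res M i) (homOn.res L (struc S) i) (homOn.res N (struc S) i) (res N i)
    (homOn.res N L i) (res E i) (fun f n => ev_homOn_res i f n) (fun _ _ => rfl) (q.ev_res i)
    (Q.ev_res i) (φ.app_res i) z x

section

variable (q N)

/-- The first basis vector of the Clifford module. -/
def p₀ (U : (Opens S)ᵒᵖ) : (q.preP N).obj U := ((1, 0) : q.Bimod N U)

theorem p₀_res {U V : (Opens S)ᵒᵖ} (i : U ⟶ V) :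
    (q.preP N).restrictₛₗ i (q.p₀ N U) = q.p₀ N V :=
  Prod.ext (RingHom.map_one (q.C0res i)) (LinearMap.map_zero _)

/-- The first coordinate on the Clifford module. -/
def coord₁ (U : (Opens S)ᵒᵖ) : (q.preP N).obj U →ₗ[q.opC0 U] q.opC0 U where
  toFun x := MulOpposite.op (show q.Bimod N U from x).1
  map_add' _ _ := rfl
  map_smul' _ _ := rfl

theorem coord₁_res {U V : (Opens S)ᵒᵖ} (i : U ⟶ V) (x : (q.preP N).obj U) :
    q.coord₁ N V ((q.preP N).restrictₛₗ i x) =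
      (q.preC0 ⋙ opRing).map i (q.coord₁ N U x) := rfl

end

namespace LocalFrame

variable {U : (Opens S)ᵒᵖ} (F : q.LocalFrame N U)

include F in
theorem isFramed : q.IsFramed N U := ⟨F⟩

/-- The second vector of the local basis of the Clifford module. -/
def p₁ : (q.preP N).obj U := (F.toFrame F.isFramed).p₁

theorem p₁_res {V : (Opens S)ᵒᵖ} (i : U ⟶ V) :
    (q.preP N).restrictₛₗ i F.p₁ = (F.restrict i).p₁ := by
  refine Prod.ext (RingHom.map_zero (q.C0res i)) ?_
  exact congrArg (fun c => C1.mulLeft (q.app V) (ev L V) (res M i F.v) c ⊗ₜ[S.presheaf.obj V]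
    ((F.restrict i).toFrame (F.restrict i).isFramed).φ₀) (RingHom.map_one (q.C0res i))

/-- The second coordinate on the Clifford module. -/
def coord₂ : (q.preP N).obj U →ₗ[q.opC0 U] q.opC0 U where
  toFun x := MulOpposite.op ((F.toFrame F.isFramed).coord₂ (show q.Bimod N U from x).2)
  map_add' x y := congrArg MulOpposite.op ((F.toFrame F.isFramed).coord₂.map_add
    (show q.Bimod N U from x).2 (show q.Bimod N U from y).2)
  map_smul' c x := congrArg MulOpposite.op
    ((F.toFrame F.isFramed).coord₂_op_smul (show q.Bimod N U from x).2 (MulOpposite.unop c))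

theorem coord₂_res {V : (Opens S)ᵒᵖ} (i : U ⟶ V) (x : (q.preP N).obj U) :
    (F.restrict i).coord₂ ((q.preP N).restrictₛₗ i x) =
      (q.preC0 ⋙ opRing).map i (F.coord₂ x) :=
  congrArg MulOpposite.op (LinePairing.Frame.map_coord₂ (l := linePairing F.isFramed)
    (l' := linePairing (F.restrict i).isFramed)
    (res M i) (homOn.res L (struc S) i) (homOn.res N (struc S) i)
    (res N i) (fun f n => ev_homOn_res i f n) (q.ev_res i)
    (F.toFrame F.isFramed) ((F.restrict i).toFrame (F.restrict i).isFramed) rfl rfl rfl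
    (show q.Bimod N U from x).2)

theorem coord₂_p₁ : F.coord₂ F.p₁ = 1 :=
  congrArg MulOpposite.op ((F.toFrame F.isFramed).coord₂_mulLeft 1)

theorem coord₂_p₀ : F.coord₂ (q.p₀ N U) = 0 :=
  congrArg MulOpposite.op (LinearMap.map_zero (F.toFrame F.isFramed).coord₂)

theorem eq_coord (x : (q.preP N).obj U) :
    x = q.coord₁ N U x • q.p₀ N U + F.coord₂ x • F.p₁ := (F.toFrame F.isFramed).eq_coord x

theorem exists_act_eq (x₀ x₁ : (q.preP N).obj U) : ∃ z : Q.preC0.obj U,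
    φ.act F.isFramed z (q.p₀ N U) = x₀ ∧ φ.act F.isFramed z F.p₁ = x₁ :=
  (linePairing F.isFramed).exists_isoAct_eq (φ.app U) (φ.form_app _) (φ.inv U) (φ.app_inv U)
    (F.toFrame F.isFramed) x₀ x₁

theorem eq_zero_of_act (z : Q.preC0.obj U) (h₀ : φ.act F.isFramed z (q.p₀ N U) = 0)
    (h₁ : φ.act F.isFramed z F.p₁ = 0) : z = 0 :=
  (linePairing F.isFramed).eq_zero_of_isoAct (φ.app U) (φ.form_app _) (φ.inv U) (φ.app_inv U)
    (φ.inv_app U) (F.toFrame F.isFramed) z h₀ h₁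

end LocalFrame

end QuadForm

end Sections

/-! ### Gluing of linear maps -/

section Gluing

open CategoryTheory Opposite

variable {C : Type u} [Category.{u} C] {J : GrothendieckTopology C}

/-- Sections of a sheaf which are characterized by a predicate, locally unique and locally
existing, glue. -/
theorem exists_glue {F : Cᵒᵖ ⥤ Type u} (hF : Presieve.IsSheaf J F) {X : C} {T : Sieve X}
    (hT : T ∈ J X) (Φ : ∀ ⦃Y : C⦄ (_ : Y ⟶ X), F.obj (op Y) → Prop)
    (hres : ∀ ⦃Y Z : C⦄ (f : Y ⟶ X) (g : Z ⟶ Y) (z), Φ f z → Φ (g ≫ f) (F.map g.op z))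
    (huniq : ∀ ⦃Y : C⦄ (f : Y ⟶ X) (z z'), T f → Φ f z → Φ f z' → z = z')
    (hex : ∀ ⦃Y : C⦄ (f : Y ⟶ X), T f → ∃ z, Φ f z) :
    ∃ z : F.obj (op X), ∀ ⦃Y : C⦄ (f : Y ⟶ X), T f → Φ f (F.map f.op z) := by
  choose s hs using hex
  have hc : Presieve.FamilyOfElements.Compatible (P := F) (R := T.arrows) s := by
    intro Y₁ Y₂ Z g₁ g₂ f₁ f₂ h₁ h₂ h
    refine huniq (g₁ ≫ f₁) _ _ (T.downward_closed h₁ g₁) (hres _ _ _ (hs f₁ h₁)) ?_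
    rw [h]
    exact hres _ _ _ (hs f₂ h₂)
  refine ⟨(hF T hT).amalgamate s hc, fun Y f hf => ?_⟩
  rw [(hF T hT).valid_glue hc f hf]
  exact hs f hf

variable {R : Sheaf J RingCat.{u}}

theorem restrict_restrict {R : Cᵒᵖ ⥤ RingCat.{u}} (M : PresheafOfModules.{u} R) {X Y Z : Cᵒᵖ}
    (f : X ⟶ Y) (g : Y ⟶ Z) (x : M.obj X) :
    M.restrictₛₗ g (M.restrictₛₗ f x) = M.restrictₛₗ (f ≫ g) x :=
  (ConcreteCategory.congr_hom (M.presheaf.map_comp f g) x).symm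

theorem restrict_id {R : Cᵒᵖ ⥤ RingCat.{u}} (M : PresheafOfModules.{u} R) {X : Cᵒᵖ}
    (x : M.obj X) : M.restrictₛₗ (𝟙 X) x = x :=
  ConcreteCategory.congr_hom (M.presheaf.map_id X) x

/-- The sheaf of sets underlying a sheaf of modules. -/
theorem isSheaf_types (M : SheafOfModules.{u} R) :
    Presieve.IsSheaf J (M.val.presheaf ⋙ forget Ab.{u}) :=
  (isSheaf_iff_isSheaf_of_type _ _).1
    ((Presheaf.isSheaf_iff_isSheaf_forget J _ (forget Ab.{u})).1 M.isSheaf)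

theorem eq_of_locally (M : SheafOfModules.{u} R) {X : Cᵒᵖ} {T : Sieve X.unop} (hT : T ∈ J X.unop)
    {x y : M.val.obj X} (h : ∀ ⦃Y : C⦄ (f : Y ⟶ X.unop), T f →
      M.val.restrictₛₗ f.op x = M.val.restrictₛₗ f.op y) : x = y :=
  ((isSheaf_types M).isSeparated T hT).ext fun _ f hf => h f hf

/-- A linear map between the restrictions of two presheaves of modules to the objects over `X`. -/
@[ext]
structure LocHom {R : Cᵒᵖ ⥤ RingCat.{u}} (P G : PresheafOfModules.{u} R) (X : Cᵒᵖ) where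
  app (Y : Cᵒᵖ) (i : X ⟶ Y) : P.obj Y →ₗ[R.obj Y] G.obj Y
  naturality (Y Z : Cᵒᵖ) (i : X ⟶ Y) (j : Y ⟶ Z) (x : P.obj Y) :
    G.restrictₛₗ j (app Y i x) = app Z (i ≫ j) (P.restrictₛₗ j x)

variable {R₀ : Cᵒᵖ ⥤ RingCat.{u}}

/-- A locally bijective map from a presheaf of modules to a sheaf of modules, semilinear along
a morphism `α` of presheaves of rings. -/
structure LocBij (α : R₀ ⟶ R.obj) (P₀ : PresheafOfModules.{u} R₀) (P : SheafOfModules.{u} R) where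
  app (Y : Cᵒᵖ) : P₀.obj Y →ₛₗ[(α.app Y).hom] P.val.obj Y
  naturality {Y Z : Cᵒᵖ} (j : Y ⟶ Z) (x : P₀.obj Y) :
    P.val.restrictₛₗ j (app Y x) = app Z (P₀.restrictₛₗ j x)
  inj {Y : Cᵒᵖ} (x y : P₀.obj Y) (h : app Y x = app Y y) : ∃ T ∈ J Y.unop, ∀ ⦃Z : C⦄
    (f : Z ⟶ Y.unop), T f → P₀.restrictₛₗ f.op x = P₀.restrictₛₗ f.op y
  surj {Y : Cᵒᵖ} (y : P.val.obj Y) : ∃ T ∈ J Y.unop, ∀ ⦃Z : C⦄ (f : Z ⟶ Y.unop), T f →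
    ∃ x : P₀.obj (op Z), app (op Z) x = P.val.restrictₛₗ f.op y

/-- The unit of the sheafification is locally bijective. -/
def LocBij.sheafification (α : R₀ ⟶ R.obj) [Presheaf.IsLocallyInjective J α]
    [Presheaf.IsLocallySurjective J α] [J.WEqualsLocallyBijective AddCommGrpCat.{u}]
    [HasWeakSheafify J AddCommGrpCat.{u}] (P₀ : PresheafOfModules.{u} R₀) :
    LocBij α P₀ ((PresheafOfModules.sheafification α).obj P₀) where
  app Y :=
    { toFun := fun x => (toSheafify J P₀.presheaf).app Y x
      map_add' := fun x y => ((toSheafify J P₀.presheaf).app Y).hom.map_add x y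
      map_smul' := fun r x =>
        ((PresheafOfModules.toSheafify α (toSheafify J P₀.presheaf)).app Y).hom.map_smul r x }
  naturality j x := (NatTrans.naturality_apply (toSheafify J P₀.presheaf) j x).symm
  inj {Y} x y h := ⟨_, Presheaf.equalizerSieve_mem J (toSheafify J P₀.presheaf) (X := Y) x y h,
    by intro Z f hf; exact hf⟩
  surj {Y} y := ⟨Presheaf.imageSieve (toSheafify J P₀.presheaf) (U := Y.unop) y,
    Presheaf.imageSieve_mem J (toSheafify J P₀.presheaf) (U := Y) y, fun Z f hf => hf⟩

namespace LocBij

variable {α : R₀ ⟶ R.obj} {P₀ : PresheafOfModules.{u} R₀} {P : SheafOfModules.{u} R}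
  (η : LocBij α P₀ P) (G : SheafOfModules.{u} R) {X : Cᵒᵖ} {T : Sieve X.unop}

/-- A map to a sheaf of modules, linear along `α`, defined on the sections of `P₀` over the
objects of a sieve. -/
structure Partial (α : R₀ ⟶ R.obj) (P₀ : PresheafOfModules.{u} R₀) (G : SheafOfModules.{u} R)
    {X : Cᵒᵖ} (T : Sieve X.unop) where
  app (Y : Cᵒᵖ) (i : X ⟶ Y) (_ : T i.unop) : P₀.obj Y →ₛₗ[(α.app Y).hom] G.val.obj Y
  naturality (Y Z : Cᵒᵖ) (i : X ⟶ Y) (j : Y ⟶ Z) (hi : T i.unop) (x : P₀.obj Y) :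
    G.val.restrictₛₗ j (app Y i hi x) =
      app Z (i ≫ j) (T.downward_closed hi j.unop) (P₀.restrictₛₗ j x)

variable {G} (t : Partial α P₀ G T)

theorem Partial.app_congr {Y : Cᵒᵖ} {i i' : X ⟶ Y} (h : i = i') (hi : T i.unop)
    (hi' : T i'.unop) (b : P₀.obj Y) : t.app Y i hi b = t.app Y i' hi' b := by
  subst h; rfl

include η in
theorem partial_congr {Y : Cᵒᵖ} (i : X ⟶ Y) (hi : T i.unop) {x y : P₀.obj Y}
    (h : η.app Y x = η.app Y y) : t.app Y i hi x = t.app Y i hi y := by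
  obtain ⟨T', hT', h'⟩ := η.inj x y h
  refine eq_of_locally G hT' fun Z f hf => ?_
  rw [t.naturality, t.naturality, h' f hf]

/-- The relation whose graph is the extension of a partial map to all sections of the sheaf. -/
def Rel {Y : Cᵒᵖ} (i : X ⟶ Y) (x : P.val.obj Y) (y : G.val.obj Y) : Prop :=
  ∀ (W : Cᵒᵖ) (k : Y ⟶ W) (hk : T (i ≫ k).unop) (b : P₀.obj W),
    η.app W b = P.val.restrictₛₗ k x → G.val.restrictₛₗ k y = t.app W (i ≫ k) hk b

variable {η t}

theorem Rel.res {Y Z : Cᵒᵖ} {i : X ⟶ Y} {x : P.val.obj Y} {y : G.val.obj Y} (h : η.Rel t i x y)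
    (j : Y ⟶ Z) : η.Rel t (i ≫ j) (P.val.restrictₛₗ j x) (G.val.restrictₛₗ j y) := by
  intro W k hk b hb
  rw [restrict_restrict] at hb ⊢
  exact (h W (j ≫ k) ((congrArg (fun a => T a.unop) (Category.assoc i j k)).mp hk) b hb).trans
    (t.app_congr (Category.assoc i j k).symm _ _ b)

theorem Rel.of_lift {Y : Cᵒᵖ} {i : X ⟶ Y} (hi : T i.unop) (b : P₀.obj Y) :
    η.Rel t i (η.app Y b) (t.app Y i hi b) := by
  intro W k hk c hc
  rw [t.naturality]
  refine η.partial_congr t _ _ ?_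
  rw [hc, η.naturality]

theorem exists_cover (η : LocBij α P₀ P) (hT : T ∈ J X.unop) {Y : Cᵒᵖ} (i : X ⟶ Y)
    (x : P.val.obj Y) :
    ∃ T' ∈ J Y.unop, ∀ ⦃Z : C⦄ (f : Z ⟶ Y.unop), T' f → T (i ≫ f.op).unop ∧
      ∃ b : P₀.obj (op Z), η.app (op Z) b = P.val.restrictₛₗ f.op x := by
  obtain ⟨T', hT', h⟩ := η.surj x
  exact ⟨_, J.intersection_covering (J.pullback_stable i.unop hT) hT',
    fun Z f hf => ⟨hf.1, h f hf.2⟩⟩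

theorem Rel.unique (hT : T ∈ J X.unop) {Y : Cᵒᵖ} {i : X ⟶ Y} {x : P.val.obj Y}
    {y y' : G.val.obj Y} (h : η.Rel t i x y) (h' : η.Rel t i x y') : y = y' := by
  obtain ⟨T', hT', hc⟩ := η.exists_cover hT i x
  refine eq_of_locally G hT' fun Z f hf => ?_
  obtain ⟨hi, b, hb⟩ := hc f hf
  rw [h _ _ hi b hb, h' _ _ hi b hb]

theorem Rel.of_locally {Y : Cᵒᵖ} {i : X ⟶ Y} {x : P.val.obj Y}
    {y : G.val.obj Y} {T' : Sieve Y.unop} (hT' : T' ∈ J Y.unop)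
    (h : ∀ ⦃Z : C⦄ (f : Z ⟶ Y.unop), T' f →
      η.Rel t (i ≫ f.op) (P.val.restrictₛₗ f.op x) (G.val.restrictₛₗ f.op y)) :
    η.Rel t i x y := by
  intro W k hk b hb
  refine eq_of_locally G (J.pullback_stable k.unop hT') fun Z f hf => ?_
  have hi : (i ≫ k) ≫ f.op = (i ≫ (f ≫ k.unop).op) ≫ 𝟙 (op Z) :=
    (Category.assoc i k f.op).trans (Category.comp_id _).symm
  have h' := h _ hf (op Z) (𝟙 _) ((congrArg (fun a => T a.unop) hi).mp
    (T.downward_closed hk f)) (P₀.restrictₛₗ f.op b) (by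
      rw [← η.naturality, hb, restrict_restrict, restrict_id]; rfl)
  rw [restrict_id] at h'
  rw [restrict_restrict, t.naturality]
  exact h'.trans (t.app_congr hi.symm _ _ _)

theorem Rel.exists (η : LocBij α P₀ P) (t : Partial α P₀ G T) (hT : T ∈ J X.unop) {Y : Cᵒᵖ}
    (i : X ⟶ Y) (x : P.val.obj Y) : ∃ y : G.val.obj Y, η.Rel t i x y := by
  obtain ⟨T', hT', hc⟩ := η.exists_cover hT i x
  obtain ⟨y, hy⟩ := exists_glue (isSheaf_types G) hT'
    (fun Z f z => η.Rel t (i ≫ f.op) (P.val.restrictₛₗ f.op x) (show G.val.obj (op Z) from z))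
    (fun Z W f g z hz => by
      have h := Rel.res hz g.op
      rw [restrict_restrict, Category.assoc] at h
      exact h)
    (fun Z f z z' _ hz hz' => Rel.unique hT hz hz')
    (fun Z f hf => by
      obtain ⟨hi, b, hb⟩ := hc f hf
      refine ⟨t.app _ _ hi b, ?_⟩
      rw [← hb]
      exact Rel.of_lift hi b)
  exact ⟨y, Rel.of_locally hT' hy⟩

theorem Rel.add (hT : T ∈ J X.unop) {Y : Cᵒᵖ} {i : X ⟶ Y} {x x' : P.val.obj Y}
    {y y' : G.val.obj Y} (h : η.Rel t i x y) (h' : η.Rel t i x' y') :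
    η.Rel t i (x + x') (y + y') := by
  obtain ⟨T₁, hT₁, h₁⟩ := η.exists_cover hT i x
  obtain ⟨T₂, hT₂, h₂⟩ := η.exists_cover hT i x'
  refine Rel.of_locally (J.intersection_covering hT₁ hT₂) fun Z f hf => ?_
  obtain ⟨hi, b, hb⟩ := h₁ f hf.1
  obtain ⟨_, b', hb'⟩ := h₂ f hf.2
  rw [LinearMap.map_add, LinearMap.map_add, h _ _ hi b hb, h' _ _ hi b' hb', ← hb, ← hb',
    ← LinearMap.map_add, ← LinearMap.map_add]
  exact Rel.of_lift hi _

theorem Rel.smul [Presheaf.IsLocallySurjective J α] (hT : T ∈ J X.unop) {Y : Cᵒᵖ} {i : X ⟶ Y}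
    {x : P.val.obj Y} {y : G.val.obj Y} (h : η.Rel t i x y) (r : R.obj.obj Y) :
    η.Rel t i (r • x) (r • y) := by
  obtain ⟨T₁, hT₁, h₁⟩ := η.exists_cover hT i x
  refine Rel.of_locally (J.intersection_covering hT₁
    (Presheaf.imageSieve_mem J α (U := Y) r)) fun Z f hf => ?_
  obtain ⟨hi, b, hb⟩ := h₁ f hf.1
  obtain ⟨s, hs⟩ := hf.2
  have hs' : (α.app (op Z)).hom s = (R.obj.map f.op).hom r := hs
  rw [LinearMap.map_smulₛₗ, LinearMap.map_smulₛₗ, h _ _ hi b hb, ← hb, ← hs',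
    ← LinearMap.map_smulₛₗ, ← LinearMap.map_smulₛₗ]
  exact Rel.of_lift hi _

variable (η t)

/-- A partial map defined on a covering sieve extends to all sections of the sheaf. -/
def extend [Presheaf.IsLocallySurjective J α] (hT : T ∈ J X.unop) : LocHom P.val G.val X where
  app _ i :=
    { toFun := fun x => (Rel.exists η t hT i x).choose
      map_add' := fun x x' => Rel.unique hT (Rel.exists η t hT i (x + x')).choose_spec
        (Rel.add hT (Rel.exists η t hT i x).choose_spec (Rel.exists η t hT i x').choose_spec)
      map_smul' := fun r x => Rel.unique hT (Rel.exists η t hT i (r • x)).choose_spec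
        (Rel.smul hT (Rel.exists η t hT i x).choose_spec r) }
  naturality _ _ i j x := Rel.unique hT (Rel.res (Rel.exists η t hT i x).choose_spec j)
    (Rel.exists η t hT (i ≫ j) (P.val.restrictₛₗ j x)).choose_spec

theorem extend_app [Presheaf.IsLocallySurjective J α] (hT : T ∈ J X.unop) {Y : Cᵒᵖ} (i : X ⟶ Y)
    (hi : T i.unop) (b : P₀.obj Y) :
    (η.extend t hT).app Y i (η.app Y b) = t.app Y i hi b :=
  Rel.unique hT (Rel.exists η t hT i (η.app Y b)).choose_spec (Rel.of_lift hi b)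

include η in
/-- A linear map on the sheaf is determined by its values on the presheaf. -/
theorem hom_ext (hT : T ∈ J X.unop) {g g' : LocHom P.val G.val X}
    (h : ∀ (Y : Cᵒᵖ) (i : X ⟶ Y) (_ : T i.unop) (b : P₀.obj Y),
      g.app Y i (η.app Y b) = g'.app Y i (η.app Y b)) : g = g' := by
  refine LocHom.ext (funext₂ fun Y i => LinearMap.ext fun x => ?_)
  obtain ⟨T', hT', hc⟩ := η.exists_cover hT i x
  refine eq_of_locally G hT' fun Z f hf => ?_
  obtain ⟨hi, b, hb⟩ := hc f hf
  rw [g.naturality, g'.naturality, ← hb, h _ _ hi]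

end LocBij

/-- The restriction of a linear map to the objects over `Y`. -/
def LocHom.res {P G : PresheafOfModules.{u} R₀} {X Y : Cᵒᵖ} (t : LocHom P G X) (j : X ⟶ Y) :
    LocHom P G Y where
  app Z i := t.app Z (j ≫ i)
  naturality Z W i k x := (t.naturality Z W (j ≫ i) k x).trans
    (congrArg (fun l => t.app W l (P.restrictₛₗ k x)) (Category.assoc j i k))

/-- Linear maps between sheaves of modules glue. -/
theorem LocHom.existsUnique_glue {P G : SheafOfModules.{u} R} {X : C} {T : Sieve X} (hT : T ∈ J X)
    (x : ∀ ⦃Y : C⦄ (f : Y ⟶ X), T f → LocHom P.val G.val (op Y))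
    (hx : ∀ ⦃Y : C⦄ (f : Y ⟶ X) (hf : T f) ⦃Z : C⦄ (g : Z ⟶ Y),
      (x f hf).res g.op = x (g ≫ f) (T.downward_closed hf g)) :
    ∃! t : LocHom P.val G.val (op X), ∀ ⦃Y : C⦄ (f : Y ⟶ X) (hf : T f), t.res f.op = x f hf := by
  let η : LocBij (J := J) (𝟙 R.obj) P.val P :=
    { app := fun Y =>
        { toFun := fun x => x
          map_add' := fun _ _ => rfl
          map_smul' := fun _ _ => rfl }
      naturality := fun _ _ => rfl
      inj := fun x y h => ⟨⊤, J.top_mem _, fun Z f _ => congrArg _ h⟩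
      surj := fun y => ⟨⊤, J.top_mem _, fun Z f _ => ⟨_, rfl⟩⟩ }
  have hx' {Y : Cᵒᵖ} (i : op X ⟶ Y) (hi : T i.unop) {Z : Cᵒᵖ} (j : Y ⟶ Z) (b : P.val.obj Z) :
      (x i.unop hi).app Z j b =
        (x (i ≫ j).unop (T.downward_closed hi j.unop)).app Z (𝟙 Z) b := by
    have h := congrArg (fun t : LocHom P.val G.val Z => t.app Z (𝟙 Z) b) (hx i.unop hi j.unop)
    exact (congrArg (fun l => (x i.unop hi).app Z l b) (Category.comp_id j)).symm.trans h
  let t : LocBij.Partial (𝟙 R.obj) P.val G (X := op X) T :=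
    { app := fun Y i hi =>
        { toFun := fun b => (x i.unop hi).app Y (𝟙 Y) b
          map_add' := fun b c => ((x i.unop hi).app Y (𝟙 Y)).map_add b c
          map_smul' := fun r b => ((x i.unop hi).app Y (𝟙 Y)).map_smul r b }
      naturality := fun Y Z i j hi b => ((x i.unop hi).naturality Y Z (𝟙 Y) j b).trans
        ((congrArg (fun l => (x i.unop hi).app Z l (P.val.restrictₛₗ j b))
          (Category.id_comp j)).trans (hx' i hi j _)) }
  refine ⟨η.extend t hT, fun Y f hf => ?_, fun g hg => ?_⟩
  · refine η.hom_ext (T := ⊤) (J.top_mem _) fun Z i _ b => ?_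
    refine (η.extend_app t hT (f.op ≫ i) (T.downward_closed hf i.unop) b).trans ?_
    exact (hx' f.op hf i b).symm
  · refine η.hom_ext hT fun Z i hi b => ?_
    refine Eq.trans ?_ (η.extend_app t hT i hi b).symm
    refine Eq.trans ?_ (congrArg (fun l : LocHom P.val G.val Z => l.app Z (𝟙 Z) b) (hg i.unop hi))
    exact congrArg (fun l => g.app Z l b) (Category.comp_id i).symm

end Gluing

/-! ### Existence of local generators -/

section Frames

open CategoryTheory Opposite AlgebraicGeometry TopologicalSpace

variable {S : Scheme.{u}}

namespace QuadForm

/-- A line bundle has a generator locally, with a dual coordinate. -/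
theorem exists_generator (N : S.Modules) (hN : IsLocallyFreeOfRank (R := S.ringCatSheaf) 1 N)
    (x : S) : ∃ U : Opens S, x ∈ U ∧ ∃ (n : N.val.obj (op U)) (c : homOn N.val (struc S) (op U)),
      ev N.val (op U) c n = 1 ∧
        ∀ (V : (Opens S)ᵒᵖ) (i : op U ⟶ V) (y : N.val.obj V), y = evAt i c y • res N.val i n := by
  obtain ⟨U, hx, ⟨e'⟩⟩ := hN x
  let e : N.over U ≅ SheafOfModules.unit (S.ringCatSheaf.over U) :=
    e' ≪≫ Limits.coproductUniqueIso _
  have hr {V W : (Over U)ᵒᵖ} (j : V ⟶ W) (y : (N.over U).val.obj V) :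
      S.ringCatSheaf.obj.map j.unop.left.op (e.hom.val.app V y) =
        e.hom.val.app W (N.val.restrictₛₗ j.unop.left.op y) :=
    (PresheafOfModules.naturality_apply e.hom.val j y).symm
  have hr' {V W : (Over U)ᵒᵖ} (j : V ⟶ W) (y : S.ringCatSheaf.obj.obj (op V.unop.left)) :
      N.val.restrictₛₗ j.unop.left.op (e.inv.val.app V y) =
        e.inv.val.app W (S.ringCatSheaf.obj.map j.unop.left.op y) :=
    (PresheafOfModules.naturality_apply e.inv.val j y).symm
  have h₁ (W : (Over U)ᵒᵖ) (y) : e.inv.val.app W (e.hom.val.app W y) = y :=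
    congrArg (fun f => f.val.app W y) e.hom_inv_id
  have h₂ (W : (Over U)ᵒᵖ) (y) : e.hom.val.app W (e.inv.val.app W y) = y :=
    congrArg (fun f => f.val.app W y) e.inv_hom_id
  let o {V : (Opens S)ᵒᵖ} (i : op U ⟶ V) : (Over U)ᵒᵖ := op (Over.mk i.unop)
  let m {V W : (Opens S)ᵒᵖ} (i : op U ⟶ V) (j : V ⟶ W) : o i ⟶ o (i ≫ j) :=
    (Over.homMk (U := Over.mk (i ≫ j).unop) (V := Over.mk i.unop) j.unop rfl).op
  let c : homOn N.val (struc S) (op U) :=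
    ⟨fun V i =>
      { toFun := fun y => e.hom.val.app (o i) y
        map_add' := fun y z => (e.hom.val.app (o i)).hom.map_add y z
        map_smul' := fun r y => (e.hom.val.app (o i)).hom.map_smul r y },
      fun V W i j y => hr (m i j) y⟩
  refine ⟨U, hx, e.inv.val.app (o (𝟙 _)) (1 : S.ringCatSheaf.obj.obj (op U)), c, h₂ (o (𝟙 _)) _,
    fun V i y => ?_⟩
  have h₃ : res N.val i (e.inv.val.app (o (𝟙 _)) (1 : S.ringCatSheaf.obj.obj (op U))) =
      e.inv.val.app (o i) (1 : S.ringCatSheaf.obj.obj V) :=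
    (hr' (m (𝟙 _) i) _).trans (congrArg (fun r : S.ringCatSheaf.obj.obj V => e.inv.val.app (o i) r)
      (RingHom.map_one (S.ringCatSheaf.obj.map i).hom))
  rw [h₃]
  have h₄ (r : S.ringCatSheaf.obj.obj V) : e.inv.val.app (o i) r =
      r • (show N.val.obj V from e.inv.val.app (o i) (1 : S.ringCatSheaf.obj.obj V)) :=
    (congrArg (fun r : S.ringCatSheaf.obj.obj V => e.inv.val.app (o i) r) (mul_one r).symm).trans
      ((e.inv.val.app (o i)).hom.map_smul r (1 : S.ringCatSheaf.obj.obj V))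
  exact (h₁ (o i) y).symm.trans (h₄ _)

/-- If a family of functions generates the unit ideal near `x`, one of them is invertible
near `x`. -/
theorem exists_isUnit_map {V : Opens S} {s : Set (S.presheaf.obj (op V))}
    (hs : Ideal.span s = ⊤) (x : S) (hx : x ∈ V) :
    ∃ r ∈ s, ∃ (W : Opens S) (i : W ⟶ V), x ∈ W ∧ IsUnit ((S.presheaf.map i.op).hom r) := by
  have h : ∃ r ∈ s, IsUnit ((S.presheaf.germ V x hx).hom r) := by
    by_contra! h
    have hle : Ideal.span s ≤ (IsLocalRing.maximalIdeal (S.presheaf.stalk x)).comap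
        (S.presheaf.germ V x hx).hom := Ideal.span_le.2 fun r hr => h r hr
    rw [hs, top_le_iff] at hle
    exact Ideal.comap_ne_top _ (Ideal.IsPrime.ne_top inferInstance) hle
  obtain ⟨r, hr, hu⟩ := h
  obtain ⟨W, i, hW, h⟩ := S.toRingedSpace.isUnit_res_of_isUnit_germ V r x hx hu
  exact ⟨r, hr, W, i, hW, h⟩

theorem exists_isFramed {M : S.PresheafOfModules} (N L : S.Modules)
    (hN : IsLocallyFreeOfRank (R := S.ringCatSheaf) 1 N)
    (hL : IsLocallyFreeOfRank (R := S.ringCatSheaf) 1 L)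
    (q : QuadForm M L.val) (hq : q.IsPrimitive) (x : S) :
    ∃ V : Opens S, x ∈ V ∧ q.IsFramed N.val (op V) := by
  obtain ⟨U₁, hx₁, n₀, d, hd, hn⟩ := exists_generator N hN x
  obtain ⟨U₂, hx₂, l₀, c, hc, hl⟩ := exists_generator L hL x
  obtain ⟨V, i, hxV, hV⟩ := hq U₂ l₀ x hx₂
  let cV := homOn.res L.val (struc S) i.op c
  have hs : Ideal.span (Set.range fun v => ev L.val (op V) cV (q.app (op V) v)) = ⊤ := by
    rw [Ideal.eq_top_iff_one]
    have h := Submodule.mem_map_of_mem (f := ev L.val (op V) cV) hV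
    rw [ev_homOn_res, hc, RingHom.map_one, Submodule.map_span, ← Set.range_comp] at h
    exact h
  obtain ⟨_, ⟨v, rfl⟩, W, j, hxW, hu⟩ := exists_isUnit_map hs x hxV
  let W' := W ⊓ U₁
  have hW' : W' ≤ U₂ := inf_le_left.trans (j.le.trans i.le)
  let k₁ : op U₁ ⟶ op W' := (homOfLE inf_le_right).op
  let k₂ : op U₂ ⟶ op W' := (homOfLE hW').op
  let k : op V ⟶ op W' := (homOfLE (inf_le_left.trans j.le)).op
  let v' := res M k v
  let c' := homOn.res L.val (struc S) k₂ c
  let d' := homOn.res N.val (struc S) k₁ d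
  let a := ev L.val (op W') c' (q.app (op W') v')
  have ha : IsUnit a := by
    have h := hu.map (S.presheaf.map (homOfLE inf_le_left : W' ⟶ W).op).hom
    have e : a = (S.presheaf.map k).hom (ev L.val (op V) cV (q.app (op V) v)) :=
      q.ev_res k cV v
    rw [e]
    have hk : k = j.op ≫ (homOfLE inf_le_left : W' ⟶ W).op := Subsingleton.elim _ _
    rw [hk, map_comp_hom]
    exact h
  obtain ⟨b, hb⟩ := ha.exists_left_inv
  have hlW (Y : (Opens S)ᵒᵖ) (t : op W' ⟶ Y) (y : L.val.obj Y) :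
      y = evAt t c' y • res L.val t (res L.val k₂ l₀) := by
    rw [res_res L.val k₂ t (k₂ ≫ t)]
    exact hl Y (k₂ ≫ t) y
  have hl₀ : res L.val k₂ l₀ = b • q.app (op W') v' := by
    have h := hlW (op W') (𝟙 _) (q.app (op W') v')
    rw [res_id] at h
    rw [h, smul_smul]
    exact (one_smul _ _).symm.trans (congrArg (· • res L.val k₂ l₀) hb.symm)
  let l₁ := q.app (op W') v'
  have hf : ev L.val (op W') (b • c') l₁ = 1 := by
    rw [LinearMap.map_smul]
    exact hb
  have hf' (Y : (Opens S)ᵒᵖ) (t : op W' ⟶ Y) : evAt t (b • c') (res L.val t l₁) = 1 := by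
    have h := ev_homOn_res t (b • c') l₁
    rw [hf, RingHom.map_one] at h
    exact h
  have hd' : ev N.val (op W') d' (res N.val k₁ n₀) = 1 := by
    rw [ev_homOn_res, hd, RingHom.map_one]
  refine ⟨W', ⟨hxW, hx₁⟩, ⟨{
    f₀ := b • c'
    n₀ := res N.val k₁ n₀
    h₀ := ⟨fun Y t => (evAt t d').smulRight (res L.val t l₁), fun Y Z s t y => ?_⟩
    v := v'
    ev_v := hf
    ev_app := ?_
    eq_smul_n := fun Y t y => ?_
    eq_smul_l := fun Y t y => ?_ }⟩⟩
  · refine ((res L.val t).map_smulₛₗ (evAt s d' y) (res L.val s l₁)).trans ?_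
    exact congrArg₂ (· • ·) (d'.2 Y Z s t y) (res_res L.val s t (s ≫ t) l₁)
  · have h := hf' (op W') (𝟙 _)
    refine Eq.trans ?_ h
    refine congrArg (ev L.val (op W') (b • c')) ?_
    exact (congrArg (· • res L.val (𝟙 _) l₁) hd').trans (one_smul _ _)
  · have h : evAt t (b • c') (evAt t d' y • res L.val t l₁) = evAt t d' y := by
      rw [LinearMap.map_smul, hf', smul_eq_mul, mul_one]
    refine Eq.trans ?_ (congrArg (· • res N.val t (res N.val k₁ n₀)) h.symm)
    have h' := hn Y (k₁ ≫ t) y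
    rw [← res_res N.val k₁ t] at h'
    exact h'
  · refine (hlW Y t y).trans ?_
    rw [hl₀, LinearMap.map_smulₛₗ, smul_smul, mul_comm]
    rfl

end QuadForm

end Frames

/-! ### The isomorphism with the algebra of endomorphisms -/

section Endomorphisms

open CategoryTheory Opposite AlgebraicGeometry TopologicalSpace

variable {S : Scheme.{u}}

section

variable {A : AlgSheaf S} {P : SheafOfModules.{u} A.right}

/-- A linear map over the open subsets of `U` as a section of the sheaf of endomorphisms. -/
def LocHom.toEnd {U : (Opens S)ᵒᵖ} (g : LocHom P.val P.val U) : endOn A P U :=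
  ⟨g.app, g.naturality⟩

/-- A section of the sheaf of endomorphisms as a linear map over the open subsets of `U`. -/
def endOn.toLocHom {U : (Opens S)ᵒᵖ} (f : endOn A P U) : LocHom P.val P.val U :=
  ⟨f.1, f.2⟩

theorem endOn.ext_app {U : (Opens S)ᵒᵖ} {f g : endOn A P U}
    (h : endOn.toLocHom f = endOn.toLocHom g) : f = g :=
  Subtype.ext (congrArg LocHom.app h)

variable (A P) in
theorem endAlg_isSheaf : Presheaf.IsSheaf (zar S) (endAlg A P).ring := by
  rw [Presheaf.isSheaf_iff_isSheaf_forget (zar S) _ (forget RingCat.{u}),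
    isSheaf_iff_isSheaf_of_type]
  intro U T hT x hx
  obtain ⟨g, hg, hg'⟩ := LocHom.existsUnique_glue hT
    (fun Y f hf => endOn.toLocHom (x f hf : endOn A P (op Y)))
    (fun Y f hf Z k => congrArg (fun z : endOn A P (op Z) => endOn.toLocHom z)
      ((Presieve.compatible_iff_sieveCompatible x).1 hx f k hf).symm)
  exact ⟨g.toEnd, fun Y f hf => endOn.ext_app (hg f hf), fun z hz => endOn.ext_app
    (hg' (endOn.toLocHom (z : endOn A P (op U))) fun Y f hf =>
      congrArg (fun w : endOn A P (op Y) => endOn.toLocHom w) (hz f hf))⟩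

end

namespace QuadForm

variable {M N L E : S.PresheafOfModules} (q : QuadForm M L) {Q : QuadForm E L}

/-- The canonical map from the presheaf of even Clifford algebras to its associated sheaf, on
opposite rings. -/
def toRight : q.preC0 ⋙ opRing ⟶ q.evenClifford.right.obj := q.preC0Alg.toRight

instance : Presheaf.IsLocallySurjective (zar S) q.toRight :=
  inferInstanceAs (Presheaf.IsLocallySurjective (zar S) q.preC0Alg.toRight)

/-- The map from the presheaf of modules `C₀(q) ⊕ C₁(q) ⊗ N^∨` to the associated sheaf. -/
def toBimodule (N : S.PresheafOfModules) :
    LocBij (J := zar S) q.toRight (q.preP N) (q.bimodule N) :=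
  LocBij.sheafification q.preC0Alg.toRight (q.preP N)

/-- The open subsets of `U` over which local generators exist. -/
def framedSieve (N : S.PresheafOfModules) (U : (Opens S)ᵒᵖ) : Sieve U.unop where
  arrows V _ := q.IsFramed N (op V)
  downward_closed hf g := hf.restrict g.op

/-- Local generators exist near every point. -/
def LocallyFramed (N : S.PresheafOfModules) : Prop :=
  ∀ x : S, ∃ V : Opens S, x ∈ V ∧ q.IsFramed N (op V)

variable {q}

theorem LocallyFramed.exists_le (h : q.LocallyFramed N) {x : S} {U : Opens S} (hx : x ∈ U) :
    ∃ V : Opens S, ∃ _ : V ⟶ U, x ∈ V ∧ q.IsFramed N (op V) := by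
  obtain ⟨V, hV, hF⟩ := h x
  exact ⟨V ⊓ U, homOfLE inf_le_right, ⟨hV, hx⟩, hF.restrict (homOfLE inf_le_left).op⟩

theorem LocallyFramed.mem (h : q.LocallyFramed N) (U : (Opens S)ᵒᵖ) :
    q.framedSieve N U ∈ zar S U.unop := by
  intro x hx
  obtain ⟨V, i, hV, hF⟩ := h.exists_le hx
  exact ⟨V, i, hF, hV⟩

variable (φ : HypIso Q q N)

/-- The action of a section of the even Clifford algebra on the sections of the presheaf
`C₀(q) ⊕ C₁(q) ⊗ N^∨` over the open subsets where local generators exist. -/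
def HypIso.actPartial {U : (Opens S)ᵒᵖ} (z : Q.preC0.obj U) :
    LocBij.Partial q.toRight (q.preP N) (q.bimodule N) (q.framedSieve N U) where
  app Y i hi :=
    { toFun := fun x => (q.toBimodule N).app Y (φ.act hi (Q.preC0.map i z) x)
      map_add' := fun x y => by
        rw [LinearMap.map_add, LinearMap.map_add]
      map_smul' := fun r x => by
        rw [LinearMap.map_smul, LinearMap.map_smulₛₗ] }
  naturality Y Z i j hi x := by
    have h := congrArg ((q.toBimodule N).app Z) (φ.act_res hi j (Q.preC0.map i z) x)
    rw [← LocBij.naturality] at h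
    refine h.trans ?_
    exact congrArg (fun w => (q.toBimodule N).app Z (φ.act _ w ((q.preP N).restrictₛₗ j x)))
      (ConcreteCategory.congr_hom (Q.preC0.map_comp i j) z).symm

variable (hF : q.LocallyFramed N)

/-- The action of a section of the even Clifford algebra on the sheaf of bimodules. -/
def HypIso.actSheaf {U : (Opens S)ᵒᵖ} (z : Q.preC0.obj U) :
    endOn q.evenClifford (q.bimodule N) U :=
  ((q.toBimodule N).extend (φ.actPartial z) (hF.mem U)).toEnd

theorem HypIso.actSheaf_app {U V : (Opens S)ᵒᵖ} (z : Q.preC0.obj U) (i : U ⟶ V)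
    (hi : q.IsFramed N V) (x : (q.preP N).obj V) :
    (φ.actSheaf hF z).1 V i ((q.toBimodule N).app V x) =
      (q.toBimodule N).app V (φ.act hi (Q.preC0.map i z) x) :=
  (q.toBimodule N).extend_app (φ.actPartial z) (hF.mem U) i hi x

include hF in
theorem end_ext {U : (Opens S)ᵒᵖ} {f g : endOn q.evenClifford (q.bimodule N) U}
    (h : ∀ (V : (Opens S)ᵒᵖ) (i : U ⟶ V), q.IsFramed N V → ∀ x : (q.preP N).obj V,
      f.1 V i ((q.toBimodule N).app V x) = g.1 V i ((q.toBimodule N).app V x)) : f = g :=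
  endOn.ext_app ((q.toBimodule N).hom_ext (hF.mem U) h)

/-- The action of the presheaf of even Clifford algebras on the sheaf of bimodules. -/
def HypIso.actHom : Q.preC0 ⟶ (endAlg q.evenClifford (q.bimodule N)).ring where
  app U := RingCat.ofHom
    { toFun := fun z => φ.actSheaf hF z
      map_one' := end_ext hF fun V i hi x => by
        refine (φ.actSheaf_app hF _ i hi x).trans ((congrArg
          (fun f : Module.End (q.opC0 V) ((q.preP N).obj V) => (q.toBimodule N).app V (f x))
          (RingHom.map_one ((φ.act hi).comp (Q.preC0.map i).hom))).trans ?_)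
        rfl
      map_mul' := fun y z => end_ext hF fun V i hi x => by
        refine (φ.actSheaf_app hF _ i hi x).trans ((congrArg
          (fun f : Module.End (q.opC0 V) ((q.preP N).obj V) => (q.toBimodule N).app V (f x))
          (RingHom.map_mul ((φ.act hi).comp (Q.preC0.map i).hom) y z)).trans ?_)
        refine Eq.trans ?_ (congrArg ((φ.actSheaf hF y).1 V i)
          (φ.actSheaf_app hF z i hi x)).symm
        exact (φ.actSheaf_app hF y i hi _).symm
      map_zero' := end_ext hF fun V i hi x => by
        refine (φ.actSheaf_app hF _ i hi x).trans ((congrArg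
          (fun f : Module.End (q.opC0 V) ((q.preP N).obj V) => (q.toBimodule N).app V (f x))
          (RingHom.map_zero ((φ.act hi).comp (Q.preC0.map i).hom))).trans ?_)
        exact LinearMap.map_zero _
      map_add' := fun y z => end_ext hF fun V i hi x => by
        refine (φ.actSheaf_app hF _ i hi x).trans ((congrArg
          (fun f : Module.End (q.opC0 V) ((q.preP N).obj V) => (q.toBimodule N).app V (f x))
          (RingHom.map_add ((φ.act hi).comp (Q.preC0.map i).hom) y z)).trans ?_)
        refine Eq.trans (LinearMap.map_add _ _ _) ?_
        exact congrArg₂ (· + ·) (φ.actSheaf_app hF y i hi x).symm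
          (φ.actSheaf_app hF z i hi x).symm }
  naturality U V i := RingCat.hom_ext <| RingHom.ext fun z => end_ext hF fun W j hW x => by
    refine (φ.actSheaf_app hF _ j hW x).trans (Eq.trans ?_
      (φ.actSheaf_app hF z (i ≫ j) hW x).symm)
    exact congrArg (fun w => (q.toBimodule N).app W (φ.act hW w x))
      (ConcreteCategory.congr_hom (Q.preC0.map_comp i j) z).symm

theorem HypIso.unit_actHom :
    Q.preC0Unit ≫ φ.actHom hF = (endAlg q.evenClifford (q.bimodule N)).unit := by
  refine NatTrans.ext (funext fun U => RingCat.hom_ext <| RingHom.ext fun r =>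
    end_ext hF fun V i hV x => ?_)
  refine (φ.actSheaf_app hF _ i hV x).trans ?_
  have h : Q.preC0.map i (Q.preC0Unit.app U r) = Q.preC0Unit.app V (S.ringCatSheaf.obj.map i r) :=
    (NatTrans.naturality_apply Q.preC0Unit i r).symm
  refine (congrArg (fun w => (q.toBimodule N).app V (φ.act hV w x)) h).trans ?_
  rw [φ.act_unit, LinearMap.map_smulₛₗ]
  rfl

theorem toBimodule_eq {U : (Opens S)ᵒᵖ} (F : q.LocalFrame N U) (x : (q.preP N).obj U) :
    (q.toBimodule N).app U x =
      (q.toRight.app U).hom (q.coord₁ N U x) • (q.toBimodule N).app U (q.p₀ N U) +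
        (q.toRight.app U).hom (F.coord₂ x) • (q.toBimodule N).app U F.p₁ :=
  (congrArg ((q.toBimodule N).app U) (F.eq_coord x)).trans ((LinearMap.map_add _ _ _).trans
    (congrArg₂ (· + ·) (LinearMap.map_smulₛₗ _ _ _) (LinearMap.map_smulₛₗ _ _ _)))

include hF in
/-- An endomorphism is determined by its values on a local basis. -/
theorem end_ext_frame {U : (Opens S)ᵒᵖ} (F : q.LocalFrame N U)
    {f g : endOn q.evenClifford (q.bimodule N) U}
    (h₀ : f.1 U (𝟙 U) ((q.toBimodule N).app U (q.p₀ N U)) =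
      g.1 U (𝟙 U) ((q.toBimodule N).app U (q.p₀ N U)))
    (h₁ : f.1 U (𝟙 U) ((q.toBimodule N).app U F.p₁) =
      g.1 U (𝟙 U) ((q.toBimodule N).app U F.p₁)) : f = g := by
  refine end_ext hF fun V i _ x => ?_
  have h {b : (q.preP N).obj U} {c : (q.preP N).obj V} (hc : (q.preP N).restrictₛₗ i b = c)
      (hb : f.1 U (𝟙 U) ((q.toBimodule N).app U b) = g.1 U (𝟙 U) ((q.toBimodule N).app U b)) :
      f.1 V i ((q.toBimodule N).app V c) = g.1 V i ((q.toBimodule N).app V c) := by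
    rw [← hc, ← LocBij.naturality]
    exact (f.2 U V (𝟙 U) i _).symm.trans ((congrArg _ hb).trans (g.2 U V (𝟙 U) i _))
  have hx := toBimodule_eq (F.restrict i) x
  refine (congrArg (f.1 V i) hx).trans (Eq.trans ?_ (congrArg (g.1 V i) hx).symm)
  refine (LinearMap.map_add _ _ _).trans (Eq.trans ?_ (LinearMap.map_add _ _ _).symm)
  refine congrArg₂ (· + ·) ?_ ?_
  · exact (LinearMap.map_smul _ _ _).trans ((congrArg _ (h (p₀_res N q i) h₀)).trans
      (LinearMap.map_smul _ _ _).symm)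
  · exact (LinearMap.map_smul _ _ _).trans ((congrArg _ (h (F.p₁_res i) h₁)).trans
      (LinearMap.map_smul _ _ _).symm)

instance : Presheaf.IsLocallyInjective (zar S) (φ.actHom hF) where
  equalizerSieve_mem {U} y z h x hx := by
    obtain ⟨V, i, hxV, ⟨F⟩⟩ := hF.exists_le hx
    have h' (b : (q.preP N).obj (op V)) : (q.toBimodule N).app (op V)
        (φ.act F.isFramed (Q.preC0.map i.op y) b) = (q.toBimodule N).app (op V)
        (φ.act F.isFramed (Q.preC0.map i.op z) b) := by
      rw [← φ.actSheaf_app hF, ← φ.actSheaf_app hF]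
      exact congrArg (fun f : endOn q.evenClifford (q.bimodule N) U => f.1 (op V) i.op _) h
    obtain ⟨T₀, hT₀, h₀⟩ := (q.toBimodule N).inj _ _ (h' (q.p₀ N (op V)))
    obtain ⟨T₁, hT₁, h₁⟩ := (q.toBimodule N).inj _ _ (h' F.p₁)
    obtain ⟨W, j, hj, hxW⟩ := (zar S).intersection_covering hT₀ hT₁ x hxV
    have e₀ := h₀ j hj.1
    have e₁ := h₁ j hj.2
    rw [φ.act_res, φ.act_res] at e₀ e₁
    rw [p₀_res] at e₀
    rw [LocalFrame.p₁_res] at e₁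
    refine ⟨W, j ≫ i, ?_, hxW⟩
    have hm (w : Q.preC0.obj U) : Q.preC0.map (j ≫ i).op w =
      Q.preC0.map j.op (Q.preC0.map i.op w) := ConcreteCategory.congr_hom
        (Q.preC0.map_comp i.op j.op) w
    refine (hm y).trans (Eq.trans ?_ (hm z).symm)
    refine sub_eq_zero.1 ((F.restrict j.op).eq_zero_of_act φ _ ?_ ?_)
    · rw [RingHom.map_sub, LinearMap.sub_apply]
      exact sub_eq_zero.2 e₀
    · rw [RingHom.map_sub, LinearMap.sub_apply]
      exact sub_eq_zero.2 e₁

instance : Presheaf.IsLocallySurjective (zar S) (φ.actHom hF) where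
  imageSieve_mem {U} g x hx := by
    obtain ⟨V, i, hxV, ⟨F⟩⟩ := hF.exists_le hx
    let g' : endOn q.evenClifford (q.bimodule N) (op U) := g
    obtain ⟨T₀, hT₀, h₀⟩ := (q.toBimodule N).surj
      (g'.1 (op V) i.op ((q.toBimodule N).app (op V) (q.p₀ N (op V))))
    obtain ⟨T₁, hT₁, h₁⟩ := (q.toBimodule N).surj
      (g'.1 (op V) i.op ((q.toBimodule N).app (op V) F.p₁))
    obtain ⟨W, j, hj, hxW⟩ := (zar S).intersection_covering hT₀ hT₁ x hxV
    obtain ⟨x₀, e₀⟩ := h₀ j hj.1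
    obtain ⟨x₁, e₁⟩ := h₁ j hj.2
    rw [g'.2, LocBij.naturality] at e₀ e₁
    rw [p₀_res] at e₀
    rw [LocalFrame.p₁_res] at e₁
    obtain ⟨z, hz₀, hz₁⟩ := (F.restrict j.op).exists_act_eq φ x₀ x₁
    refine ⟨W, j ≫ i, ⟨z, ?_⟩, hxW⟩
    have hm : Q.preC0.map (𝟙 (op W)) z = z := ConcreteCategory.congr_hom (Q.preC0.map_id _) z
    refine end_ext_frame hF (F.restrict j.op)
      ((φ.actSheaf_app hF z (𝟙 _) (F.restrict j.op).isFramed _).trans ?_)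
      ((φ.actSheaf_app hF z (𝟙 _) (F.restrict j.op).isFramed _).trans ?_)
    · rw [hm, hz₀]
      exact e₀
    · rw [hm, hz₁]
      exact e₁

/-- The isomorphism `C₀(Q) ≅ End(C₀(q) ⊕ C₁(q) ⊗ N^∨)` for `Q ≅ H_L(N) ⊥ q`. -/
def HypIso.isoEnd : AlgPresheaf.Iso Q.evenClifford.toAlgPresheaf
    (endAlg q.evenClifford (q.bimodule N)) :=
  let g := sheafifyLift (zar S) (φ.actHom hF) (endAlg_isSheaf _ _)
  have hg : toSheafify (zar S) Q.preC0 ≫ g = φ.actHom hF := toSheafify_sheafifyLift _ _ _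
  have hi : IsIso g := by
    have : Presheaf.IsLocallyInjective (zar S) g :=
      Presheaf.isLocallyInjective_of_isLocallyInjective_of_isLocallySurjective_fac (zar S) _ hg
    have : Presheaf.IsLocallySurjective (zar S) g :=
      Presheaf.isLocallySurjective_of_isLocallySurjective_fac (zar S) hg
    let g' : (presheafToSheaf (zar S) RingCat.{u}).obj Q.preC0 ⟶
      ⟨(endAlg q.evenClifford (q.bimodule N)).ring, endAlg_isSheaf _ _⟩ := ⟨g⟩
    have : IsIso g' := Sheaf.isLocallyBijective_iff_isIso g' |>.1 ⟨‹_›, ‹_›⟩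
    exact inferInstanceAs (IsIso ((sheafToPresheaf _ _).map g'))
  { iso := @asIso _ _ _ _ g hi
    unit_comp := by
      refine (Category.assoc _ _ _).trans ?_
      refine (congrArg (Q.preC0Unit ≫ ·) hg).trans ?_
      exact φ.unit_actHom hF }

end QuadForm

end Endomorphisms

/-! ### Direct summands of finite free sheaves and presentations -/

section Presentations

open CategoryTheory Limits

variable {C : Type u} [Category.{u} C] {J : GrothendieckTopology C} {R : Sheaf J RingCat.{u}}

/-- `T` has a finite dual basis: it is a direct summand of a finite free sheaf of modules. -/
def HasFiniteCoordinates (T : SheafOfModules.{u} R) : Prop :=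
  ∃ (K : Type u) (_ : Fintype K) (p : K → (T ⟶ SheafOfModules.unit R))
    (i : K → (SheafOfModules.unit R ⟶ T)), ∑ k, p k ≫ i k = 𝟙 T

namespace HasFiniteCoordinates

/-- The map from a free sheaf of modules with prescribed values on the basis. -/
def freeDesc {T : SheafOfModules.{u} R} {K : Type u} (i : K → (SheafOfModules.unit R ⟶ T)) :
    SheafOfModules.free K ⟶ T := Sigma.desc i

theorem ι_freeDesc {T : SheafOfModules.{u} R} {K : Type u} (i : K → (SheafOfModules.unit R ⟶ T))
    (k : K) : SheafOfModules.ιFree k ≫ freeDesc i = i k := Sigma.ι_desc i k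

theorem free_hom_ext {T : SheafOfModules.{u} R} {K : Type u} {f g : SheafOfModules.free K ⟶ T}
    (h : ∀ k, SheafOfModules.ιFree k ≫ f = SheafOfModules.ιFree k ≫ g) : f = g :=
  Sigma.hom_ext _ _ h

theorem exists_retract {T : SheafOfModules.{u} R} (h : HasFiniteCoordinates T) :
    ∃ (K : Type u) (_ : Finite K) (i : T ⟶ SheafOfModules.free K) (r : SheafOfModules.free K ⟶ T),
      i ≫ r = 𝟙 T := by
  obtain ⟨K, _, p, i, h⟩ := h
  refine ⟨K, inferInstance, ∑ k, p k ≫ SheafOfModules.ιFree k, freeDesc i, ?_⟩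
  rw [Preadditive.sum_comp, ← h]
  refine Finset.sum_congr rfl fun k _ => ?_
  rw [Category.assoc, ι_freeDesc]

theorem free (K : Type u) [Finite K] :
    HasFiniteCoordinates (SheafOfModules.free (R := R) K) := by
  classical
  have := Fintype.ofFinite K
  refine ⟨K, inferInstance, fun k => freeDesc fun j => if j = k then 𝟙 _ else 0,
    fun k => SheafOfModules.ιFree k, free_hom_ext fun j => ?_⟩
  rw [Preadditive.comp_sum, Finset.sum_eq_single j]
  · rw [← Category.assoc, ι_freeDesc, if_pos rfl, Category.id_comp, Category.comp_id]
  · intro k _ hk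
    rw [← Category.assoc, ι_freeDesc, if_neg hk.symm, zero_comp]
  · exact fun hj => absurd (Finset.mem_univ j) hj

theorem retract {T T' : SheafOfModules.{u} R} (h : HasFiniteCoordinates T) (i : T' ⟶ T)
    (r : T ⟶ T') (hr : i ≫ r = 𝟙 T') : HasFiniteCoordinates T' := by
  obtain ⟨K, hK, p, j, h⟩ := h
  refine ⟨K, hK, fun k => i ≫ p k, fun k => j k ≫ r, ?_⟩
  have e : i ≫ (∑ k, p k ≫ j k) ≫ r = 𝟙 T' := by rw [h, Category.id_comp, hr]
  rw [← e, Preadditive.sum_comp, Preadditive.comp_sum]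
  refine Finset.sum_congr rfl fun k _ => ?_
  simp only [Category.assoc]

variable {C' : Type u} [Category.{u} C'] {J' : GrothendieckTopology C'}
  {R' : Sheaf J' RingCat.{u}} (Φ : SheafOfModules.{u} R ⥤ SheafOfModules.{u} R') [Φ.Additive]

theorem map (hΦ : HasFiniteCoordinates (Φ.obj (SheafOfModules.unit R)))
    {T : SheafOfModules.{u} R} (h : HasFiniteCoordinates T) : HasFiniteCoordinates (Φ.obj T) := by
  obtain ⟨K, _, p, i, h⟩ := h
  obtain ⟨K', _, p', i', h'⟩ := hΦ
  refine ⟨K × K', inferInstance, fun k => Φ.map (p k.1) ≫ p' k.2,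
    fun k => i' k.2 ≫ Φ.map (i k.1), ?_⟩
  rw [Fintype.sum_prod_type, ← Φ.map_id, ← h, Functor.map_sum]
  refine Finset.sum_congr rfl fun k _ => ?_
  rw [Φ.map_comp, ← Category.comp_id (Φ.map (p k)), Category.assoc, ← h',
    Preadditive.sum_comp, Preadditive.comp_sum]
  refine Finset.sum_congr rfl fun k' _ => ?_
  simp only [Category.assoc]

end HasFiniteCoordinates

/-- `M` has a finite global presentation. -/
def IsFinitelyPresented (M : SheafOfModules.{u} R) : Prop :=
  ∃ σ : M.Presentation, σ.IsFinite

namespace IsFinitelyPresented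

open HasFiniteCoordinates

theorem of_iso {M M' : SheafOfModules.{u} R} (h : IsFinitelyPresented M) (e : M ≅ M') :
    IsFinitelyPresented M' := by
  obtain ⟨σ, hσ⟩ := h
  exact ⟨σ.ofIsIso e.hom, inferInstance⟩

/-- A cokernel of a map between direct summands of finite free sheaves of modules is finitely
presented. -/
theorem of_isColimit {M A B : SheafOfModules.{u} R} (hA : HasFiniteCoordinates A)
    (hB : HasFiniteCoordinates B) (f : A ⟶ B) (g : B ⟶ M) (w : f ≫ g = 0)
    (hg : IsColimit (CokernelCofork.ofπ g w)) : IsFinitelyPresented M := by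
  obtain ⟨KA, _, iA, rA, hA⟩ := hA.exists_retract
  obtain ⟨KB, _, iB, rB, hB⟩ := hB.exists_retract
  have hge : Epi g := epi_of_isColimit_cofork hg
  let v : SheafOfModules.free (KA ⊕ KB) ⟶ SheafOfModules.free (R := R) KB :=
    freeDesc (Sum.elim (fun k => SheafOfModules.ιFree k ≫ rA ≫ f ≫ iB)
      (fun k => SheafOfModules.ιFree k ≫ (𝟙 _ - rB ≫ iB)))
  have hv {Z : SheafOfModules.{u} R} (t : SheafOfModules.free KB ⟶ Z) :
      v ≫ t = 0 ↔ rA ≫ f ≫ iB ≫ t = 0 ∧ t = rB ≫ iB ≫ t := by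
    have h₁ (k : KA) : SheafOfModules.ιFree (Sum.inl k) ≫ v ≫ t =
        SheafOfModules.ιFree k ≫ rA ≫ f ≫ iB ≫ t := by
      rw [← Category.assoc, ι_freeDesc]
      simp only [Sum.elim_inl, Category.assoc]
    have h₂ (k : KB) : SheafOfModules.ιFree (Sum.inr k) ≫ v ≫ t =
        SheafOfModules.ιFree k ≫ (t - rB ≫ iB ≫ t) := by
      rw [← Category.assoc, ι_freeDesc]
      simp only [Sum.elim_inr, Category.assoc, Preadditive.sub_comp, Category.id_comp]
    constructor
    · intro h
      refine ⟨free_hom_ext fun k => ?_, sub_eq_zero.1 (free_hom_ext fun k => ?_)⟩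
      · rw [← h₁, h, comp_zero, comp_zero]
      · rw [← h₂, h, comp_zero, comp_zero]
    · rintro ⟨h, h'⟩
      refine free_hom_ext fun k => ?_
      rcases k with k | k
      · rw [h₁, h, comp_zero, comp_zero]
      · rw [h₂, ← h', sub_self, comp_zero, comp_zero]
  have hv₀ : v ≫ rB ≫ g = 0 := by
    refine (hv _).2 ⟨?_, ?_⟩
    · rw [← Category.assoc iB, hB, Category.id_comp, w, comp_zero]
    · rw [← Category.assoc iB, hB, Category.id_comp]
  have hf {Z : SheafOfModules.{u} R} (t : SheafOfModules.free KB ⟶ Z) (ht : v ≫ t = 0) :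
      f ≫ iB ≫ t = 0 := by
    have h := congrArg (iA ≫ ·) ((hv t).1 ht).1
    simp only [comp_zero, ← Category.assoc iA, hA, Category.id_comp] at h
    exact h
  refine ⟨SheafOfModules.presentationOfIsCokernelFree v (rB ≫ g) hv₀
    (CokernelCofork.IsColimit.ofπ _ _ (fun t ht => hg.desc (CokernelCofork.ofπ (iB ≫ t) (hf t ht)))
      (fun t ht => ?_) fun t ht m hm => ?_), ?_⟩
  · have h : g ≫ hg.desc (CokernelCofork.ofπ (iB ≫ t) (hf t ht)) = iB ≫ t :=
      hg.fac (CokernelCofork.ofπ (iB ≫ t) (hf t ht)) WalkingParallelPair.one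
    rw [Category.assoc, h]
    exact ((hv t).1 ht).2.symm
  · refine hge.left_cancellation _ _ ?_
    have h : g ≫ hg.desc (CokernelCofork.ofπ (iB ≫ t) (hf t ht)) = iB ≫ t :=
      hg.fac (CokernelCofork.ofπ (iB ≫ t) (hf t ht)) WalkingParallelPair.one
    rw [h, ← hm, Category.assoc, ← Category.assoc iB, hB, Category.id_comp]
  · exact { isFiniteType_generators := ⟨inferInstanceAs (Finite KB)⟩
            isFiniteType_relations := ⟨inferInstanceAs (Finite (KA ⊕ KB))⟩ }

variable {C' : Type u} [Category.{u} C'] {J' : GrothendieckTopology C'}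
  {R' : Sheaf J' RingCat.{u}} (Φ : SheafOfModules.{u} R ⥤ SheafOfModules.{u} R') [Φ.Additive]
  [Φ.IsLeftAdjoint]

/-- A right exact functor which maps the structure sheaf to a direct summand of a finite free
sheaf of modules preserves finite presentations. -/
theorem map (hΦ : HasFiniteCoordinates (Φ.obj (SheafOfModules.unit R)))
    {M : SheafOfModules.{u} R} (h : IsFinitelyPresented M) : IsFinitelyPresented (Φ.obj M) := by
  obtain ⟨σ, hσ⟩ := h
  have := hσ.isFiniteType_generators.finite
  have := hσ.isFiniteType_relations.finite
  have hp : PreservesColimitsOfSize.{0, 0} Φ :=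
    (Adjunction.ofIsLeftAdjoint Φ).leftAdjoint_preservesColimits
  exact of_isColimit (HasFiniteCoordinates.map Φ hΦ (HasFiniteCoordinates.free _))
    (HasFiniteCoordinates.map Φ hΦ (HasFiniteCoordinates.free _)) _ _ _
    (isColimitCoforkMapOfIsColimit' Φ _ σ.isColimit)

end IsFinitelyPresented

end Presentations

/-! ### Corners of sheaves of rings -/

section Corner

open CategoryTheory Limits Opposite

variable {C : Type u} [Category.{u} C] {J : GrothendieckTopology C}

/-- A presheaf of modules from its modules of sections and their restriction maps. -/
def ofSections {R : Cᵒᵖ ⥤ RingCat.{u}} (A : Cᵒᵖ → Type u)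
    [∀ X, AddCommGroup (A X)] [∀ X, Module (R.obj X) (A X)]
    (r : ∀ {X Y : Cᵒᵖ} (i : X ⟶ Y), A X →ₛₗ[(R.map i).hom] A Y)
    (hid : ∀ (X : Cᵒᵖ) (x : A X), r (𝟙 X) x = x)
    (hcomp : ∀ {X Y Z : Cᵒᵖ} (i : X ⟶ Y) (j : Y ⟶ Z) (x : A X),
      r (i ≫ j) x = r j (r i x)) : PresheafOfModules.{u} R :=
  letI F : Cᵒᵖ ⥤ Ab.{u} :=
    { obj X := AddCommGrpCat.of (A X)
      map i := AddCommGrpCat.ofHom (r i).toAddMonoidHom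
      map_id X := by ext x; exact hid X x
      map_comp i j := by ext x; exact hcomp i j x }
  letI (X : Cᵒᵖ) : Module (R.obj X) (F.obj X) := inferInstanceAs (Module (R.obj X) (A X))
  PresheafOfModules.ofPresheaf F fun _ _ i a x => (r i).map_smulₛₗ a x

/-- A sheaf of modules from its modules of sections, for which gluing is known. -/
def ofSheaf {R : Sheaf J RingCat.{u}} (M : PresheafOfModules.{u} R.obj)
    (h : Presieve.IsSheaf J (M.presheaf ⋙ forget Ab.{u})) : SheafOfModules.{u} R where
  val := M
  isSheaf := (Presheaf.isSheaf_iff_isSheaf_forget J _ (forget Ab.{u})).2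
    ((isSheaf_iff_isSheaf_of_type _ _).2 h)

variable (R R' : Sheaf J RingCat.{u})

/-- An isomorphism of `R'` with a corner `e R e` of the sheaf of rings `R`, where `e` is an
idempotent section which locally generates `R` as a two-sided ideal, by an equation
`1 = e + β e α`. -/
structure Corner where
  app (X : Cᵒᵖ) : R'.obj.obj X →ₙ+* R.obj.obj X
  naturality {X Y : Cᵒᵖ} (i : X ⟶ Y) (a : R'.obj.obj X) :
    R.obj.map i (app X a) = app Y (R'.obj.map i a)
  injective (X : Cᵒᵖ) : Function.Injective (app X)
  exists_eq {X : Cᵒᵖ} (r : R.obj.obj X) : ∃ a, app X 1 * r * app X 1 = app X a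
  full (X : Cᵒᵖ) : ∃ T ∈ J X.unop, ∀ ⦃Y : C⦄ (f : Y ⟶ X.unop), T f →
    ∃ α β : R.obj.obj (op Y), app (op Y) 1 + β * app (op Y) 1 * α = 1

namespace Corner

variable {R R'} (κ : Corner R R')

/-- The idempotent. -/
def e (X : Cᵒᵖ) : R.obj.obj X := κ.app X 1

theorem e_mul_e (X : Cᵒᵖ) : κ.e X * κ.e X = κ.e X := by
  rw [e, ← map_mul, one_mul]

theorem e_mul_app {X : Cᵒᵖ} (a : R'.obj.obj X) : κ.e X * κ.app X a = κ.app X a := by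
  rw [e, ← map_mul, one_mul]

theorem app_mul_e {X : Cᵒᵖ} (a : R'.obj.obj X) : κ.app X a * κ.e X = κ.app X a := by
  rw [e, ← map_mul, mul_one]

theorem map_e {X Y : Cᵒᵖ} (i : X ⟶ Y) : R.obj.map i (κ.e X) = κ.e Y :=
  (κ.naturality i 1).trans (congrArg (κ.app Y) (map_one (R'.obj.map i).hom))

variable (M : SheafOfModules.{u} R)

/-- The sections `m` of `M` with `e m = m`. -/
def part (X : Cᵒᵖ) : AddSubgroup (M.val.obj X) where
  carrier := {m | κ.e X • m = m}
  add_mem' {_ _} hm hn := (smul_add _ _ _).trans (congrArg₂ (· + ·) hm hn)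
  zero_mem' := smul_zero _
  neg_mem' {_} hm := (smul_neg _ _).trans (congrArg Neg.neg hm)

variable {M} in
theorem part_ext {X : Cᵒᵖ} {m n : κ.part M X} (h : m.1 = n.1) : m = n := Subtype.ext h

instance (X : Cᵒᵖ) : Module (R'.obj.obj X) (κ.part M X) where
  smul a m := ⟨κ.app X a • m.1, by
    change κ.e X • κ.app X a • m.1 = κ.app X a • m.1
    rw [smul_smul, e_mul_app]⟩
  one_smul m := κ.part_ext m.2
  mul_smul a b m := κ.part_ext <| by
    change κ.app X (a * b) • m.1 = κ.app X a • κ.app X b • m.1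
    rw [map_mul, mul_smul]
  smul_zero a := κ.part_ext (smul_zero (κ.app X a))
  smul_add a m n := κ.part_ext (smul_add (κ.app X a) m.1 n.1)
  add_smul a b m := κ.part_ext <| by
    change κ.app X (a + b) • m.1 = κ.app X a • m.1 + κ.app X b • m.1
    rw [map_add, add_smul]
  zero_smul m := κ.part_ext <| by
    change κ.app X 0 • m.1 = 0
    rw [map_zero, zero_smul]

/-- Restriction of sections `m` with `e m = m`. -/
def partRes {X Y : Cᵒᵖ} (i : X ⟶ Y) : κ.part M X →ₛₗ[(R'.obj.map i).hom] κ.part M Y where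
  toFun m := ⟨M.val.restrictₛₗ i m.1, by
    have h := (M.val.restrictₛₗ i).map_smulₛₗ (κ.e X) m.1
    rw [show κ.e X • m.1 = m.1 from m.2] at h
    exact (h.trans (congrArg (· • M.val.restrictₛₗ i m.1) (κ.map_e i))).symm⟩
  map_add' m n := κ.part_ext ((M.val.restrictₛₗ i).map_add m.1 n.1)
  map_smul' a m := κ.part_ext (((M.val.restrictₛₗ i).map_smulₛₗ (κ.app X a) m.1).trans
    (congrArg (· • M.val.restrictₛₗ i m.1) (κ.naturality i a)))

/-- The sheaf of `R'`-modules `e M`. -/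
def obj : SheafOfModules.{u} R' :=
  ofSheaf (ofSections (fun X => κ.part M X) (fun i => κ.partRes M i)
    (fun _ m => κ.part_ext (restrict_id M.val m.1))
    (fun i j m => κ.part_ext (restrict_restrict M.val i j m.1).symm)) (by
      intro X T hT x hx
      let y : Presieve.FamilyOfElements (M.val.presheaf ⋙ forget Ab.{u}) T.arrows :=
        fun Y f hf => (x f hf : κ.part M (op Y)).1
      have hy : y.Compatible := fun Y₁ Y₂ Z g₁ g₂ f₁ f₂ h₁ h₂ h =>
        congrArg (Subtype.val : κ.part M (op Z) → _) (hx g₁ g₂ h₁ h₂ h)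
      obtain ⟨m, hm, hm'⟩ := isSheaf_types M T hT y hy
      have hem : κ.e (op X) • (show M.val.obj (op X) from m) = m := by
        refine eq_of_locally M (X := op X) hT fun Y f hf => ?_
        refine ((M.val.restrictₛₗ f.op).map_smulₛₗ (κ.e (op X)) m).trans ?_
        have h : M.val.restrictₛₗ f.op m = (x f hf : κ.part M (op Y)).1 := hm f hf
        rw [h]
        exact (congrArg (· • (x f hf : κ.part M (op Y)).1) (κ.map_e f.op)).trans
          (x f hf : κ.part M (op Y)).2
      exact ⟨(⟨m, hem⟩ : κ.part M (op X)), fun Y f hf => κ.part_ext (hm f hf),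
        fun n hn => κ.part_ext (hm' (n : κ.part M (op X)).1 fun Y f hf =>
          congrArg (Subtype.val : κ.part M (op Y) → _) (hn f hf))⟩)

/-- A section of `e M`, as a section of `M`. -/
def incl (X : Cᵒᵖ) : (κ.obj M).val.obj X →+ M.val.obj X := (κ.part M X).subtype

variable {M}

theorem incl_injective {X : Cᵒᵖ} {m n : (κ.obj M).val.obj X} (h : κ.incl M X m = κ.incl M X n) :
    m = n := Subtype.ext h

theorem e_smul_incl {X : Cᵒᵖ} (m : (κ.obj M).val.obj X) :
    κ.e X • κ.incl M X m = κ.incl M X m := m.2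

theorem incl_smul {X : Cᵒᵖ} (a : R'.obj.obj X) (m : (κ.obj M).val.obj X) :
    κ.incl M X (a • m) = κ.app X a • κ.incl M X m := rfl

theorem incl_res {X Y : Cᵒᵖ} (i : X ⟶ Y) (m : (κ.obj M).val.obj X) :
    κ.incl M Y ((κ.obj M).val.restrictₛₗ i m) = M.val.restrictₛₗ i (κ.incl M X m) := rfl

/-- The section `e r m` of `e M`. -/
def cut {X : Cᵒᵖ} (r : R.obj.obj X) : M.val.obj X →+ (κ.obj M).val.obj X where
  toFun m := (⟨(κ.e X * r) • m, by
    change κ.e X • (κ.e X * r) • m = (κ.e X * r) • m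
    rw [smul_smul, ← mul_assoc, e_mul_e]⟩ : κ.part M X)
  map_zero' := κ.part_ext (smul_zero _)
  map_add' m n := κ.part_ext (smul_add _ m n)

theorem incl_cut {X : Cᵒᵖ} (r : R.obj.obj X) (m : M.val.obj X) :
    κ.incl M X (κ.cut r m) = (κ.e X * r) • m := rfl

theorem cut_smul {X : Cᵒᵖ} (r s : R.obj.obj X) (m : M.val.obj X) :
    κ.cut r (s • m) = κ.cut (r * s) m :=
  κ.incl_injective (by rw [incl_cut, incl_cut, smul_smul, mul_assoc])

theorem res_cut {X Y : Cᵒᵖ} (i : X ⟶ Y) (r : R.obj.obj X) (m : M.val.obj X) :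
    (κ.obj M).val.restrictₛₗ i (κ.cut r m) = κ.cut (R.obj.map i r) (M.val.restrictₛₗ i m) :=
  κ.incl_injective (((M.val.restrictₛₗ i).map_smulₛₗ (κ.e X * r) m).trans
    (congrArg (· • M.val.restrictₛₗ i m) ((map_mul (R.obj.map i).hom _ _).trans
      (congrArg (· * _) (κ.map_e i)))))

/-- For a section of `e M`, multiplication by `e r` is the action of a section of `R'`. -/
theorem exists_cut_incl {X : Cᵒᵖ} (r : R.obj.obj X) : ∃ a : R'.obj.obj X,
    ∀ (M : SheafOfModules.{u} R) (m : (κ.obj M).val.obj X), κ.cut r (κ.incl M X m) = a • m := by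
  obtain ⟨a, ha⟩ := κ.exists_eq r
  refine ⟨a, fun M m => κ.incl_injective ?_⟩
  rw [incl_cut, incl_smul, ← ha, mul_smul (κ.app X 1 * r)]
  exact congrArg ((κ.app X 1 * r) • ·) (κ.e_smul_incl m).symm

theorem eq_cut_add {X : Cᵒᵖ} {α β : R.obj.obj X} (h : κ.app X 1 + β * κ.app X 1 * α = 1)
    (m : M.val.obj X) : m = κ.incl M X (κ.cut 1 m) + β • κ.incl M X (κ.cut α m) := by
  rw [incl_cut, incl_cut, smul_smul, ← add_smul, mul_one, ← mul_assoc]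
  exact (one_smul _ m).symm.trans (congrArg (· • m) h.symm)

/-- A section `m` of `M` is determined by the sections `e r m` of `e M`. -/
theorem ext_cut {X : Cᵒᵖ} {m n : M.val.obj X} (h : ∀ (Y : Cᵒᵖ) (i : X ⟶ Y) (r : R.obj.obj Y),
    κ.cut r (M.val.restrictₛₗ i m) = κ.cut r (M.val.restrictₛₗ i n)) : m = n := by
  obtain ⟨T, hT, hf⟩ := κ.full X
  refine eq_of_locally M hT fun Y f hTf => ?_
  obtain ⟨α, β, hαβ⟩ := hf f hTf
  rw [κ.eq_cut_add hαβ (M.val.restrictₛₗ f.op m), κ.eq_cut_add hαβ (M.val.restrictₛₗ f.op n), h, h]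

variable {M' : SheafOfModules.{u} R}

/-- A morphism of sheaves of modules from linear maps on sections. -/
def homMk {R : Sheaf J RingCat.{u}} {M M' : SheafOfModules.{u} R}
    (f : ∀ X, M.val.obj X →ₗ[R.obj.obj X] M'.val.obj X)
    (hf : ∀ {X Y : Cᵒᵖ} (i : X ⟶ Y) (x : M.val.obj X),
      f Y (M.val.restrictₛₗ i x) = M'.val.restrictₛₗ i (f X x)) : M ⟶ M' :=
  ⟨{ app := fun X => ModuleCat.ofHom (f X)
     naturality := fun i => ModuleCat.hom_ext (LinearMap.ext fun x => hf i x) }⟩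

/-- A morphism of sheaves of modules on sections. -/
def homApp {R : Sheaf J RingCat.{u}} {M M' : SheafOfModules.{u} R} (f : M ⟶ M') (X : Cᵒᵖ) :
    M.val.obj X →ₗ[R.obj.obj X] M'.val.obj X := (f.val.app X).hom

theorem homApp_res {R : Sheaf J RingCat.{u}} {M M' : SheafOfModules.{u} R} (f : M ⟶ M')
    {X Y : Cᵒᵖ} (i : X ⟶ Y) (x : M.val.obj X) :
    homApp f Y (M.val.restrictₛₗ i x) = M'.val.restrictₛₗ i (homApp f X x) :=
  PresheafOfModules.naturality_apply f.val i x

theorem hom_ext_app {R : Sheaf J RingCat.{u}} {M M' : SheafOfModules.{u} R} {f g : M ⟶ M'}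
    (h : ∀ X x, homApp f X x = homApp g X x) : f = g :=
  SheafOfModules.hom_ext (PresheafOfModules.hom_ext fun X =>
    ModuleCat.hom_ext (LinearMap.ext (h X)))

/-- The map `e M ⟶ e M'` induced by a map `M ⟶ M'`. -/
def map (f : M ⟶ M') : κ.obj M ⟶ κ.obj M' :=
  homMk (fun X =>
    { toFun := fun m => (⟨homApp f X m.1, ((homApp f X).map_smul (κ.e X) m.1).symm.trans
        (congrArg (homApp f X) m.2)⟩ : κ.part M' X)
      map_add' := fun m n => κ.part_ext ((homApp f X).map_add m.1 n.1)
      map_smul' := fun a m => κ.part_ext ((homApp f X).map_smul (κ.app X a) m.1) })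
    (fun i m => κ.part_ext (homApp_res f i m.1))

theorem map_cut (f : M ⟶ M') {X : Cᵒᵖ} (r : R.obj.obj X) (m : M.val.obj X) :
    homApp (κ.map f) X (κ.cut r m) = κ.cut r (homApp f X m) :=
  κ.incl_injective ((homApp f X).map_smul (κ.e X * r) m)

/-- The functor `M ↦ e M`. -/
def functor : SheafOfModules.{u} R ⥤ SheafOfModules.{u} R' where
  obj := κ.obj
  map := κ.map

instance : κ.functor.Additive where
  map_add {_ _ _ _} := hom_ext_app fun _ _ => κ.incl_injective rfl

instance : κ.functor.Faithful where
  map_injective {M M' f g} h := hom_ext_app fun X m => κ.ext_cut fun Y i r => by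
    rw [← homApp_res, ← homApp_res, ← map_cut, ← map_cut]
    exact congrArg (fun k : κ.obj M ⟶ κ.obj M' => homApp k Y _) h

section Full

variable (g : κ.obj M ⟶ κ.obj M')

/-- The graph of the extension to `M` of a map defined on `e M`. -/
def ExtRel {X : Cᵒᵖ} (m : M.val.obj X) (y : M'.val.obj X) : Prop :=
  ∀ (Y : Cᵒᵖ) (i : X ⟶ Y) (r : R.obj.obj Y),
    κ.cut r (M'.val.restrictₛₗ i y) = homApp g Y (κ.cut r (M.val.restrictₛₗ i m))

variable {κ g}

theorem ExtRel.unique {X : Cᵒᵖ} {m : M.val.obj X} {y y' : M'.val.obj X} (h : κ.ExtRel g m y)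
    (h' : κ.ExtRel g m y') : y = y' :=
  κ.ext_cut fun Y i r => (h Y i r).trans (h' Y i r).symm

theorem ExtRel.res {X Y : Cᵒᵖ} (j : X ⟶ Y) {m : M.val.obj X} {y : M'.val.obj X}
    (h : κ.ExtRel g m y) : κ.ExtRel g (M.val.restrictₛₗ j m) (M'.val.restrictₛₗ j y) := by
  intro Z i r
  rw [restrict_restrict, restrict_restrict]
  exact h Z (j ≫ i) r

theorem ExtRel.add {X : Cᵒᵖ} {m m' : M.val.obj X} {y y' : M'.val.obj X}
    (h : κ.ExtRel g m y) (h' : κ.ExtRel g m' y') : κ.ExtRel g (m + m') (y + y') := by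
  intro Z i r
  rw [LinearMap.map_add, LinearMap.map_add, AddMonoidHom.map_add, AddMonoidHom.map_add,
    LinearMap.map_add, h Z i r, h' Z i r]

theorem ExtRel.smul {X : Cᵒᵖ} (s : R.obj.obj X) {m : M.val.obj X} {y : M'.val.obj X}
    (h : κ.ExtRel g m y) : κ.ExtRel g (s • m) (s • y) := by
  intro Z i r
  rw [LinearMap.map_smulₛₗ, LinearMap.map_smulₛₗ, cut_smul, cut_smul, h Z i]

theorem ExtRel.of_incl {X : Cᵒᵖ} (m : (κ.obj M).val.obj X) :
    κ.ExtRel g (κ.incl M X m) (κ.incl M' X (homApp g X m)) := by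
  intro Y i r
  obtain ⟨a, ha⟩ := κ.exists_cut_incl r
  rw [← incl_res, ← incl_res, ha, ha, ← homApp_res, LinearMap.map_smul]

theorem ExtRel.of_locally {X : Cᵒᵖ} {m : M.val.obj X} {y : M'.val.obj X} {T : Sieve X.unop}
    (hT : T ∈ J X.unop) (h : ∀ ⦃Y : C⦄ (f : Y ⟶ X.unop), T f →
      κ.ExtRel g (M.val.restrictₛₗ f.op m) (M'.val.restrictₛₗ f.op y)) : κ.ExtRel g m y := by
  intro Y i r
  refine eq_of_locally (κ.obj M') (J.pullback_stable i.unop hT) fun Z f hf => ?_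
  have h' := h _ hf (op Z) (𝟙 _) (R.obj.map f.op r)
  rw [restrict_restrict, restrict_restrict] at h'
  rw [← homApp_res, res_cut, res_cut, restrict_restrict, restrict_restrict]
  have hi : (f ≫ i.unop).op ≫ 𝟙 (op Z) = i ≫ f.op := Category.comp_id _
  rw [hi] at h'
  exact h'

theorem ExtRel.exists (κ : Corner R R') (g : κ.obj M ⟶ κ.obj M') {X : Cᵒᵖ} (m : M.val.obj X) :
    ∃ y, κ.ExtRel g m y := by
  obtain ⟨T, hT, hf⟩ := κ.full X
  obtain ⟨y, hy⟩ := exists_glue (isSheaf_types M') hT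
    (fun Z f y => κ.ExtRel g (M.val.restrictₛₗ f.op m) (show M'.val.obj (op Z) from y))
    (fun Z W f k y hy => by
      have h := ExtRel.res k.op hy
      rw [restrict_restrict] at h
      exact h)
    (fun Z f y y' _ hy hy' => ExtRel.unique hy hy')
    (fun Y f hTf => by
      obtain ⟨α, β, hαβ⟩ := hf f hTf
      rw [κ.eq_cut_add hαβ (M.val.restrictₛₗ f.op m)]
      exact ⟨_, ExtRel.add (ExtRel.of_incl _) (ExtRel.smul β (ExtRel.of_incl _))⟩)
  exact ⟨y, ExtRel.of_locally hT hy⟩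

end Full

instance : κ.functor.Full where
  map_surjective {M M'} (g : κ.obj M ⟶ κ.obj M') := by
    choose y hy using fun X (m : M.val.obj X) => ExtRel.exists κ g m
    refine ⟨homMk (fun X =>
      { toFun := y X
        map_add' := fun m m' => ExtRel.unique (hy X _) (ExtRel.add (hy X m) (hy X m'))
        map_smul' := fun s m => ExtRel.unique (hy X _) (ExtRel.smul s (hy X m)) })
      (fun i m => ExtRel.unique (hy _ _) (ExtRel.res i (hy _ m))), ?_⟩
    refine hom_ext_app fun X m => κ.incl_injective ?_
    exact ExtRel.unique (hy X _) (ExtRel.of_incl m)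

end Corner

end Corner

/-! ### The quasi-inverse of the corner functor -/

section Induction

open CategoryTheory Limits Opposite

variable {C : Type u} [Category.{u} C] {J : GrothendieckTopology C}
variable {R R' : Sheaf J RingCat.{u}}

theorem isIso_of_bijective {M M' : SheafOfModules.{u} R} (f : M ⟶ M')
    (h : ∀ X, Function.Bijective (Corner.homApp f X)) : IsIso f := by
  have : IsIso ((PresheafOfModules.toPresheaf R.obj).map ((SheafOfModules.forget R).map f)) := by
    refine (NatTrans.isIso_iff_isIso_app _).2 fun X => ?_
    exact (ConcreteCategory.isIso_iff_bijective (C := Ab.{u}) _).2 (h X)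
  have : IsIso ((SheafOfModules.forget R).map f) :=
    isIso_of_reflects_iso _ (PresheafOfModules.toPresheaf R.obj)
  exact isIso_of_reflects_iso _ (SheafOfModules.forget R)

namespace Corner

variable (κ : Corner R R')

/-- The sheaf of rings `R`, as a module over itself. -/
abbrev self (R : Sheaf J RingCat.{u}) : SheafOfModules.{u} R := SheafOfModules.unit R

/-- Multiplication from the right by a section of `R` on the sheaf `R`. -/
def mulRight {X : Cᵒᵖ} (r : R.obj.obj X) : (self R).val.obj X →ₗ[R.obj.obj X] (self R).val.obj X :=
  LinearMap.toSpanSingleton (R.obj.obj X) (R.obj.obj X) r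

/-- A section of `e R`, as a section of `R`. -/
def inR {X : Cᵒᵖ} : (κ.obj (self R)).val.obj X →+ R.obj.obj X := κ.incl (self R) X

theorem inR_injective {X : Cᵒᵖ} {s t : (κ.obj (self R)).val.obj X} (h : κ.inR s = κ.inR t) :
    s = t := Subtype.ext h

theorem e_mul_inR {X : Cᵒᵖ} (s : (κ.obj (self R)).val.obj X) :
    κ.e X * κ.inR s = κ.inR s := s.2

theorem inR_smul {X : Cᵒᵖ} (a : R'.obj.obj X) (s : (κ.obj (self R)).val.obj X) :
    κ.inR (a • s) = κ.app X a * κ.inR s := rfl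

theorem inR_res {X Y : Cᵒᵖ} (i : X ⟶ Y) (s : (κ.obj (self R)).val.obj X) :
    κ.inR ((κ.obj (self R)).val.restrictₛₗ i s) = R.obj.map i (κ.inR s) := rfl

/-- Multiplication from the right by a section of `R` on `e R`. -/
def partMulRight {X : Cᵒᵖ} (r : R.obj.obj X) :
    (κ.obj (self R)).val.obj X →ₗ[R'.obj.obj X] (κ.obj (self R)).val.obj X where
  toFun s := (⟨mulRight r s.1, ((mulRight r).map_smul (κ.e X) s.1).symm.trans
    (congrArg (mulRight r) s.2)⟩ : κ.part (self R) X)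
  map_add' s t := κ.part_ext ((mulRight r).map_add s.1 t.1)
  map_smul' a s := κ.part_ext ((mulRight r).map_smul (κ.app X a) s.1)

theorem inR_partMulRight {X : Cᵒᵖ} (r : R.obj.obj X) (s : (κ.obj (self R)).val.obj X) :
    κ.inR (κ.partMulRight r s) = κ.inR s * r := rfl

theorem partMulRight_res {X Y : Cᵒᵖ} (i : X ⟶ Y) (r : R.obj.obj X)
    (s : (κ.obj (self R)).val.obj X) :
    (κ.obj (self R)).val.restrictₛₗ i (κ.partMulRight r s) =
      κ.partMulRight (R.obj.map i r) ((κ.obj (self R)).val.restrictₛₗ i s) :=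
  κ.inR_injective (map_mul (R.obj.map i).hom (κ.inR s) r)

variable (N : SheafOfModules.{u} R')

/-- The `R'`-linear maps from `e R` to `N` over the objects over `X`. -/
def indOn (X : Cᵒᵖ) : AddSubgroup (∀ (Y : Cᵒᵖ) (_ : X ⟶ Y),
    (κ.obj (self R)).val.obj Y →ₗ[R'.obj.obj Y] N.val.obj Y) where
  carrier := {f | ∀ (Y Z : Cᵒᵖ) (i : X ⟶ Y) (j : Y ⟶ Z) (s : (κ.obj (self R)).val.obj Y),
    N.val.restrictₛₗ j (f Y i s) = f Z (i ≫ j) ((κ.obj (self R)).val.restrictₛₗ j s)}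
  add_mem' hf hg Y Z i j s :=
    ((N.val.restrictₛₗ j).map_add _ _).trans (congrArg₂ (· + ·) (hf Y Z i j s) (hg Y Z i j s))
  zero_mem' _ _ _ j _ := (N.val.restrictₛₗ j).map_zero
  neg_mem' hf Y Z i j s :=
    ((N.val.restrictₛₗ j).map_neg _).trans (congrArg Neg.neg (hf Y Z i j s))

variable {N} in
theorem indOn_ext {X : Cᵒᵖ} {f g : κ.indOn N X} (h : ∀ Y i s, f.1 Y i s = g.1 Y i s) : f = g :=
  Subtype.ext (funext₂ fun Y i => LinearMap.ext (h Y i))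

theorem partMulRight_map {X Y Z : Cᵒᵖ} (i : X ⟶ Y) (j : Y ⟶ Z) (r : R.obj.obj X) :
    R.obj.map (i ≫ j) r = R.obj.map j (R.obj.map i r) :=
  ConcreteCategory.congr_hom (R.obj.map_comp i j) r

theorem partMulRight_one {X : Cᵒᵖ} (s : (κ.obj (self R)).val.obj X) :
    κ.partMulRight 1 s = s := κ.inR_injective (mul_one (κ.inR s))

theorem partMulRight_mul {X : Cᵒᵖ} (r r' : R.obj.obj X) (s : (κ.obj (self R)).val.obj X) :
    κ.partMulRight (r * r') s = κ.partMulRight r' (κ.partMulRight r s) :=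
  κ.inR_injective (mul_assoc (κ.inR s) r r').symm

theorem partMulRight_add {X : Cᵒᵖ} (r r' : R.obj.obj X) (s : (κ.obj (self R)).val.obj X) :
    κ.partMulRight (r + r') s = κ.partMulRight r s + κ.partMulRight r' s :=
  κ.inR_injective (mul_add (κ.inR s) r r')

theorem partMulRight_zero {X : Cᵒᵖ} (s : (κ.obj (self R)).val.obj X) :
    κ.partMulRight 0 s = 0 := κ.inR_injective (mul_zero (κ.inR s))

instance (X : Cᵒᵖ) : Module (R.obj.obj X) (κ.indOn N X) where
  smul r f := ⟨fun Y i => f.1 Y i ∘ₗ κ.partMulRight (R.obj.map i r), fun Y Z i j s => by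
    refine (f.2 Y Z i j _).trans (congrArg (f.1 Z (i ≫ j)) ?_)
    rw [partMulRight_res, partMulRight_map]⟩
  one_smul f := κ.indOn_ext fun Y i s => congrArg (f.1 Y i) <|
    (congrArg (κ.partMulRight · s) (map_one (R.obj.map i).hom)).trans (κ.partMulRight_one s)
  mul_smul r r' f := κ.indOn_ext fun Y i s => congrArg (f.1 Y i) <|
    (congrArg (κ.partMulRight · s) (map_mul (R.obj.map i).hom r r')).trans
      (κ.partMulRight_mul _ _ s)
  smul_zero _ := κ.indOn_ext fun _ _ _ => rfl
  smul_add _ _ _ := κ.indOn_ext fun _ _ _ => rfl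
  add_smul r r' f := κ.indOn_ext fun Y i s => (congrArg (f.1 Y i) <|
    (congrArg (κ.partMulRight · s) (map_add (R.obj.map i).hom r r')).trans
      (κ.partMulRight_add _ _ s)).trans ((f.1 Y i).map_add _ _)
  zero_smul f := κ.indOn_ext fun Y i s => (congrArg (f.1 Y i) <|
    (congrArg (κ.partMulRight · s) (map_zero (R.obj.map i).hom)).trans
      (κ.partMulRight_zero s)).trans (f.1 Y i).map_zero

theorem indOn_smul {X : Cᵒᵖ} (r : R.obj.obj X) (f : κ.indOn N X) (Y : Cᵒᵖ) (i : X ⟶ Y)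
    (s : (κ.obj (self R)).val.obj Y) :
    (r • f).1 Y i s = f.1 Y i (κ.partMulRight (R.obj.map i r) s) := rfl

/-- Restriction of `R'`-linear maps. -/
def indRes {X Y : Cᵒᵖ} (i : X ⟶ Y) : κ.indOn N X →ₛₗ[(R.obj.map i).hom] κ.indOn N Y where
  toFun f := ⟨fun Z j => f.1 Z (i ≫ j), fun Z W j k s => (f.2 Z W (i ≫ j) k s).trans
    (congrArg (fun l => f.1 W l _) (Category.assoc i j k))⟩
  map_add' _ _ := rfl
  map_smul' r f := κ.indOn_ext fun Z j s =>
    congrArg (fun t => f.1 Z (i ≫ j) (κ.partMulRight t s)) (partMulRight_map i j r)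

variable {N} in
/-- A section of the induced sheaf of modules, as a map of sheaves. -/
def toLocHom {X : Cᵒᵖ} (f : κ.indOn N X) : LocHom (κ.obj (self R)).val N.val X := ⟨f.1, f.2⟩

variable {N} in
theorem toLocHom_injective {X : Cᵒᵖ} {f g : κ.indOn N X} (h : κ.toLocHom f = κ.toLocHom g) :
    f = g := Subtype.ext (congrArg LocHom.app h)

/-- The sheaf of `R`-modules `Hom(e R, N)`. -/
def ind : SheafOfModules.{u} R :=
  ofSheaf (ofSections (fun X => κ.indOn N X) (fun i => κ.indRes N i)
    (fun X f => κ.indOn_ext fun Y i s => congrArg (fun l => f.1 Y l s) (Category.id_comp i))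
    (fun i j f => κ.indOn_ext fun Y k s => congrArg (fun l => f.1 Y l s)
      (Category.assoc i j k))) (by
      intro X T hT x hx
      obtain ⟨t, ht, ht'⟩ := LocHom.existsUnique_glue hT
        (fun Y f hf => κ.toLocHom (x f hf : κ.indOn N (op Y)))
        (fun Y f hf Z g => congrArg (fun z : κ.indOn N (op Z) => κ.toLocHom z)
          ((Presieve.compatible_iff_sieveCompatible x).1 hx f g hf).symm)
      exact ⟨(⟨t.app, t.naturality⟩ : κ.indOn N (op X)),
        fun Y f hf => κ.toLocHom_injective (ht f hf),
        fun z hz => κ.toLocHom_injective (ht' (κ.toLocHom (z : κ.indOn N (op X))) fun Y f hf =>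
          congrArg (fun w : κ.indOn N (op Y) => κ.toLocHom w) (hz f hf))⟩)

variable {N}

/-- A section of `e Hom(e R, N)`, as a linear map `e R ⟶ N`. -/
def indApp {X Y : Cᵒᵖ} (f : (κ.obj (κ.ind N)).val.obj X) (i : X ⟶ Y) :
    (κ.obj (self R)).val.obj Y →ₗ[R'.obj.obj Y] N.val.obj Y :=
  (κ.incl (κ.ind N) X f : κ.indOn N X).1 Y i

/-- The section `e` of `e R`. -/
def unitSection (X : Cᵒᵖ) : (κ.obj (self R)).val.obj X := κ.cut 1 (1 : R.obj.obj X)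

theorem inR_unitSection (X : Cᵒᵖ) : κ.inR (κ.unitSection X) = κ.e X :=
  (mul_one (κ.e X * 1)).trans (mul_one _)

theorem unitSection_res {X Y : Cᵒᵖ} (i : X ⟶ Y) :
    (κ.obj (self R)).val.restrictₛₗ i (κ.unitSection X) = κ.unitSection Y := by
  refine κ.inR_injective ?_
  rw [inR_res, inR_unitSection, inR_unitSection]
  exact κ.map_e i

theorem exists_coord {X : Cᵒᵖ} (s : (κ.obj (self R)).val.obj X) (r : R.obj.obj X) :
    ∃ a : R'.obj.obj X, κ.inR s * r * κ.e X = κ.app X a := by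
  obtain ⟨a, ha⟩ := κ.exists_eq (κ.inR s * r)
  refine ⟨a, Eq.trans ?_ ha⟩
  rw [← mul_assoc (κ.app X 1)]
  exact congrArg (· * r * κ.e X) (κ.e_mul_inR s).symm

/-- The coordinate `s ↦ s r e` on `e R`, with values in `R' = e R e`. -/
def coord {X : Cᵒᵖ} (r : R.obj.obj X) :
    (κ.obj (self R)).val.obj X →ₗ[R'.obj.obj X] R'.obj.obj X where
  toFun s := (κ.exists_coord s r).choose
  map_add' s t := κ.injective X <| by
    refine (κ.exists_coord (s + t) r).choose_spec.symm.trans (Eq.trans ?_ (map_add _ _ _).symm)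
    refine Eq.trans ?_ (congrArg₂ (· + ·) (κ.exists_coord s r).choose_spec
      (κ.exists_coord t r).choose_spec)
    rw [AddMonoidHom.map_add, add_mul, add_mul]
  map_smul' a s := κ.injective X <| by
    refine (κ.exists_coord (a • s) r).choose_spec.symm.trans (Eq.trans ?_ (map_mul _ _ _).symm)
    refine Eq.trans ?_ (congrArg (κ.app X a * ·) (κ.exists_coord s r).choose_spec)
    rw [inR_smul, mul_assoc, mul_assoc, mul_assoc]

theorem app_coord {X : Cᵒᵖ} (r : R.obj.obj X) (s : (κ.obj (self R)).val.obj X) :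
    κ.app X (κ.coord r s) = κ.inR s * r * κ.e X :=
  (κ.exists_coord s r).choose_spec.symm

theorem coord_res {X Y : Cᵒᵖ} (i : X ⟶ Y) (r : R.obj.obj X) (s : (κ.obj (self R)).val.obj X) :
    κ.coord (R.obj.map i r) ((κ.obj (self R)).val.restrictₛₗ i s) =
      R'.obj.map i (κ.coord r s) := by
  refine κ.injective Y ?_
  rw [app_coord, ← κ.naturality, app_coord, inR_res]
  refine Eq.symm ((map_mul (R.obj.map i).hom _ _).trans ?_)
  exact congrArg₂ (· * ·) (map_mul (R.obj.map i).hom _ _) (κ.map_e i)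

theorem coord_unitSection (X : Cᵒᵖ) : κ.coord 1 (κ.unitSection X) = 1 := by
  refine κ.injective X ?_
  rw [app_coord, inR_unitSection, mul_one, e_mul_e]
  rfl

/-- Sections of `e Hom(e R, N)` are determined by their value at `e`. -/
theorem indApp_eq {X Y : Cᵒᵖ} (f : (κ.obj (κ.ind N)).val.obj X) (i : X ⟶ Y)
    (s : (κ.obj (self R)).val.obj Y) :
    κ.indApp f i s = κ.coord 1 s • κ.indApp f i (κ.unitSection Y) := by
  have h : κ.indApp f i s = κ.indApp f i (κ.partMulRight (R.obj.map i (κ.e X)) s) :=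
    congrArg (fun g : κ.indOn N X => g.1 Y i s) (κ.e_smul_incl f).symm
  rw [h, ← LinearMap.map_smul, κ.map_e]
  refine congrArg (κ.indApp f i) (κ.inR_injective ?_)
  rw [inR_partMulRight, inR_smul, app_coord, inR_unitSection, mul_one, mul_assoc, e_mul_e]

/-- The isomorphism `e Hom(e R, N) ≅ N`. -/
def indHom (N : SheafOfModules.{u} R') : κ.obj (κ.ind N) ⟶ N :=
  homMk (fun X =>
    { toFun := fun f => κ.indApp f (𝟙 X) (κ.unitSection X)
      map_add' := fun _ _ => rfl
      map_smul' := fun a f => by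
        rw [RingHom.id_apply, ← LinearMap.map_smul]
        refine congrArg (κ.indApp f (𝟙 X)) (κ.inR_injective ?_)
        refine (κ.inR_partMulRight _ _).trans ?_
        rw [inR_smul, inR_unitSection, app_mul_e]
        refine Eq.trans ?_ (κ.e_mul_app a)
        exact congrArg (κ.e X * ·) (ConcreteCategory.congr_hom (R.obj.map_id X) (κ.app X a)) })
    (fun {X Y} i f => by
      refine Eq.trans ?_ ((κ.incl (κ.ind N) X f : κ.indOn N X).2 X Y (𝟙 X) i
        (κ.unitSection X)).symm
      refine congrArg₂ (fun l s => κ.indApp f l s) ?_ (κ.unitSection_res i).symm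
      exact (Category.comp_id i).trans (Category.id_comp i).symm)

instance (N : SheafOfModules.{u} R') : IsIso (κ.indHom N) := by
  refine isIso_of_bijective _ fun X => ⟨?_, fun n => ?_⟩
  · intro f g h
    refine κ.incl_injective (κ.indOn_ext fun Y i s => ?_)
    refine (κ.indApp_eq f i s).trans (Eq.trans ?_ (κ.indApp_eq g i s).symm)
    have h' (f : (κ.obj (κ.ind N)).val.obj X) : κ.indApp f i (κ.unitSection Y) =
        N.val.restrictₛₗ i (homApp (κ.indHom N) X f) := by
      refine Eq.symm (((κ.incl (κ.ind N) X f : κ.indOn N X).2 X Y (𝟙 X) i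
        (κ.unitSection X)).trans ?_)
      exact congrArg₂ (fun l s => κ.indApp f l s) (Category.id_comp i) (κ.unitSection_res i)
    rw [h', h', h]
  · let f : κ.indOn N X := ⟨fun Y i => LinearMap.toSpanSingleton _ _ (N.val.restrictₛₗ i n) ∘ₗ
      κ.coord 1, fun Y Z i j s => by
        refine ((N.val.restrictₛₗ j).map_smulₛₗ _ _).trans ?_
        refine congrArg₂ (· • ·) ?_ (restrict_restrict N.val i j n)
        refine (κ.coord_res j 1 s).symm.trans ?_
        exact congrArg (fun r => κ.coord r _) (map_one (R.obj.map j).hom)⟩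
    have hf : κ.e X • f = f := κ.indOn_ext fun Y i s => by
      rw [indOn_smul]
      refine congrArg (· • N.val.restrictₛₗ i n) (κ.injective Y ?_)
      change κ.app Y (κ.coord 1 _) = κ.app Y (κ.coord 1 s)
      rw [app_coord, app_coord, inR_partMulRight, κ.map_e, mul_one, mul_one, mul_assoc, e_mul_e]
    refine ⟨(⟨f, hf⟩ : κ.part (κ.ind N) X), ?_⟩
    change κ.coord 1 (κ.unitSection X) • N.val.restrictₛₗ (𝟙 X) n = n
    rw [coord_unitSection, one_smul, restrict_id]

instance : κ.functor.EssSurj where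
  mem_essImage N := ⟨κ.ind N, ⟨(asIso (κ.indHom N) : κ.obj (κ.ind N) ≅ N)⟩⟩

instance : κ.functor.IsEquivalence where

end Corner

end Induction

/-! ### Corners and finite presentation -/

section FinitePresentation

open CategoryTheory Limits Opposite

variable {C : Type u} [Category.{u} C] {J : GrothendieckTopology C}
variable {R R' : Sheaf J RingCat.{u}}

theorem HasFiniteCoordinates.of_two {T : SheafOfModules.{u} R} (p₀ p₁ : T ⟶ SheafOfModules.unit R)
    (i₀ i₁ : SheafOfModules.unit R ⟶ T) (h : p₀ ≫ i₀ + p₁ ≫ i₁ = 𝟙 T) :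
    HasFiniteCoordinates T := by
  refine ⟨Option PUnit, inferInstance, fun k => k.elim p₀ fun _ => p₁,
    fun k => k.elim i₀ fun _ => i₁, ?_⟩
  rw [Fintype.sum_option, Fintype.sum_unique]
  exact h

theorem HasFiniteCoordinates.unit : HasFiniteCoordinates (SheafOfModules.unit R) :=
  .of_two (𝟙 _) 0 (𝟙 _) 0 (by rw [zero_comp, add_zero, Category.comp_id])

section

variable {M : SheafOfModules.{u} R}

theorem isFinitePresentation_of_locally (h : ∀ X : C, ∃ T ∈ J X, ∀ ⦃Y : C⦄ (f : Y ⟶ X), T f →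
    IsFinitelyPresented (M.over Y)) : M.IsFinitePresentation := by
  let I : Type u := {Y : C // IsFinitelyPresented (M.over Y)}
  let X : I → C := Subtype.val
  have hX : J.CoversTop X := fun W => by
    obtain ⟨T, hT, hf⟩ := h W
    exact J.superset_covering (fun Y f hTf => ⟨⟨Y, hf f hTf⟩, ⟨𝟙 Y⟩⟩) hT
  let σ := @SheafOfModules.QuasicoherentData.mk C _ J R _ _ M I X hX fun i => i.2.choose
  exact @SheafOfModules.IsFinitePresentation.mk C _ J R _ _ M
    ⟨σ, @SheafOfModules.QuasicoherentData.IsFinitePresentation.mk C _ J R _ _ M σ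
      fun i => i.2.choose_spec⟩

theorem exists_isFinitelyPresented_over [HasPullbacks C] (hM : M.IsFinitePresentation) (X : C) :
    ∃ T ∈ J X, ∀ ⦃Y : C⦄ (f : Y ⟶ X), T f → IsFinitelyPresented (M.over Y) := by
  obtain ⟨σ, hσ⟩ := hM.exists_quasicoherentData
  refine ⟨_, σ.coversTop X, fun Y f hf => ?_⟩
  obtain ⟨i, ⟨g⟩⟩ := hf
  have : (SheafOfModules.overMap R g).Additive := ⟨fun {_ _ _ _} => rfl⟩
  have h : IsFinitelyPresented (M.over (σ.X i)) := ⟨σ.presentation i, hσ.isFinite_presentation i⟩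
  exact (h.map (SheafOfModules.overMap R g) HasFiniteCoordinates.unit).of_iso
    ((SheafOfModules.overFunctorMap R g).app M)

end

namespace Corner

variable (κ : Corner R R')

/-- The coordinate `s ↦ s r e` on the sheaf `e R`. -/
def coordHom (r : ∀ X, R.obj.obj X) (hr : ∀ {X Y} (i : X ⟶ Y), R.obj.map i (r X) = r Y) :
    κ.obj (self R) ⟶ self R' :=
  homMk (fun X => κ.coord (r X)) fun i s =>
    (congrArg (fun t => κ.coord t _) (hr i)).symm.trans (κ.coord_res i (r _) s)

/-- The map `a ↦ a e r` to the sheaf `e R`. -/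
def genHom (r : ∀ X, R.obj.obj X) (hr : ∀ {X Y} (i : X ⟶ Y), R.obj.map i (r X) = r Y) :
    self R' ⟶ κ.obj (self R) :=
  homMk (fun X => LinearMap.toSpanSingleton (R'.obj.obj X) _
      (κ.partMulRight (r X) (κ.unitSection X))) fun {X Y} i a => by
    refine Eq.trans ?_ (((κ.obj (self R)).val.restrictₛₗ i).map_smulₛₗ a _).symm
    rw [partMulRight_res, hr, unitSection_res]
    rfl

theorem inR_genHom (r : ∀ X, R.obj.obj X) (hr : ∀ {X Y} (i : X ⟶ Y), R.obj.map i (r X) = r Y)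
    {X : Cᵒᵖ} (a : R'.obj.obj X) :
    κ.inR (homApp (κ.genHom r hr) X a) = κ.app X a * r X := by
  refine (κ.inR_smul a _).trans ?_
  rw [inR_partMulRight, inR_unitSection, ← mul_assoc, app_mul_e]

theorem map_one_res {X Y : Cᵒᵖ} (i : X ⟶ Y) : R.obj.map i (1 : R.obj.obj X) = 1 :=
  map_one (R.obj.map i).hom

theorem genHom_coordHom : κ.genHom (fun _ => 1) map_one_res ≫ κ.coordHom (fun _ => 1) map_one_res =
    𝟙 (self R') := by
  refine hom_ext_app fun X a => κ.injective X ?_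
  refine (κ.app_coord 1 (homApp (κ.genHom (fun _ => 1) map_one_res) X a)).trans ?_
  refine (congrArg (· * 1 * κ.e X) (κ.inR_genHom _ map_one_res a)).trans ?_
  rw [mul_one, mul_one]
  exact κ.app_mul_e a

/-- If the equation `1 = e + β e α` holds globally, then `e R` is a direct summand of a free sheaf
of modules of rank two. -/
theorem hasFiniteCoordinates (α β : ∀ X, R.obj.obj X)
    (hα : ∀ {X Y} (i : X ⟶ Y), R.obj.map i (α X) = α Y)
    (hβ : ∀ {X Y} (i : X ⟶ Y), R.obj.map i (β X) = β Y)
    (h : ∀ X, κ.app X 1 + β X * κ.app X 1 * α X = 1) : HasFiniteCoordinates (κ.obj (self R)) := by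
  refine .of_two (κ.coordHom (fun _ => 1) map_one_res) (κ.coordHom β hβ)
    (κ.genHom (fun _ => 1) map_one_res) (κ.genHom α hα) (hom_ext_app fun X s => κ.inR_injective ?_)
  refine (κ.inR.map_add _ _).trans ?_
  refine (congrArg₂ (· + ·) (κ.inR_genHom _ map_one_res _) (κ.inR_genHom α hα _)).trans ?_
  refine (congrArg₂ (· + ·) (congrArg (· * _) (κ.app_coord 1 s))
    (congrArg (· * _) (κ.app_coord (β X) s))).trans ?_
  rw [mul_one, mul_one, mul_assoc (κ.inR s), mul_assoc (κ.inR s), ← mul_add]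
  exact (congrArg (κ.inR s * ·) (h X)).trans (mul_one _)

/-- The restriction of a corner to the objects over `X`. -/
def restrict (X : C) : Corner (R.over X) (R'.over X) where
  app W := κ.app (op W.unop.left)
  naturality i a := κ.naturality i.unop.left.op a
  injective W := κ.injective (op W.unop.left)
  exists_eq {W} r := κ.exists_eq (X := op W.unop.left) r
  full W := by
    obtain ⟨T, hT, h⟩ := κ.full (op W.unop.left)
    exact ⟨(Sieve.overEquiv W.unop).symm T, J.overEquiv_symm_mem_over W.unop T hT,
      fun V f hf => h f.left ((Sieve.overEquiv_symm_iff T f).1 hf)⟩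

/-- The functor `M ↦ e M` is compatible with restriction. -/
def overHom (M : SheafOfModules.{u} R) (X : C) :
    (κ.obj M).over X ⟶ (κ.restrict X).obj (M.over X) :=
  homMk (fun W =>
    { toFun := fun m => (⟨(show κ.part M (op W.unop.left) from m).1,
        (show κ.part M (op W.unop.left) from m).2⟩ : (κ.restrict X).part (M.over X) W)
      map_add' := fun _ _ => rfl
      map_smul' := fun _ _ => rfl }) fun _ _ => rfl

instance (M : SheafOfModules.{u} R) (X : C) : IsIso (κ.overHom M X) :=
  isIso_of_bijective _ fun W => ⟨fun _ _ h => κ.part_ext (congrArg (fun k =>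
    (show (κ.restrict X).part (M.over X) W from k).1) h),
      fun m => ⟨(⟨(show (κ.restrict X).part (M.over X) W from m).1,
        (show (κ.restrict X).part (M.over X) W from m).2⟩ : κ.part M (op W.unop.left)), rfl⟩⟩

/-- The isomorphism `(e M)|_X ≅ e (M|_X)`. -/
def overIso (M : SheafOfModules.{u} R) (X : C) :
    (κ.obj M).over X ≅ (κ.restrict X).obj (M.over X) := asIso (κ.overHom M X)

variable [HasPullbacks C] {M : SheafOfModules.{u} R}

/-- Finite presentation passes from `M` to `e M`, since the equation `1 = e + β e α` makes `e R`
locally a direct summand of a free sheaf of modules of rank two. -/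
theorem isFinitePresentation_obj (hM : M.IsFinitePresentation) :
    (κ.obj M).IsFinitePresentation := by
  refine isFinitePresentation_of_locally fun X => ?_
  obtain ⟨T₁, hT₁, h₁⟩ := exists_isFinitelyPresented_over hM X
  obtain ⟨T₂, hT₂, h₂⟩ := κ.full (op X)
  refine ⟨T₁ ⊓ T₂, J.intersection_covering hT₁ hT₂, fun Y f hf => ?_⟩
  obtain ⟨α, β, h⟩ := h₂ f hf.2
  have hm (r : R.obj.obj (op Y)) {V W : (Over Y)ᵒᵖ} (i : V ⟶ W) :
      R.obj.map i.unop.left.op (R.obj.map V.unop.hom.op r) = R.obj.map W.unop.hom.op r :=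
    (partMulRight_map _ _ r).symm.trans (congrArg (fun l => R.obj.map l r)
      (congrArg Quiver.Hom.op (Over.w i.unop)))
  have hc : HasFiniteCoordinates ((κ.restrict Y).obj (self (R.over Y))) :=
    (κ.restrict Y).hasFiniteCoordinates (fun V => R.obj.map V.unop.hom.op α)
      (fun V => R.obj.map V.unop.hom.op β) (hm α) (hm β) fun V => by
        have h' := congrArg (R.obj.map V.unop.hom.op).hom h
        rw [RingHom.map_one, RingHom.map_add, RingHom.map_mul, RingHom.map_mul] at h'
        refine Eq.trans ?_ h'
        have he : R.obj.map V.unop.hom.op (κ.app (op Y) 1) = κ.app (op V.unop.left) 1 :=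
          κ.map_e _
        exact (congrArg (fun e => e + R.obj.map V.unop.hom.op β * e *
          R.obj.map V.unop.hom.op α) he).symm
  exact ((h₁ f hf.1).map (κ.restrict Y).functor hc).of_iso (κ.overIso M Y).symm

/-- Finite presentation passes from `e M` to `M`, since the quasi-inverse functor maps `R'` to a
direct summand of `R`. -/
theorem isFinitePresentation_of_obj (hM : (κ.obj M).IsFinitePresentation) :
    M.IsFinitePresentation := by
  refine isFinitePresentation_of_locally fun X => ?_
  obtain ⟨T, hT, h⟩ := exists_isFinitelyPresented_over hM X
  refine ⟨T, hT, fun Y f hf => ?_⟩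
  let Φ := (κ.restrict Y).functor
  have h' : IsFinitelyPresented (Φ.obj (M.over Y)) := (h f hf).of_iso (κ.overIso M Y)
  let ε := Φ.asEquivalence.unitIso
  have hc : HasFiniteCoordinates (Φ.inv.obj (self (R'.over Y))) := by
    let ε₁ : self (R.over Y) ≅ Φ.inv.obj ((κ.restrict Y).obj (self (R.over Y))) :=
      ε.app (self (R.over Y))
    refine (HasFiniteCoordinates.unit (R := R.over Y)).retract
      (Φ.inv.map ((κ.restrict Y).genHom (fun _ => 1) map_one_res) ≫ ε₁.inv)
      (ε₁.hom ≫ Φ.inv.map ((κ.restrict Y).coordHom (fun _ => 1) map_one_res)) ?_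
    rw [Category.assoc, Iso.inv_hom_id_assoc, ← Functor.map_comp, genHom_coordHom,
      CategoryTheory.Functor.map_id]
  have : Φ.asEquivalence.functor.Additive := inferInstanceAs (κ.restrict Y).functor.Additive
  have : Φ.inv.Additive := Φ.asEquivalence.inverse_additive
  exact (h'.map Φ.inv hc).of_iso (ε.app (M.over Y)).symm

end Corner

end FinitePresentation

/-! ### Corners and Morita equivalence -/

section Morita

open CategoryTheory Limits Opposite AlgebraicGeometry TopologicalSpace

theorem isFinitePresentation_of_iso {C : Type u} [Category.{u} C] [HasPullbacks C]
    {J : GrothendieckTopology C} {R : Sheaf J RingCat.{u}}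
    [∀ X, HasWeakSheafify (J.over X) AddCommGrpCat.{u}]
    [∀ X, (J.over X).WEqualsLocallyBijective AddCommGrpCat.{u}]
    {M N : SheafOfModules.{u} R} (f : M ≅ N) (hM : M.IsFinitePresentation) :
    N.IsFinitePresentation := by
  refine isFinitePresentation_of_locally fun X => ?_
  obtain ⟨T, hT, h⟩ := exists_isFinitelyPresented_over hM X
  exact ⟨T, hT, fun Z g hg => (h g hg).of_iso ((SheafOfModules.overFunctor _ Z).mapIso f)⟩

variable {S : Scheme.{u}} {A A' : AlgSheaf S}

namespace Coh

theorem hom_ext_app {X Y : Coh A} {f g : X ⟶ Y} (h : ∀ (W : (Over X.U)ᵒᵖ) (x : X.M.val.obj W),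
    Corner.homApp (Hom.map f) W x = Corner.homApp (Hom.map g) W x) : f = g :=
  Hom.ext (Corner.hom_ext_app h)

theorem homApp_comp {X Y Z : Coh A} (f : Hom X Y) (g : Hom Y Z) (W : (Over X.U)ᵒᵖ)
    (x : X.M.val.obj W) : Corner.homApp (comp f g).map W x =
      Corner.homApp g.map (op ((Over.map (homOfLE f.le)).obj W.unop))
        (Corner.homApp f.map W x) := rfl

section

variable {U : Opens S} {M N : SheafOfModules.{u} (A.right.over U)} {hM : M.IsFinitePresentation}
  {hN : N.IsFinitePresentation}

/-- A homomorphism of modules over an open subset, in the fibered category. -/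
def ofHom (f : M ⟶ N) : Hom (⟨U, M, hM⟩ : Coh A) ⟨U, N, hN⟩ :=
  ⟨le_rfl, f ≫ (id ⟨U, N, hN⟩).map⟩

theorem homApp_ofHom (f : M ⟶ N) (W : (Over U)ᵒᵖ) (x : M.val.obj W) :
    Corner.homApp (ofHom (hM := hM) (hN := hN) f).map W x = Corner.homApp f W x := rfl

theorem homApp_ofHom_map (f : M ⟶ N) (W : (Over U)ᵒᵖ) (x : M.val.obj W) :
    Corner.homApp (ofHom (hM := hM) (hN := hN) f).map
      (op ((Over.map (homOfLE (le_refl U))).obj W.unop)) x = Corner.homApp f W x := rfl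

theorem homApp_id (W : (Over U)ᵒᵖ) (x : M.val.obj W) :
    Corner.homApp (id (⟨U, M, hM⟩ : Coh A)).map W x = x := rfl

theorem ofHom_comp {f : M ⟶ N} {g : N ⟶ M} (h : f ≫ g = 𝟙 M) :
    comp (ofHom (hM := hM) (hN := hN) f) (ofHom g) = id ⟨U, M, hM⟩ := by
  refine hom_ext_app fun W x => ?_
  have h' : Corner.homApp g W (Corner.homApp f W x) = x :=
    congrArg (fun k => Corner.homApp k W x) h
  refine (homApp_comp (ofHom (hM := hM) (hN := hN) f) (ofHom g) W x).trans ?_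
  refine (homApp_ofHom_map (hM := hN) (hN := hM) g W _).trans ?_
  refine (congrArg (Corner.homApp g W) (homApp_ofHom (hM := hM) (hN := hN) f W x)).trans ?_
  exact h'.trans (homApp_id (hM := hM) W x).symm

/-- An isomorphism of modules over an open subset, in the fibered category. -/
def isoMk (f : M ≅ N) (hM : M.IsFinitePresentation) (hN : N.IsFinitePresentation) :
    (⟨U, M, hM⟩ : Coh A) ≅ ⟨U, N, hN⟩ where
  hom := ofHom f.hom
  inv := ofHom f.inv
  hom_inv_id := ofHom_comp f.hom_inv_id
  inv_hom_id := ofHom_comp f.inv_hom_id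

end

end Coh

namespace Corner

variable (κ : Corner A.right A'.right)

/-- The functor `M ↦ e M` is compatible with restriction to smaller open subsets. -/
def restrictHom {U V : Opens S} (h : U ≤ V) (M : SheafOfModules.{u} (A.right.over V)) :
    (κ.restrict U).obj ((SheafOfModules.overMap A.right (homOfLE h)).obj M) ⟶
      (SheafOfModules.overMap A'.right (homOfLE h)).obj ((κ.restrict V).obj M) :=
  homMk (fun W =>
    { toFun := fun m =>
        (⟨m.1, m.2⟩ : (κ.restrict V).part M (op ((Over.map (homOfLE h)).obj W.unop)))
      map_add' := fun _ _ => rfl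
      map_smul' := fun _ _ => rfl }) fun _ _ => rfl

/-- The functor `M ↦ e M` commutes with restriction to smaller open subsets. -/
def restrictIso {U V : Opens S} (h : U ≤ V) (M : SheafOfModules.{u} (A.right.over V)) :
    (κ.restrict U).obj ((SheafOfModules.overMap A.right (homOfLE h)).obj M) ≅
      (SheafOfModules.overMap A'.right (homOfLE h)).obj ((κ.restrict V).obj M) where
  hom := κ.restrictHom h M
  inv := homMk (fun W =>
    { toFun := fun m => (⟨(show (κ.restrict V).part M
          (op ((Over.map (homOfLE h)).obj W.unop)) from m).1,
        (show (κ.restrict V).part M (op ((Over.map (homOfLE h)).obj W.unop)) from m).2⟩ :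
          (κ.restrict U).part ((SheafOfModules.overMap A.right (homOfLE h)).obj M) W)
      map_add' := fun _ _ => rfl
      map_smul' := fun _ _ => rfl }) fun _ _ => rfl
  hom_inv_id := hom_ext_app fun _ _ => rfl
  inv_hom_id := hom_ext_app fun _ _ => rfl

/-- The finitely presented module `e M`. -/
def cohObj (X : Coh A) : Coh A' :=
  ⟨X.U, (κ.restrict X.U).obj X.M, (κ.restrict X.U).isFinitePresentation_obj
    X.isFinitePresentation⟩

/-- The map `e M ⟶ e M'` induced by a map of finitely presented modules. -/
def cohMap {X Y : Coh A} (f : Coh.Hom X Y) : Coh.Hom (κ.cohObj X) (κ.cohObj Y) :=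
  ⟨f.le, (κ.restrict X.U).map f.map ≫ κ.restrictHom f.le Y.M⟩

/-- A section of the finitely presented module `e M`, as a section of `M`. -/
def cohIncl (X : Coh A) (W : (Over X.U)ᵒᵖ) (x : (κ.cohObj X).M.val.obj W) : X.M.val.obj W :=
  (κ.restrict X.U).incl X.M W x

theorem cohIncl_injective (X : Coh A) (W : (Over X.U)ᵒᵖ) : Function.Injective (κ.cohIncl X W) :=
  fun _ _ h => (κ.restrict X.U).incl_injective h

theorem cohIncl_cohMap {X Y : Coh A} (f : Coh.Hom X Y) (W : (Over X.U)ᵒᵖ)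
    (x : (κ.cohObj X).M.val.obj W) :
    κ.cohIncl Y (op ((Over.map (homOfLE f.le)).obj W.unop)) (homApp (κ.cohMap f).map W x) =
      homApp f.map W (κ.cohIncl X W x) := rfl

theorem cohMap_comp {X Y Z : Coh A} (f : Coh.Hom X Y) (g : Coh.Hom Y Z) :
    κ.cohMap (Coh.comp f g) = Coh.comp (κ.cohMap f) (κ.cohMap g) := by
  refine Coh.hom_ext_app fun W x => κ.cohIncl_injective Z _ ?_
  let W' : (Over Y.U)ᵒᵖ := op ((Over.map (homOfLE f.le)).obj W.unop)
  refine (κ.cohIncl_cohMap (Coh.comp f g) W x).trans ?_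
  refine (Coh.homApp_comp f g W _).trans ?_
  refine (congrArg (fun y : Y.M.val.obj W' => homApp g.map W' y)
    (κ.cohIncl_cohMap f W x).symm).trans ?_
  refine (κ.cohIncl_cohMap g W' (homApp (κ.cohMap f).map W x)).symm.trans ?_
  exact congrArg (κ.cohIncl Z _) (Coh.homApp_comp (κ.cohMap f) (κ.cohMap g) W x).symm

theorem cohMap_injective {X Y : Coh A} {f g : Coh.Hom X Y} (h : κ.cohMap f = κ.cohMap g) :
    f = g := by
  have h' : (κ.restrict X.U).map f.map ≫ (κ.restrictIso f.le Y.M).hom =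
      (κ.restrict X.U).map g.map ≫ (κ.restrictIso f.le Y.M).hom := Coh.Hom.ext_iff.1 h
  exact Coh.Hom.ext ((κ.restrict X.U).functor.map_injective
    ((Iso.cancel_iso_hom_right _ _ _).1 h'))

theorem cohMap_surjective {X Y : Coh A} (g : Coh.Hom (κ.cohObj X) (κ.cohObj Y)) :
    ∃ f, κ.cohMap f = g := by
  have hle : X.U ≤ Y.U := g.le
  obtain ⟨f, hf⟩ := (κ.restrict X.U).functor.map_surjective
    (g.map ≫ (κ.restrictIso hle Y.M).inv)
  refine ⟨(⟨hle, f⟩ : Coh.Hom X Y), Coh.Hom.ext ?_⟩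
  exact (congrArg (· ≫ (κ.restrictIso hle Y.M).hom) hf).trans
    ((Category.assoc _ _ _).trans ((congrArg (_ ≫ ·) (Iso.inv_hom_id _)).trans
      (Category.comp_id _)))

/-- The functor `M ↦ e M` on the fibered category of finitely presented modules. -/
def cohFunctor : Coh A ⥤ Coh A' where
  obj := κ.cohObj
  map f := κ.cohMap f
  map_id X := Coh.hom_ext_app fun W x => κ.cohIncl_injective X _
    ((κ.cohIncl_cohMap (Coh.id X) W x).trans rfl)
  map_comp f g := κ.cohMap_comp f g

theorem cohFunctor_faithful : κ.cohFunctor.Faithful where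
  map_injective h := κ.cohMap_injective h

theorem cohFunctor_full : κ.cohFunctor.Full where
  map_surjective g := κ.cohMap_surjective g

theorem cohFunctor_essSurj : κ.cohFunctor.EssSurj where
  mem_essImage Y := by
    let κ' := κ.restrict Y.U
    let f : κ'.obj (κ'.ind Y.M) ≅ Y.M := asIso (κ'.indHom Y.M)
    have hM : (κ'.obj (κ'.ind Y.M)).IsFinitePresentation :=
      isFinitePresentation_of_iso.{u} (M := Y.M) f.symm Y.isFinitePresentation
    exact ⟨⟨Y.U, κ'.ind Y.M, κ'.isFinitePresentation_of_obj hM⟩,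
      ⟨Coh.isoMk f _ Y.isFinitePresentation⟩⟩

theorem cohIncl_smul (h : ∀ (U : (Opens S)ᵒᵖ) (r : S.ringCatSheaf.obj.obj U),
    κ.app U (A'.scalar U r) = A.scalar U r * κ.app U 1) (X : Coh A)
    (r : S.ringCatSheaf.obj.obj (op X.U)) (W : (Over X.U)ᵒᵖ) (x : (κ.cohObj X).M.val.obj W) :
    κ.cohIncl X W ((κ.cohObj X).smul r W x) = X.smul r W (κ.cohIncl X W x) := by
  let s := S.ringCatSheaf.obj.map W.unop.hom.op r
  let a : (A.right.over X.U).obj.obj W := A.scalar (op W.unop.left) s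
  refine (congrArg (fun b : (A.right.over X.U).obj.obj W => b • κ.cohIncl X W x)
    (h (op W.unop.left) s)).trans ?_
  refine (mul_smul a ((κ.restrict X.U).e W) (κ.cohIncl X W x)).trans ?_
  exact congrArg (a • ·) ((κ.restrict X.U).e_smul_incl x)

theorem cohMap_isSMul (h : ∀ (U : (Opens S)ᵒᵖ) (r : S.ringCatSheaf.obj.obj U),
    κ.app U (A'.scalar U r) = A.scalar U r * κ.app U 1) {X Y : Coh A} (f g : Coh.Hom X Y)
    (r : S.ringCatSheaf.obj.obj (op X.U)) (hfg : Coh.IsSMul (X := X) (Y := Y) r f g) :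
    Coh.IsSMul (X := κ.cohObj X) (Y := κ.cohObj Y)
      (S.ringCatSheaf.obj.map (homOfLE (le_refl X.U)).op r) (κ.cohMap f) (κ.cohMap g) := by
  intro W x
  refine κ.cohIncl_injective Y _ ?_
  refine (κ.cohIncl_cohMap g W x).trans ((hfg W (κ.cohIncl X W x)).trans ?_)
  refine Eq.trans ?_ (κ.cohIncl_cohMap f W _).symm
  have hr : S.ringCatSheaf.obj.map (homOfLE (le_refl X.U)).op r = r :=
    ConcreteCategory.congr_hom (S.ringCatSheaf.obj.map_id (op X.U)) r
  refine congrArg (homApp f.map W) ?_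
  refine Eq.trans ?_ (κ.cohIncl_smul h X _ W x).symm
  exact congrArg (fun r => X.smul r W (κ.cohIncl X W x)) hr.symm

/-- Sheaves of algebras related by a corner compatible with the structures of algebras are Morita
equivalent. -/
theorem moritaEquivalent (h : ∀ (U : (Opens S)ᵒᵖ) (r : S.ringCatSheaf.obj.obj U),
    κ.app U (A'.scalar U r) = A.scalar U r * κ.app U 1) : MoritaEquivalent A A' := by
  have := κ.cohFunctor_faithful
  have := κ.cohFunctor_full
  have := κ.cohFunctor_essSurj
  refine ⟨κ.cohFunctor, { }, fun _ => rfl, fun X Y f g => ?_, fun X Y r f g hfg W x => ?_⟩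
  · exact Coh.hom_ext_app fun W x => rfl
  · exact κ.cohMap_isSMul h f g r hfg W x

end Corner

end Morita

/-! ### Split bases -/

section SplitBasis

open CategoryTheory Opposite AlgebraicGeometry TopologicalSpace

variable {S : Scheme.{u}} {A : AlgSheaf S} {P : SheafOfModules.{u} A.right}

variable (P) in
/-- The sections over `U` of the dual of `P`. -/
abbrev LocCoord (U : (Opens S)ᵒᵖ) : Type u :=
  LocHom P.val (SheafOfModules.unit A.right).val U

/-- The value of a section of the dual of `P`, as a section of the sheaf of rings. -/
def LocCoord.eval {U : (Opens S)ᵒᵖ} (π : LocCoord P U) (V : (Opens S)ᵒᵖ) (i : U ⟶ V) :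
    P.val.obj V →ₗ[A.right.obj.obj V] A.right.obj.obj V := π.app V i

theorem LocCoord.eval_res {U : (Opens S)ᵒᵖ} (π : LocCoord P U) {V W : (Opens S)ᵒᵖ} (i : U ⟶ V)
    (j : V ⟶ W) (x : P.val.obj V) :
    A.right.obj.map j (LocCoord.eval π V i x) =
      LocCoord.eval π W (i ≫ j) (P.val.restrictₛₗ j x) := π.naturality V W i j x

/-- The endomorphism `x ↦ π(x) p` of `P`. -/
def rankOne {U : (Opens S)ᵒᵖ} (π : LocCoord P U) (p : P.val.obj U) : endOn A P U :=
  ⟨fun V i => (LinearMap.toSpanSingleton (A.right.obj.obj V) (P.val.obj V)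
      (P.val.restrictₛₗ i p)).comp (LocCoord.eval π V i), fun V W i j x => by
    refine ((P.val.restrictₛₗ j).map_smulₛₗ (LocCoord.eval π V i x) (P.val.restrictₛₗ i p)).trans ?_
    exact congrArg₂ (· • ·) (LocCoord.eval_res π i j x) (restrict_restrict P.val i j p)⟩

theorem rankOne_app {U : (Opens S)ᵒᵖ} (π : LocCoord P U) (p : P.val.obj U) (V : (Opens S)ᵒᵖ)
    (i : U ⟶ V) (x : P.val.obj V) :
    (rankOne π p).1 V i x = LocCoord.eval π V i x • P.val.restrictₛₗ i p := rfl

theorem endOn_ext {U : (Opens S)ᵒᵖ} {f g : endOn A P U} (h : ∀ V i x, f.1 V i x = g.1 V i x) :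
    f = g :=
  Subtype.ext (funext₂ fun V i => LinearMap.ext (h V i))

theorem endOn_mul_app {U : (Opens S)ᵒᵖ} (f g : endOn A P U) (V : (Opens S)ᵒᵖ) (i : U ⟶ V)
    (x : P.val.obj V) : (f * g).1 V i x = f.1 V i (g.1 V i x) := rfl

theorem endOn_add_app {U : (Opens S)ᵒᵖ} (f g : endOn A P U) (V : (Opens S)ᵒᵖ) (i : U ⟶ V)
    (x : P.val.obj V) : (f + g).1 V i x = f.1 V i x + g.1 V i x := rfl

theorem endOn_smul {U : (Opens S)ᵒᵖ} (f : endOn A P U) {V : (Opens S)ᵒᵖ} (i : U ⟶ V)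
    (r : A.right.obj.obj V) (x : P.val.obj V) : f.1 V i (r • x) = r • f.1 V i x :=
  (f.1 V i).map_smul r x

variable (A P) in
/-- A section `p₀` of `P` and a linear form on `P` with value `1` at `p₀`, whose kernel is locally
free of rank one: locally it is completed by a section `p₁` and a linear form `π₁` to a basis and its
dual basis. -/
structure SplitBasis where
  p₀ (U : (Opens S)ᵒᵖ) : P.val.obj U
  p₀_res {U V : (Opens S)ᵒᵖ} (i : U ⟶ V) : P.val.restrictₛₗ i (p₀ U) = p₀ V
  π₀ (U : (Opens S)ᵒᵖ) : LocCoord P U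
  π₀_app {U V : (Opens S)ᵒᵖ} (i : U ⟶ V) : (π₀ U).app V i = (π₀ V).app V (𝟙 V)
  π₀_p₀ (U : (Opens S)ᵒᵖ) : LocCoord.eval (π₀ U) U (𝟙 U) (p₀ U) = 1
  exists_basis (x : S) : ∃ U : Opens S, x ∈ U ∧
    ∃ (p₁ : P.val.obj (op U)) (π₁ : LocCoord P (op U)),
    (∀ V i x, x = LocCoord.eval (π₀ (op U)) V i x • p₀ V +
      LocCoord.eval π₁ V i x • P.val.restrictₛₗ i p₁) ∧
    LocCoord.eval (π₀ (op U)) (op U) (𝟙 _) p₁ = 0 ∧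
    LocCoord.eval π₁ (op U) (𝟙 _) (p₀ (op U)) = 0 ∧
    LocCoord.eval π₁ (op U) (𝟙 _) p₁ = 1

namespace SplitBasis

variable (B : SplitBasis A P)

/-- The linear form of a split basis. -/
def coord (V : (Opens S)ᵒᵖ) : P.val.obj V →ₗ[A.right.obj.obj V] A.right.obj.obj V :=
  LocCoord.eval (B.π₀ V) V (𝟙 V)

theorem eval_π₀ {U V : (Opens S)ᵒᵖ} (i : U ⟶ V) : LocCoord.eval (B.π₀ U) V i = B.coord V :=
  B.π₀_app i

theorem coord_p₀ (V : (Opens S)ᵒᵖ) : B.coord V (B.p₀ V) = 1 := B.π₀_p₀ V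

theorem coord_res {U V : (Opens S)ᵒᵖ} (i : U ⟶ V) (x : P.val.obj U) :
    B.coord V (P.val.restrictₛₗ i x) = A.right.obj.map i (B.coord U x) := by
  refine Eq.trans ?_ (LocCoord.eval_res (B.π₀ U) (𝟙 U) i x).symm
  exact congrArg (fun f => f (P.val.restrictₛₗ i x)) (B.eval_π₀ (𝟙 U ≫ i)).symm

theorem coord_smul_p₀ {V : (Opens S)ᵒᵖ} (r : A.right.obj.obj V) : B.coord V (r • B.p₀ V) = r := by
  rw [LinearMap.map_smul, coord_p₀, smul_eq_mul, mul_one]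

/-- The endomorphism `x ↦ π₀(x) p` of `P`. -/
def single {U : (Opens S)ᵒᵖ} (p : P.val.obj U) : endOn A P U := rankOne (B.π₀ U) p

theorem single_app {U : (Opens S)ᵒᵖ} (p : P.val.obj U) (V : (Opens S)ᵒᵖ) (i : U ⟶ V)
    (x : P.val.obj V) : (B.single p).1 V i x = B.coord V x • P.val.restrictₛₗ i p :=
  congrArg (fun f => f x • P.val.restrictₛₗ i p) (B.eval_π₀ i)

/-- The endomorphism `x ↦ π₀(x) r p₀` of `P`. -/
def unitAt {U : (Opens S)ᵒᵖ} (r : A.right.obj.obj U) : endOn A P U := B.single (r • B.p₀ U)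

theorem unitAt_app {U : (Opens S)ᵒᵖ} (r : A.right.obj.obj U) (V : (Opens S)ᵒᵖ) (i : U ⟶ V)
    (x : P.val.obj V) :
    (B.unitAt r).1 V i x = (B.coord V x * A.right.obj.map i r) • B.p₀ V := by
  refine (B.single_app _ V i x).trans ?_
  rw [mul_smul]
  refine congrArg (B.coord V x • ·) (((P.val.restrictₛₗ i).map_smulₛₗ r _).trans ?_)
  exact congrArg (A.right.obj.map i r • ·) (B.p₀_res i)

theorem map_one_right {U V : (Opens S)ᵒᵖ} (i : U ⟶ V) :
    A.right.obj.map i (1 : A.right.obj.obj U) = 1 := map_one (A.right.obj.map i).hom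

theorem unitAt_one_app {U : (Opens S)ᵒᵖ} (V : (Opens S)ᵒᵖ) (i : U ⟶ V)
    (x : P.val.obj V) : (B.unitAt (1 : A.right.obj.obj U)).1 V i x = B.coord V x • B.p₀ V := by
  rw [unitAt_app, map_one_right, mul_one]

theorem unitAt_mul {U : (Opens S)ᵒᵖ} (r s : A.right.obj.obj U) :
    B.unitAt (r * s) = B.unitAt s * B.unitAt r := endOn_ext fun V i x => by
  rw [endOn_mul_app, unitAt_app, unitAt_app, unitAt_app, coord_smul_p₀, mul_assoc]
  exact congrArg (fun t => (B.coord V x * t) • B.p₀ V) (map_mul (A.right.obj.map i).hom r s)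

theorem unitAt_add {U : (Opens S)ᵒᵖ} (r s : A.right.obj.obj U) :
    B.unitAt (r + s) = B.unitAt r + B.unitAt s := endOn_ext fun V i x => by
  rw [endOn_add_app, unitAt_app, unitAt_app, unitAt_app, ← add_smul, ← mul_add]
  exact congrArg (fun t => (B.coord V x * t) • B.p₀ V) (map_add (A.right.obj.map i).hom r s)

theorem unitAt_zero {U : (Opens S)ᵒᵖ} : B.unitAt (0 : A.right.obj.obj U) = 0 :=
  endOn_ext fun V i x => by
    refine (B.unitAt_app _ V i x).trans ?_
    refine (congrArg (fun t => (B.coord V x * t) • B.p₀ V)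
      (map_zero (A.right.obj.map i).hom)).trans ?_
    rw [mul_zero, zero_smul]
    rfl

theorem coord_unitAt {U : (Opens S)ᵒᵖ} (r : A.right.obj.obj U) :
    B.coord U ((B.unitAt r).1 U (𝟙 U) (B.p₀ U)) = r := by
  rw [unitAt_app, coord_smul_p₀, coord_p₀, one_mul]
  exact ConcreteCategory.congr_hom (A.right.obj.map_id U) r

theorem unitAt_injective {U : (Opens S)ᵒᵖ} {r s : A.right.obj.obj U}
    (h : B.unitAt r = B.unitAt s) : r = s :=
  (B.coord_unitAt r).symm.trans ((congrArg (fun f : endOn A P U =>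
    B.coord U (f.1 U (𝟙 U) (B.p₀ U))) h).trans (B.coord_unitAt s))

theorem unitAt_mul_unitAt {U : (Opens S)ᵒᵖ} (f : endOn A P U) :
    B.unitAt 1 * f * B.unitAt 1 = B.unitAt (B.coord U (f.1 U (𝟙 U) (B.p₀ U))) :=
  endOn_ext fun V i x => by
    rw [endOn_mul_app, endOn_mul_app, unitAt_one_app, unitAt_one_app, endOn_smul,
      LinearMap.map_smul, unitAt_app, smul_eq_mul]
    refine congrArg (fun t => (B.coord V x * t) • B.p₀ V) ?_
    refine Eq.trans ?_ (B.coord_res i _)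
    refine congrArg (B.coord V) (Eq.trans ?_ (f.2 U V (𝟙 U) i (B.p₀ U)).symm)
    exact congrArg (f.1 V i) (B.p₀_res i).symm

/-- Locally, the identity of `P` is the sum of the projection to `p₀` and of a composition which
factors through it. -/
theorem exists_one_eq (x : S) : ∃ U : Opens S, x ∈ U ∧ ∀ V (_ : op U ⟶ V), ∃ f g : endOn A P V,
    B.unitAt 1 + f * B.unitAt 1 * g = 1 := by
  obtain ⟨U, hx, p₁, π₁, h, -⟩ := B.exists_basis x
  refine ⟨U, hx, fun V i => ⟨B.single (P.val.restrictₛₗ i p₁),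
    rankOne (LocHom.res π₁ i) (B.p₀ V), endOn_ext fun W j x => ?_⟩⟩
  rw [endOn_add_app, endOn_mul_app, endOn_mul_app, unitAt_one_app, unitAt_one_app, single_app,
    coord_smul_p₀, rankOne_app, p₀_res, coord_smul_p₀, restrict_restrict]
  refine Eq.trans ?_ (h W (i ≫ j) x).symm
  exact congrArg (fun t => t x • B.p₀ W + _) (B.eval_π₀ (i ≫ j)).symm

end SplitBasis

end SplitBasis

/-! ### The center and the corner of the algebra of endomorphisms -/

section SplitConsequences

open CategoryTheory Opposite AlgebraicGeometry TopologicalSpace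

variable {S : Scheme.{u}}

namespace AlgPresheaf.Iso

variable {A B C : AlgPresheaf S} (e : AlgPresheaf.Iso A B)

/-- An isomorphism of presheaves of algebras on sections. -/
def equiv (U : (Opens S)ᵒᵖ) : A.ring.obj U ≃+* B.ring.obj U :=
  (e.iso.app U).ringCatIsoToRingEquiv

theorem equiv_map {U V : (Opens S)ᵒᵖ} (i : U ⟶ V) (x : A.ring.obj U) :
    e.equiv V (A.ring.map i x) = B.ring.map i (e.equiv U x) :=
  NatTrans.naturality_apply e.iso.hom i x

theorem equiv_unit {U : (Opens S)ᵒᵖ} (r : S.ringCatSheaf.obj.obj U) :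
    e.equiv U (A.unit.app U r) = B.unit.app U r :=
  congrArg (fun k : S.ringCatSheaf.obj ⟶ B.ring => k.app U r) e.unit_comp

/-- An isomorphism of presheaves of algebras from compatible isomorphisms on sections. -/
def ofEquiv (f : ∀ U, A.ring.obj U ≃+* B.ring.obj U)
    (hf : ∀ {U V : (Opens S)ᵒᵖ} (i : U ⟶ V) (x : A.ring.obj U),
      f V (A.ring.map i x) = B.ring.map i (f U x))
    (hu : ∀ (U : (Opens S)ᵒᵖ) (r : S.ringCatSheaf.obj.obj U),
      f U (A.unit.app U r) = B.unit.app U r) : AlgPresheaf.Iso A B where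
  iso := NatIso.ofComponents (fun U => (f U).toRingCatIso) fun i =>
    RingCat.hom_ext (RingHom.ext fun x => hf i x)
  unit_comp := NatTrans.ext (funext fun U => RingCat.hom_ext (RingHom.ext fun r => hu U r))

theorem mem_centerOn_iff {U : (Opens S)ᵒᵖ} (x : A.ring.obj U) :
    e.equiv U x ∈ B.centerOn U ↔ x ∈ A.centerOn U := by
  refine ⟨fun h V i y => (e.equiv V).injective ?_, fun h V i y => ?_⟩
  · rw [map_mul, map_mul, equiv_map]
    exact h V i (e.equiv V y)
  · obtain ⟨y, rfl⟩ := (e.equiv V).surjective y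
    rw [← equiv_map, ← map_mul, ← map_mul, h V i y]

end AlgPresheaf.Iso

variable {A : AlgSheaf S} {P : SheafOfModules.{u} A.right}

/-- A central section of `A`, acting on `P`. -/
def centralEnd {U : (Opens S)ᵒᵖ} (a : A.centerOn U) : endOn A P U :=
  ⟨fun V i =>
    { toFun := fun x => AlgSheaf.toR (A.ring.map i a.1) • x
      map_add' := fun x y => smul_add _ x y
      map_smul' := fun r x => by
        have h : AlgSheaf.toR (A.ring.map i a.1) * r = r * AlgSheaf.toR (A.ring.map i a.1) :=
          MulOpposite.unop_injective (a.2 V i (MulOpposite.unop r)).symm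
        rw [smul_smul, h, mul_smul, RingHom.id_apply] }, fun V W i j x => by
    refine ((P.val.restrictₛₗ j).map_smulₛₗ (AlgSheaf.toR (A.ring.map i a.1)) x).trans ?_
    exact congrArg (fun b => AlgSheaf.toR b • P.val.restrictₛₗ j x)
      (ConcreteCategory.congr_hom (A.ring.map_comp i j) a.1).symm⟩

theorem centralEnd_app {U : (Opens S)ᵒᵖ} (a : A.centerOn U) (V : (Opens S)ᵒᵖ) (i : U ⟶ V)
    (x : P.val.obj V) : (centralEnd a).1 V i x = AlgSheaf.toR (A.ring.map i a.1) • x := rfl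

theorem centralEnd_mem {U : (Opens S)ᵒᵖ} (a : A.centerOn U) :
    (centralEnd a : endOn A P U) ∈ (endAlg A P).centerOn U := fun V _ f =>
  endOn_ext fun W j x => ((show endOn A P V from f).1 W j).map_smul _ x |>.symm

variable (A P) in
/-- The action of the center of `A` on `P`. -/
def centerHom (U : (Opens S)ᵒᵖ) : A.centerOn U →+* (endAlg A P).centerOn U where
  toFun a := ⟨centralEnd a, centralEnd_mem a⟩
  map_one' := Subtype.ext <| endOn_ext fun V i x => by
    refine (centralEnd_app 1 V i x).trans ?_
    refine (congrArg (fun b => AlgSheaf.toR b • x) (map_one (A.ring.map i).hom)).trans ?_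
    exact one_smul _ x
  map_mul' a b := Subtype.ext <| endOn_ext fun V i x => by
    refine (centralEnd_app (a * b) V i x).trans ?_
    refine (congrArg (fun b => AlgSheaf.toR b • x) ((map_mul (A.ring.map i).hom a.1 b.1).trans
      (a.2 V i _))).trans ?_
    exact mul_smul (AlgSheaf.toR (A.ring.map i a.1)) (AlgSheaf.toR (A.ring.map i b.1)) x
  map_zero' := Subtype.ext <| endOn_ext fun V i x => by
    refine (centralEnd_app 0 V i x).trans ?_
    refine (congrArg (fun b => AlgSheaf.toR b • x) (map_zero (A.ring.map i).hom)).trans ?_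
    exact zero_smul _ x
  map_add' a b := Subtype.ext <| endOn_ext fun V i x => by
    refine (centralEnd_app (a + b) V i x).trans ?_
    refine (congrArg (fun b => AlgSheaf.toR b • x) (map_add (A.ring.map i).hom a.1 b.1)).trans ?_
    exact add_smul (AlgSheaf.toR (A.ring.map i a.1)) (AlgSheaf.toR (A.ring.map i b.1)) x

namespace SplitBasis

variable (B : SplitBasis A P)

include B in
theorem centerHom_injective (U : (Opens S)ᵒᵖ) : Function.Injective (centerHom A P U) := by
  intro a b h
  have h' : AlgSheaf.toR (A.ring.map (𝟙 U) a.1) • B.p₀ U =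
      AlgSheaf.toR (A.ring.map (𝟙 U) b.1) • B.p₀ U :=
    congrArg (fun f : (endAlg A P).centerOn U => (show endOn A P U from f.1).1 U (𝟙 U) (B.p₀ U)) h
  have h'' := congrArg (B.coord U) h'
  rw [coord_smul_p₀, coord_smul_p₀] at h''
  have hid (x : A.ring.obj U) : A.ring.map (𝟙 U) x = x :=
    ConcreteCategory.congr_hom (A.ring.map_id U) x
  rw [hid, hid] at h''
  exact Subtype.ext (MulOpposite.op_injective h'')

/-- A central endomorphism commutes with the endomorphisms `x ↦ π₀(x) p`, so it is the
multiplication with the coordinate of the image of `p₀`. -/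
theorem central_app {U : (Opens S)ᵒᵖ} {f : endOn A P U} (hf : f ∈ (endAlg A P).centerOn U)
    (V : (Opens S)ᵒᵖ) (i : U ⟶ V) (x : P.val.obj V) :
    f.1 V i x = A.right.obj.map i (B.coord U (f.1 U (𝟙 U) (B.p₀ U))) • x := by
  have h : f.1 V (i ≫ 𝟙 V) ((B.single x).1 V (𝟙 V) (B.p₀ V)) =
      (B.single x).1 V (𝟙 V) (f.1 V (i ≫ 𝟙 V) (B.p₀ V)) :=
    congrArg (fun g : endOn A P V => g.1 V (𝟙 V) (B.p₀ V)) (hf V i (B.single x))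
  rw [single_app, single_app, coord_p₀, one_smul, restrict_id] at h
  have hi : i ≫ 𝟙 V = i := Category.comp_id i
  rw [hi] at h
  refine h.trans (congrArg (· • x) ?_)
  refine Eq.trans ?_ (B.coord_res i _)
  refine congrArg (B.coord V) (Eq.trans ?_ (f.2 U V (𝟙 U) i (B.p₀ U)).symm)
  exact congrArg (f.1 V i) (B.p₀_res i).symm

include B in
theorem centerHom_surjective (U : (Opens S)ᵒᵖ) : Function.Surjective (centerHom A P U) := by
  rintro ⟨f, hf⟩
  let f' : endOn A P U := f
  let r := B.coord U (f'.1 U (𝟙 U) (B.p₀ U))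
  let a : A.ring.obj U := MulOpposite.unop r
  have ha : a ∈ A.centerOn U := fun V i b => by
    let t := A.right.obj.map i r
    have hc (y : P.val.obj V) : f'.1 V i y = t • y := B.central_app hf V i y
    have h : t • AlgSheaf.toR b • B.p₀ V = AlgSheaf.toR b • t • B.p₀ V :=
      (hc _).symm.trans ((endOn_smul f' i (AlgSheaf.toR b) (B.p₀ V)).trans
        (congrArg (AlgSheaf.toR b • ·) (hc _)))
    have h' := congrArg (B.coord V) h
    rw [smul_smul, smul_smul, coord_smul_p₀, coord_smul_p₀] at h'
    exact (congrArg MulOpposite.unop h').symm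
  exact ⟨⟨a, ha⟩, Subtype.ext (endOn_ext fun V i x => (B.central_app hf V i x).symm)⟩

include B in
/-- The center of `A` is the center of the algebra of endomorphisms of `P`. -/
theorem exists_center_iso {A' : AlgPresheaf S} (e : AlgPresheaf.Iso A' (endAlg A P)) :
    ∃ ζ : AlgPresheaf.Iso A'.center A.center,
      ∀ (U : (Opens S)ᵒᵖ) (z : A'.center.ring.obj U) (V : (Opens S)ᵒᵖ) (i : U ⟶ V)
        (p : P.val.obj V), (e.iso.hom.app U z.1).1 V i p =
          AlgSheaf.toR (A.ring.map i (ζ.iso.hom.app U z).1) • p := by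
  let f (U : (Opens S)ᵒᵖ) : A'.centerOn U ≃+* (endAlg A P).centerOn U :=
    (e.equiv U).subringMap (s := A'.centerOn U) |>.trans (RingEquiv.subringCongr (by
      ext y
      obtain ⟨x, rfl⟩ := (e.equiv U).surjective y
      refine ⟨?_, fun h => ⟨x, (e.mem_centerOn_iff x).1 h, rfl⟩⟩
      rintro ⟨x', hx', hx⟩
      exact (e.mem_centerOn_iff x).2 ((e.equiv U).injective hx ▸ hx')))
  let g (U : (Opens S)ᵒᵖ) : A.centerOn U ≃+* (endAlg A P).centerOn U :=
    RingEquiv.ofBijective (centerHom A P U) ⟨B.centerHom_injective U, B.centerHom_surjective U⟩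
  let ζ (U : (Opens S)ᵒᵖ) : A'.centerOn U ≃+* A.centerOn U := (f U).trans (g U).symm
  have hζ (U : (Opens S)ᵒᵖ) (z : A'.centerOn U) : centerHom A P U (ζ U z) = f U z :=
    (g U).apply_symm_apply (f U z)
  have hζ' (U : (Opens S)ᵒᵖ) (z : A'.centerOn U) :
      (centralEnd (ζ U z) : endOn A P U) = e.equiv U z.1 := congrArg Subtype.val (hζ U z)
  refine ⟨.ofEquiv ζ (fun {U V} i z => ?_) fun U r => ?_, fun U z V i p => ?_⟩
  · refine B.centerHom_injective V (Subtype.ext ?_)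
    refine (hζ' V _).trans ((e.equiv_map i z.1).trans ?_)
    refine (congrArg ((endAlg A P).ring.map i) (hζ' U z).symm).trans (endOn_ext fun W j x => ?_)
    exact congrArg (fun b => AlgSheaf.toR b • x)
      (ConcreteCategory.congr_hom (A.ring.map_comp i j) (ζ U z).1)
  · refine B.centerHom_injective U (Subtype.ext ?_)
    refine (hζ' U _).trans ((e.equiv_unit r).trans (endOn_ext fun V i x => ?_))
    exact congrArg (fun b => AlgSheaf.toR b • x) (NatTrans.naturality_apply A.unit i r)
  · exact congrArg (fun h : endOn A P U => h.1 V i p) (hζ' U z).symm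

section

variable {A' : AlgSheaf S} (e : AlgPresheaf.Iso A'.toAlgPresheaf (endAlg A P))

/-- The endomorphism `x ↦ π₀(x) r p₀` of `P`, as a section of an isomorphic algebra. -/
def cornerElem {X : (Opens S)ᵒᵖ} (r : A.right.obj.obj X) : A'.ring.obj X :=
  (e.equiv X).symm (B.unitAt r)

theorem equiv_cornerElem {X : (Opens S)ᵒᵖ} (r : A.right.obj.obj X) :
    e.equiv X (B.cornerElem e r) = B.unitAt r := (e.equiv X).apply_symm_apply _

theorem cornerElem_mul {X : (Opens S)ᵒᵖ} (r s : A.right.obj.obj X) :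
    B.cornerElem e (r * s) = B.cornerElem e s * B.cornerElem e r :=
  (congrArg (e.equiv X).symm (B.unitAt_mul r s)).trans (map_mul (e.equiv X).symm _ _)

theorem cornerElem_add {X : (Opens S)ᵒᵖ} (r s : A.right.obj.obj X) :
    B.cornerElem e (r + s) = B.cornerElem e r + B.cornerElem e s :=
  (congrArg (e.equiv X).symm (B.unitAt_add r s)).trans (map_add (e.equiv X).symm _ _)

theorem cornerElem_zero {X : (Opens S)ᵒᵖ} : B.cornerElem e (0 : A.right.obj.obj X) = 0 :=
  (congrArg (e.equiv X).symm B.unitAt_zero).trans (map_zero (e.equiv X).symm)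

theorem map_cornerElem {X Y : (Opens S)ᵒᵖ} (i : X ⟶ Y) (r : A.right.obj.obj X) :
    A'.ring.map i (B.cornerElem e r) = B.cornerElem e (A.right.obj.map i r) := by
  refine (e.equiv Y).injective ((e.equiv_map i _).trans ?_)
  refine Eq.trans ?_ (B.equiv_cornerElem e _).symm
  refine (congrArg ((endAlg A P).ring.map i) (B.equiv_cornerElem e r)).trans ?_
  refine endOn_ext fun V j x => ?_
  refine (B.unitAt_app r V (i ≫ j) x).trans (Eq.trans ?_ (B.unitAt_app _ V j x).symm)
  exact congrArg (fun t => (B.coord V x * t) • B.p₀ V)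
    (ConcreteCategory.congr_hom (A.right.obj.map_comp i j) r)

theorem exists_cornerElem_eq {X : (Opens S)ᵒᵖ} (z : A'.ring.obj X) : ∃ r,
    B.cornerElem e (1 : A.right.obj.obj X) * (z * B.cornerElem e (1 : A.right.obj.obj X)) =
      B.cornerElem e r := by
  let f : endOn A P X := e.equiv X z
  refine ⟨B.coord X (f.1 X (𝟙 X) (B.p₀ X)), (e.equiv X).injective ?_⟩
  rw [map_mul, map_mul, equiv_cornerElem, equiv_cornerElem]
  exact (mul_assoc (B.unitAt 1) f (B.unitAt 1)).symm.trans (B.unitAt_mul_unitAt f)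

theorem cornerElem_add_eq_one {X : (Opens S)ᵒᵖ} {f g : endOn A P X}
    (h : B.unitAt 1 + f * B.unitAt 1 * g = 1) :
    B.cornerElem e (1 : A.right.obj.obj X) + (e.equiv X).symm f *
      (B.cornerElem e (1 : A.right.obj.obj X) * (e.equiv X).symm g) = 1 := by
  refine (e.equiv X).injective ?_
  have he (k : endOn A P X) : e.equiv X ((e.equiv X).symm k) = k :=
    (e.equiv X).apply_symm_apply k
  rw [map_add, map_mul, map_mul, map_one, he, he, equiv_cornerElem]
  refine Eq.trans ?_ h
  exact congrArg (fun k : endOn A P X => B.unitAt 1 + k) (mul_assoc f (B.unitAt 1) g).symm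

/-- The algebra of endomorphisms of `P` has the corner `A`, cut out by the projection to `p₀`. -/
def corner : Corner A'.right A.right where
  app X :=
    { toFun := fun r => AlgSheaf.toR (B.cornerElem e r)
      map_mul' := fun r s => congrArg MulOpposite.op (B.cornerElem_mul e r s)
      map_zero' := congrArg MulOpposite.op (B.cornerElem_zero e)
      map_add' := fun r s => congrArg MulOpposite.op (B.cornerElem_add e r s) }
  naturality {X Y} i r := congrArg MulOpposite.op (B.map_cornerElem e i r)
  injective X r s h := B.unitAt_injective ((e.equiv X).symm.injective (MulOpposite.op_injective h))
  exists_eq {X} r := by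
    obtain ⟨s, hs⟩ := B.exists_cornerElem_eq e (MulOpposite.unop r : A'.ring.obj X)
    exact ⟨s, congrArg MulOpposite.op hs⟩
  full X := by
    let T : Sieve X.unop :=
      { arrows := fun V _ => ∀ W (_ : op V ⟶ W), ∃ f g : endOn A P W,
          B.unitAt 1 + f * B.unitAt 1 * g = 1
        downward_closed := fun h i W j => h W (i.op ≫ j) }
    refine ⟨T, fun x hx => ?_, fun V i h => ?_⟩
    · obtain ⟨U, hxU, hU⟩ := B.exists_one_eq x
      exact ⟨U ⊓ X.unop, homOfLE inf_le_right,
        fun W j => hU W ((homOfLE inf_le_left).op ≫ j), hxU, hx⟩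
    · obtain ⟨f, g, h⟩ := h _ (𝟙 _)
      exact ⟨AlgSheaf.toR ((e.equiv (op V)).symm f), AlgSheaf.toR ((e.equiv (op V)).symm g),
        congrArg MulOpposite.op (B.cornerElem_add_eq_one e h)⟩

theorem corner_app_scalar (U : (Opens S)ᵒᵖ) (r : S.ringCatSheaf.obj.obj U) :
    (B.corner e).app U (A.scalar U r) = A'.scalar U r * (B.corner e).app U 1 := by
  refine congrArg MulOpposite.op (?_ : B.cornerElem e (A.scalar U r) =
    B.cornerElem e (1 : A.right.obj.obj U) * A'.unit.app U r)
  refine (e.equiv U).injective ?_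
  rw [map_mul, equiv_cornerElem, equiv_cornerElem, e.equiv_unit]
  refine endOn_ext fun V i x => ?_
  refine (B.unitAt_app _ V i x).trans (Eq.trans ?_ (B.unitAt_one_app V i _).symm)
  refine congrArg (· • B.p₀ V) ?_
  refine Eq.trans ?_ ((B.coord V).map_smul (A.scalar V (S.ringCatSheaf.obj.map i r)) x).symm
  exact (congrArg (B.coord V x * ·) (AlgSheaf.scalar_map i r)).trans
    (AlgSheaf.scalar_comm _ _).symm

include B e in
theorem moritaEquivalent : MoritaEquivalent A' A :=
  (B.corner e).moritaEquivalent (B.corner_app_scalar e)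

end

end SplitBasis

end SplitConsequences

/-! ### Local freeness of rank two -/

section RankTwo

open CategoryTheory Limits Opposite AlgebraicGeometry TopologicalSpace

/-- The map from a sheaf of rings to a sheaf of modules given by a compatible family of
sections. -/
def sectionHom {C : Type u} [Category.{u} C] {J : GrothendieckTopology C} {R : Sheaf J RingCat.{u}}
    {M : SheafOfModules.{u} R} (m : ∀ X, M.val.obj X)
    (hm : ∀ {X Y : Cᵒᵖ} (i : X ⟶ Y), M.val.restrictₛₗ i (m X) = m Y) :
    SheafOfModules.unit R ⟶ M :=
  Corner.homMk (M := SheafOfModules.unit R)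
    (fun X => LinearMap.toSpanSingleton (R.obj.obj X) _ (m X)) fun {X _} i r =>
      (((M.val.restrictₛₗ i).map_smulₛₗ (show R.obj.obj X from r) (m X)).trans
        (congrArg (R.obj.map i (show R.obj.obj X from r) • ·) (hm i))).symm

variable {S : Scheme.{u}} {A : AlgSheaf S} {P : SheafOfModules.{u} A.right}

/-- A section of the dual of `P` over `U`, as a map of sheaves over `U`. -/
def LocCoord.overHom {U : Opens S} (π : LocCoord P (op U)) :
    P.over U ⟶ SheafOfModules.unit (A.right.over U) :=
  Corner.homMk (fun W => π.app (op W.unop.left) W.unop.hom.op) fun {V _} i x =>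
    (((π.naturality _ _ V.unop.hom.op i.unop.left.op x).trans
      (congrArg (fun l => π.app _ l _) (congrArg Quiver.Hom.op (Over.w i.unop)))).symm)

/-- A section of `P` over `U`, as a map of sheaves over `U`. -/
def overSectionHom {U : Opens S} (p : P.val.obj (op U)) :
    SheafOfModules.unit (A.right.over U) ⟶ P.over U :=
  sectionHom (M := P.over U) (fun W => P.val.restrictₛₗ W.unop.hom.op p) fun {V _} i =>
    (restrict_restrict P.val V.unop.hom.op i.unop.left.op p).trans
      (congrArg (fun l => P.val.restrictₛₗ l p) (congrArg Quiver.Hom.op (Over.w i.unop)))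

theorem overSectionHom_overHom {U : Opens S} (p : P.val.obj (op U)) (π : LocCoord P (op U))
    {r : A.right.obj.obj (op U)} (h : LocCoord.eval π (op U) (𝟙 _) p = r)
    (W : (Over U)ᵒᵖ) (s : A.right.obj.obj (op W.unop.left)) :
    Corner.homApp (overSectionHom p ≫ LocCoord.overHom π) W s =
      s * A.right.obj.map W.unop.hom.op r := by
  have h' := LocCoord.eval_res π (𝟙 _) W.unop.hom.op p
  rw [h, Category.id_comp] at h'
  rw [h']
  exact (LocCoord.eval π _ W.unop.hom.op).map_smul s (P.val.restrictₛₗ W.unop.hom.op p)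

theorem SplitBasis.isLocallyFreeOfRank (B : SplitBasis A P) : IsLocallyFreeOfRank 2 P := by
  intro x
  obtain ⟨U, hx, p₁, π₁, h, h₀₁, h₁₀, h₁₁⟩ := B.exists_basis x
  refine ⟨U, hx, ⟨?_⟩⟩
  let π (k : ULift.{u} (Fin 2)) : P.over U ⟶ SheafOfModules.unit (A.right.over U) :=
    LocCoord.overHom (![B.π₀ (op U), π₁] k.down)
  let p (k : ULift.{u} (Fin 2)) : SheafOfModules.unit (A.right.over U) ⟶ P.over U :=
    overSectionHom (![B.p₀ (op U), p₁] k.down)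
  have h1 : π ⟨0⟩ ≫ p ⟨0⟩ + π ⟨1⟩ ≫ p ⟨1⟩ = 𝟙 _ := by
    refine Corner.hom_ext_app fun W x => ?_
    refine Eq.trans ?_ (h (op W.unop.left) W.unop.hom.op x).symm
    exact congrArg (fun y => LocCoord.eval (B.π₀ (op U)) (op W.unop.left) W.unop.hom.op x • y + _)
      (B.p₀_res W.unop.hom.op)
  have hr {q : P.val.obj (op U)} {ρ : LocCoord P (op U)}
      (hq : LocCoord.eval ρ (op U) (𝟙 _) q = 0) : overSectionHom q ≫ LocCoord.overHom ρ = 0 :=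
    Corner.hom_ext_app fun W s => (overSectionHom_overHom q ρ hq W s).trans
      ((congrArg ((show A.right.obj.obj (op W.unop.left) from s) * ·)
        (map_zero (A.right.obj.map W.unop.hom.op).hom)).trans (mul_zero _))
  have hr' {q : P.val.obj (op U)} {ρ : LocCoord P (op U)}
      (hq : LocCoord.eval ρ (op U) (𝟙 _) q = 1) : overSectionHom q ≫ LocCoord.overHom ρ = 𝟙 _ :=
    Corner.hom_ext_app fun W s => (overSectionHom_overHom q ρ hq W s).trans
      ((congrArg ((show A.right.obj.obj (op W.unop.left) from s) * ·)
        (map_one (A.right.obj.map W.unop.hom.op).hom)).trans (mul_one _))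
  have h2 (j k : ULift.{u} (Fin 2)) : p j ≫ π k = if j = k then 𝟙 _ else 0 := by
    obtain ⟨j⟩ := j
    obtain ⟨k⟩ := k
    fin_cases j <;> fin_cases k
    · exact hr' (B.π₀_p₀ _)
    · exact hr h₁₀
    · exact hr h₀₁
    · exact hr' h₁₁
  let I (k : ULift.{u} (Fin 2)) : SheafOfModules.unit (A.right.over U) ⟶
    SheafOfModules.free (R := A.right.over U) (ULift.{u} (Fin 2)) := SheafOfModules.ιFree k
  refine
    { hom := π ⟨0⟩ ≫ I ⟨0⟩ + π ⟨1⟩ ≫ I ⟨1⟩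
      inv := HasFiniteCoordinates.freeDesc p
      hom_inv_id := ?_
      inv_hom_id := HasFiniteCoordinates.free_hom_ext fun k => ?_ }
  · rw [Preadditive.add_comp, Category.assoc, Category.assoc, HasFiniteCoordinates.ι_freeDesc,
      HasFiniteCoordinates.ι_freeDesc]
    exact h1
  · rw [← Category.assoc, HasFiniteCoordinates.ι_freeDesc, Category.comp_id, Preadditive.comp_add,
      ← Category.assoc, ← Category.assoc, h2, h2]
    obtain ⟨k⟩ := k
    fin_cases k <;> simp [I]

end RankTwo

/-! ### The split basis of the Clifford bimodule -/

section BimoduleBasis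

open CategoryTheory Opposite AlgebraicGeometry TopologicalSpace

variable {S : Scheme.{u}}

namespace QuadForm

variable {M N L : S.PresheafOfModules} (q : QuadForm M L)

/-- The map `C₀(q) ⟶ 𝒞₀(q)` to the associated sheaf of opposite rings, on sections. -/
abbrev toR₀ (V : (Opens S)ᵒᵖ) : q.opC0 V →+* q.evenClifford.right.obj.obj V :=
  (q.toRight.app V).hom

variable (N) in
/-- A family of linear forms on the presheaf `C₀(q) ⊕ C₁(q) ⊗ N^∨` extends to the associated
sheaf. -/
def extendCoord {U : (Opens S)ᵒᵖ} (c : ∀ V (_ : U ⟶ V), (q.preP N).obj V →ₗ[q.opC0 V] q.opC0 V)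
    (hc : ∀ V W (i : U ⟶ V) (j : V ⟶ W) (x : (q.preP N).obj V),
      c W (i ≫ j) ((q.preP N).restrictₛₗ j x) = (q.preC0 ⋙ opRing).map j (c V i x)) :
    LocCoord (q.bimodule N) U :=
  (q.toBimodule N).extend (T := ⊤)
    { app := fun V i _ =>
        { toFun := fun x => q.toR₀ V (c V i x)
          map_add' := fun x y => (congrArg (q.toR₀ V) ((c V i).map_add x y)).trans
            ((q.toR₀ V).map_add _ _)
          map_smul' := fun r x => (congrArg (q.toR₀ V) ((c V i).map_smul r x)).trans
            ((q.toR₀ V).map_mul _ _) }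
      naturality := fun V W i j _ x => by
        refine Eq.trans ?_ (congrArg (q.toR₀ W) (hc V W i j x)).symm
        exact (NatTrans.naturality_apply q.toRight j (c V i x)).symm }
    ((zar S).top_mem _)

theorem extendCoord_app {U : (Opens S)ᵒᵖ}
    (c : ∀ V (_ : U ⟶ V), (q.preP N).obj V →ₗ[q.opC0 V] q.opC0 V)
    (hc : ∀ V W (i : U ⟶ V) (j : V ⟶ W) (x : (q.preP N).obj V),
      c W (i ≫ j) ((q.preP N).restrictₛₗ j x) = (q.preC0 ⋙ opRing).map j (c V i x))
    (V : (Opens S)ᵒᵖ) (i : U ⟶ V) (x : (q.preP N).obj V) :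
    LocCoord.eval (q.extendCoord N c hc) V i ((q.toBimodule N).app V x) = q.toR₀ V (c V i x) :=
  (q.toBimodule N).extend_app _ _ i trivial x

variable (N) in
/-- The linear form `C₀ ⊕ C₁ ⊗ N^∨ ⟶ C₀`. -/
def proj₀ (U : (Opens S)ᵒᵖ) : LocCoord (q.bimodule N) U :=
  q.extendCoord N (fun V _ => q.coord₁ N V) fun _ _ _ j x => q.coord₁_res N j x

variable {q} in
/-- The linear form `C₀ ⊕ C₁ ⊗ N^∨ ⟶ C₀` given by local generators. -/
def LocalFrame.proj₁ {U : (Opens S)ᵒᵖ} (F : q.LocalFrame N U) : LocCoord (q.bimodule N) U :=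
  q.extendCoord N (fun _ i => (F.restrict i).coord₂) fun _ W i j x =>
    (congrArg (fun G : q.LocalFrame N W => G.coord₂ ((q.preP N).restrictₛₗ j x))
      (F.restrict_restrict i j).symm).trans ((F.restrict i).coord₂_res j x)

theorem proj₀_app {U V : (Opens S)ᵒᵖ} (i : U ⟶ V) (x : (q.preP N).obj V) :
    LocCoord.eval (q.proj₀ N U) V i ((q.toBimodule N).app V x) = q.toR₀ V (q.coord₁ N V x) :=
  q.extendCoord_app _ _ V i x

variable {q} in
theorem LocalFrame.proj₁_app {U V : (Opens S)ᵒᵖ} (F : q.LocalFrame N U) (i : U ⟶ V)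
    (x : (q.preP N).obj V) :
    LocCoord.eval F.proj₁ V i ((q.toBimodule N).app V x) = q.toR₀ V ((F.restrict i).coord₂ x) :=
  q.extendCoord_app _ _ V i x

variable {q} in
theorem LocalFrame.eq_proj {U : (Opens S)ᵒᵖ} (F : q.LocalFrame N U) (V : (Opens S)ᵒᵖ) (i : U ⟶ V)
    (x : (q.bimodule N).val.obj V) :
    x = LocCoord.eval (q.proj₀ N U) V i x • (q.toBimodule N).app V (q.p₀ N V) +
      LocCoord.eval F.proj₁ V i x •
        (q.bimodule N).val.restrictₛₗ i ((q.toBimodule N).app U F.p₁) := by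
  have h : (1 : endOn q.evenClifford (q.bimodule N) U) =
      rankOne (q.proj₀ N U) ((q.toBimodule N).app U (q.p₀ N U)) +
        rankOne F.proj₁ ((q.toBimodule N).app U F.p₁) := by
    refine endOn.ext_app ((q.toBimodule N).hom_ext (T := ⊤) ((zar S).top_mem _) fun V i _ x => ?_)
    refine (toBimodule_eq (F.restrict i) x).trans (Eq.symm ?_)
    refine (endOn_add_app _ _ V i _).trans ?_
    rw [rankOne_app, rankOne_app, proj₀_app, F.proj₁_app, LocBij.naturality, LocBij.naturality,
      p₀_res, F.p₁_res]
  refine (congrArg (fun f : endOn q.evenClifford (q.bimodule N) U => f.1 V i x) h).trans ?_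
  refine (endOn_add_app _ _ V i x).trans ?_
  rw [rankOne_app, rankOne_app, LocBij.naturality, p₀_res]

/-- Where local generators exist, the bimodule has the basis `1`, `p₁`. -/
def splitBasis (hF : q.LocallyFramed N) : SplitBasis q.evenClifford (q.bimodule N) where
  p₀ U := (q.toBimodule N).app U (q.p₀ N U)
  p₀_res {U V} i := ((q.toBimodule N).naturality i _).trans
    (congrArg ((q.toBimodule N).app V) (p₀_res N q i))
  π₀ U := q.proj₀ N U
  π₀_app {U V} i := by
    have h : LocHom.res (q.proj₀ N U) i = q.proj₀ N V :=
      (q.toBimodule N).hom_ext (T := ⊤) ((zar S).top_mem _) fun W j _ x =>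
        (q.proj₀_app (i ≫ j) x).trans (q.proj₀_app j x).symm
    refine Eq.trans ?_ (congrArg (fun π : LocCoord (q.bimodule N) V => π.app V (𝟙 V)) h)
    exact congrArg ((q.proj₀ N U).app V) (Category.comp_id i).symm
  π₀_p₀ U := (q.proj₀_app (𝟙 U) _).trans ((q.toR₀ U).map_one)
  exists_basis x := by
    obtain ⟨U, hx, ⟨F⟩⟩ := hF x
    refine ⟨U, hx, (q.toBimodule N).app (op U) F.p₁, F.proj₁, F.eq_proj, ?_, ?_, ?_⟩
    · exact (q.proj₀_app (𝟙 _) _).trans ((q.toR₀ _).map_zero)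
    · refine (F.proj₁_app (𝟙 _) _).trans ((congrArg (q.toR₀ _) ?_).trans (q.toR₀ _).map_zero)
      exact (F.restrict (𝟙 _)).coord₂_p₀
    · refine (F.proj₁_app (𝟙 _) _).trans ((congrArg (q.toR₀ _) ?_).trans (q.toR₀ _).map_one)
      rw [← restrict_id (q.preP N) F.p₁, F.p₁_res]
      exact (F.restrict (𝟙 _)).coord₂_p₁

end QuadForm

end BimoduleBasis

end EvenClifford

end

theorem mainTheorem9 {S : AlgebraicGeometry.Scheme.{u}} (n m : ℕ) (E E' N L : S.Modules)
    (hE : EvenClifford.IsLocallyFreeOfRank (R := S.ringCatSheaf) n E)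
    (hE' : EvenClifford.IsLocallyFreeOfRank (R := S.ringCatSheaf) m E')
    (hN : EvenClifford.IsLocallyFreeOfRank (R := S.ringCatSheaf) 1 N)
    (hL : EvenClifford.IsLocallyFreeOfRank (R := S.ringCatSheaf) 1 L)
    (q : EvenClifford.QuadForm E.val L.val) (q' : EvenClifford.QuadForm E'.val L.val)
    (hq : q.Isometric ((EvenClifford.QuadForm.hyperbolic N.val L.val).perp q'))
    (hq' : q'.IsPrimitive) :
    EvenClifford.IsLocallyFreeOfRank 2 (q'.bimodule N.val) ∧
    EvenClifford.MoritaEquivalent q.evenClifford q'.evenClifford ∧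
    ∃ e : EvenClifford.AlgPresheaf.Iso q.evenClifford.toAlgPresheaf
        (EvenClifford.endAlg q'.evenClifford (q'.bimodule N.val)),
      AlgebraicGeometry.IsIntegral S → EvenClifford.IsLocallyFactorial S → Even n →
        ∃ ζ : EvenClifford.AlgPresheaf.Iso q.evenClifford.center q'.evenClifford.center,
          ∀ (U : (TopologicalSpace.Opens S)ᵒᵖ) (z : q.evenClifford.center.ring.obj U)
            (V : (TopologicalSpace.Opens S)ᵒᵖ) (i : U ⟶ V)
            (p : (q'.bimodule N.val).val.obj V),
            (e.iso.hom.app U z.1).1 V i p =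
              EvenClifford.AlgSheaf.toR
                (q'.evenClifford.ring.map i (ζ.iso.hom.app U z).1) • p := by
  obtain ⟨φ, hφ⟩ := hq
  have hF : q'.LocallyFramed N.val :=
    EvenClifford.QuadForm.exists_isFramed N L hN hL q' hq'
  let ψ : EvenClifford.QuadForm.HypIso q q' N.val := ⟨φ, hφ⟩
  have B := q'.splitBasis hF
  exact ⟨B.isLocallyFreeOfRank, B.moritaEquivalent (ψ.isoEnd hF), ψ.isoEnd hF,
    fun _ _ _ => B.exists_center_iso (ψ.isoEnd hF)⟩
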